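/- Let $k$ be a commutative ring, $A$ a dg algebra over $k$, $n\ge 0$, $R_n=k[t]/(t^{n+1})$, and let $A_n$ be a cdg deformation of $A$ of order $n$: a curved dg (cdg) algebra structure over $R_n$ (a graded associative unital product, an $R_n$-linear derivation $d$ of degree $1$, and a curvature $c$ of degree $2$ with $d(c)=0$ and $d^2=[c,-]$) on the graded $R_n$-module $A\otimes_k R_n$ which reduces modulo $t$ to the dg algebra $A$ (so $c\in tA_n$). An $A_n$-module is a left cdg module, i.e. a graded left module with a derivation $d_M$ of degree $1$ over $d$ such that $d_M^2m=cm$. Let $\mathrm{Hot}(A_n)$ be the triangulated category of $A_n$-modules and homotopy classes of closed morphisms of degree $0$. An $A_n$-module $M$ is $n$-acyclic if the complexes $t^iM/t^{i+1}M$, $0\le i\le n$, are all acyclic; a closed morphism is an $n$-quasi-isomorphism if its cone is $n$-acyclic; $D^n(A_n)$ is the Verdier quotient of $\mathrm{Hot}(A_n)$ by the subcategory of $n$-acyclic modules; and $P$ is $n$-homotopy projective if $\mathrm{Hom}_{\mathrm{Hot}(A_n)}(P,N)=0$ for every $n$-acyclic $N$. Let $A_i=A_n/t^{i+1}A_n$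 for $0\le i\le n$ and $A_{-1}=0$, and choose $\frac ct\in A_n^2$ with $t\cdot\frac ct=c$. Let $\Gamma_i$ be the $A_n$-module with underlying graded module $A_i\oplus A_{i-1}[1]$ and predifferential $d(\alpha,\beta)=\bigl(d\alpha+t\beta,\,-d\beta+\pi(\alpha\tfrac ct)\bigr)$, where $t\colon A_{i-1}\to A_i$ is multiplication by $t$ and $\pi\colon A_i\to A_{i-1}$ is the projection. An $A_n$-module $P$ is $n$-semifree if it has a filtration $0=F_0P\subseteq F_1P\subseteq\cdots$ by cdg submodules with $P=\bigcup_iF_iP$ such that each inclusion $F_iP\subseteq F_{i+1}P$ splits as a morphism of graded modules and each $F_{i+1}P/F_iP$ is isomorphic to a direct sum of copies of shifts of $\Gamma_0,\dots,\Gamma_n$. An $A_n$-module is $n$-cell if it lies in the smallest localizing subcategory (triangulated subcategory closed under small coproducts) of $\mathrm{Hot}(A_n)$ containing $\Gamma_0,\dots,\Gamma_n$. Then: 1. Every $A_n$-module $M$ admits an $n$-semifree, and hence $n$-cell, resolution: there are an $n$-semifree $A_n$-module $P$, which is also $n$-cell, and an $n$-quasi-isomorphism $P\to M$. 2. The quotient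 functor $\mathrm{Hot}(A_n)\to D^n(A_n)$ has a fully faithful left adjoint, whose essential image consists exactly of the $n$-cell modules. 3. An $A_n$-module is $n$-cell if and only if it is $n$-homotopy projective. -/

import Mathlib

open CategoryTheory
open scoped TensorProduct

universe u v

/-! ### Curved dg algebras -/

/-- A cdg algebra over a commutative ring `R`: a `ℤ`-graded associative unital `R`-algebra with an
`R`-linear derivation `d` of degree `1` (the predifferential) and a curvature `curv` of degree `2`
such that `d curv = 0` and `d² = [curv, -]`. -/
structure CDGAlgebra (R : Type v) [CommRing R] where
  carrier : Type u
  [ring : Ring carrier]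
  [algebra : Algebra R carrier]
  gr : ℤ → Submodule R carrier
  [graded : GradedAlgebra gr]
  d : carrier →ₗ[R] carrier
  d_mem : ∀ {i : ℤ} {a : carrier}, a ∈ gr i → d a ∈ gr (i + 1)
  leibniz : ∀ {i : ℤ} {a : carrier}, a ∈ gr i → ∀ b : carrier,
    d (a * b) = d a * b + i.negOnePow • (a * d b)
  curv : carrier
  curv_mem : curv ∈ gr 2
  d_curv : d curv = 0
  d_d : ∀ a : carrier, d (d a) = curv * a - a * curv

attribute [instance] CDGAlgebra.ring CDGAlgebra.algebra CDGAlgebra.graded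

/-- A dg algebra is a cdg algebra whose curvature vanishes. -/
structure DGAlgebra (R : Type v) [CommRing R] extends CDGAlgebra.{u, v} R where
  curv_eq_zero : curv = 0

namespace CDGAlgebra

variable {R : Type v} [CommRing R] (B : CDGAlgebra.{u, v} R)

/-- The unit, as an element of degree `0`. -/
def oneH : B.gr 0 := ⟨1, SetLike.one_mem_graded B.gr⟩

/-- The curvature, as an element of degree `2`. -/
def curvH : B.gr 2 := ⟨B.curv, B.curv_mem⟩

variable {B}

/-- The product of homogeneous elements. -/
def mulH {i j l : ℤ} (h : i + j = l) (a : B.gr i) (b : B.gr j) : B.gr l :=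
  ⟨a.1 * b.1, h ▸ SetLike.mul_mem_graded a.2 b.2⟩

/-- The predifferential on homogeneous elements. -/
def dH {i j : ℤ} (h : i + 1 = j) (a : B.gr i) : B.gr j :=
  ⟨B.d a.1, h ▸ B.d_mem a.2⟩

end CDGAlgebra

/-! ### Left cdg modules -/

/-- A left cdg module over the cdg algebra `B`, given by its homogeneous components `X i`: a graded
left module over the graded algebra underlying `B`, with a derivation `d` of degree `1` over the
predifferential of `B` such that `d² x = c x`, where `c` is the curvature of `B`. (The base ring
acts through the elements of degree `0` of `B`, and `d` is automatically linear over it.) -/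
structure CDGModule {R : Type v} [CommRing R] (B : CDGAlgebra.{u, v} R) where
  X : ℤ → Type u
  [grp : ∀ i, AddCommGroup (X i)]
  smul : ∀ {i j l : ℤ}, i + j = l → B.gr i →+ X j →+ X l
  one_smul : ∀ {j : ℤ} (x : X j), smul (zero_add j) B.oneH x = x
  mul_smul : ∀ {i i' j m l p : ℤ} (h : i + i' = m) (h' : i' + j = l) (h'' : i + l = p)
    (a : B.gr i) (b : B.gr i') (x : X j),
    smul (show m + j = p by omega) (CDGAlgebra.mulH h a b) x = smul h'' a (smul h' b x)
  d : ∀ {i j : ℤ}, i + 1 = j → X i →+ X j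
  leibniz : ∀ {i j l i' j' l' : ℤ} (h : i + j = l) (hi : i + 1 = i') (hj : j + 1 = j')
    (hl : l + 1 = l') (a : B.gr i) (x : X j),
    d hl (smul h a x) = smul (show i' + j = l' by omega) (CDGAlgebra.dH hi a) x +
      i.negOnePow • smul (show i + j' = l' by omega) a (d hj x)
  d_d : ∀ {i j l : ℤ} (h : i + 1 = j) (h' : j + 1 = l) (x : X i),
    d h' (d h x) = smul (show 2 + i = l by omega) B.curvH x

attribute [instance] CDGModule.grp

namespace CDGModule

section

variable {R : Type v} [CommRing R] {B : CDGAlgebra.{u, v} R}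

/-- Closed morphisms of degree `0`: `B`-linear maps of degree `0` commuting with `d`. -/
@[ext]
structure Hom (M N : CDGModule.{u, v} B) where
  f : ∀ i, M.X i →+ N.X i
  map_smul : ∀ {i j l : ℤ} (h : i + j = l) (a : B.gr i) (x : M.X j),
    f l (M.smul h a x) = N.smul h a (f j x)
  map_d : ∀ {i j : ℤ} (h : i + 1 = j) (x : M.X i), f j (M.d h x) = N.d h (f i x)

/-- The category `Z⁰(B-Mod)` of cdg modules and closed morphisms of degree `0`. -/
instance : Category (CDGModule.{u, v} B) where
  Hom := Hom
  id M := ⟨fun i => AddMonoidHom.id _, fun _ _ _ => rfl, fun _ _ => rfl⟩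
  comp f g := ⟨fun i => (g.f i).comp (f.f i),
    fun h a x => by simp [f.map_smul, g.map_smul], fun h x => by simp [f.map_d, g.map_d]⟩

/-- Two closed morphisms `f`, `g` of degree `0` are homotopic if `f - g = d h + h d` for a
`B`-linear map `h` of degree `-1`; linearity means `h (a x) = (-1)^{|a|} a (h x)`. -/
def Homotopic : HomRel (CDGModule.{u, v} B) := fun M N f g =>
  ∃ s : ∀ {i j : ℤ}, i = j + 1 → M.X i →+ N.X j,
    (∀ {i j l j' l' : ℤ} (h : i + j = l) (hj : j = j' + 1) (hl : l = l' + 1)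
      (a : B.gr i) (x : M.X j),
      s hl (M.smul h a x) = i.negOnePow • N.smul (show i + j' = l' by omega) a (s hj x)) ∧
    ∀ {i p q : ℤ} (hp : i = p + 1) (hq : i + 1 = q) (x : M.X i),
      f.f i x - g.f i x = N.d hp.symm (s hp x) + s hq.symm (M.d hq x)

/-- Homotopy is a congruence, so the morphisms of the homotopy category below are exactly the
homotopy classes of closed morphisms. -/
instance : Congruence (Homotopic (B := B)) where
  equivalence := by
    intro M N
    refine ⟨?_, ?_, ?_⟩
    · intro f
      exact ⟨fun _ => 0, by intros; simp, by intros; simp⟩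
    · rintro f g ⟨s, hs, h⟩
      refine ⟨fun e => -s e, ?_, ?_⟩
      · intro i j l j' l' h hj hl a x
        simp [hs h hj hl]
      · intro i p q hp hq x
        have := h hp hq x
        simp only [AddMonoidHom.neg_apply, map_neg]
        rw [← neg_sub, this]; abel
    · rintro f g k ⟨s, hs, h⟩ ⟨s', hs', h'⟩
      refine ⟨fun e => s e + s' e, ?_, ?_⟩
      · intro i j l j' l' h hj hl a x
        simp [hs h hj hl, hs' h hj hl]
      · intro i p q hp hq x
        have e := h hp hq x
        have e' := h' hp hq x
        simp only [AddMonoidHom.add_apply, map_add]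
        rw [← sub_add_sub_cancel _ (g.f i x), e, e']; abel
  comp_left := by
    rintro M N L f g g' ⟨s, hs, h⟩
    refine ⟨fun e => (s e).comp (f.f _), ?_, ?_⟩
    · intro i j l j' l' h hj hl a x
      simp [f.map_smul, hs h hj hl]
    · intro i p q hp hq x
      have := h hp hq (f.f i x)
      rw [← f.map_d] at this
      exact this
  comp_right := by
    rintro M N L f f' g ⟨s, hs, h⟩
    refine ⟨fun e => (g.f _).comp (s e), ?_, ?_⟩
    · intro i j l j' l' h hj hl a x
      simp [hs h hj hl, ← g.map_smul, Units.smul_def]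
    · intro i p q hp hq x
      have := congrArg (g.f i) (h hp hq x)
      simp only [map_sub, map_add, g.map_d] at this
      exact this

/-- The shift `M[p]`: `M[p]ⁱ = M^{i+p}`, with `d` multiplied by `(-1)^p` and with `a` acting as
`(-1)^{p|a|} a`. -/
def shift (M : CDGModule.{u, v} B) (p : ℤ) : CDGModule.{u, v} B where
  X i := M.X (i + p)
  smul {i j l} h :=
    { toFun := fun a => (p * i).negOnePow • M.smul (show i + (j + p) = l + p by omega) a
      map_zero' := by simp
      map_add' := fun a b => by simp }
  one_smul x := by
    have h : ∀ {j l : ℤ} (e : j = l) (e' : 0 + j = l) (y : M.X j),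
        M.smul e' B.oneH y = e ▸ y := by
      intro j l e e' y
      subst e
      exact M.one_smul y
    simpa using h rfl _ x
  mul_smul {i i' j m l q} h h' h'' a b x := by
    have := M.mul_smul h (show i' + (j + p) = l + p by omega)
      (show i + (l + p) = q + p by omega) a b x
    subst h
    simp [this, mul_add, Int.negOnePow_add, Units.smul_def, smul_smul]
  d {i j} h := p.negOnePow • M.d (show i + p + 1 = j + p by omega)
  leibniz {i j l i' j' l'} h hi hj hl a x := by
    have := M.leibniz (show i + (j + p) = l + p by omega) hi
      (show j + p + 1 = j' + p by omega) (show l + p + 1 = l' + p by omega) a x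
    subst hi
    simp only [AddMonoidHom.coe_mk, ZeroHom.coe_mk, AddMonoidHom.smul_apply, Units.smul_def,
      map_zsmul, this, smul_add, smul_smul]
    congr 2
    · norm_cast
      rw [← Int.negOnePow_add, mul_add, mul_one, add_comm]
    · norm_cast
      simp only [← Int.negOnePow_add]
      congr 1
      ring
  d_d {i j l} h h' x := by
    have := M.d_d (show i + p + 1 = j + p by omega) (show j + p + 1 = l + p by omega) x
    have e : (p * 2).negOnePow = 1 := Int.negOnePow_even _ ⟨p, by ring⟩
    simp [this, Units.smul_def, smul_smul, e]

@[simp]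
lemma shift_smul (M : CDGModule.{u, v} B) (p : ℤ) {i j l : ℤ} (h : i + j = l) (a : B.gr i)
    (x : M.X (j + p)) : (M.shift p).smul h a x =
      (p * i).negOnePow • M.smul (show i + (j + p) = l + p by omega) a x := rfl

@[simp]
lemma shift_d (M : CDGModule.{u, v} B) (p : ℤ) {i j : ℤ} (h : i + 1 = j) (x : M.X (i + p)) :
    (M.shift p).d h x = p.negOnePow • M.d (show i + p + 1 = j + p by omega) x := rfl

/-- The identification of the components of equal degrees. -/
def castX (M : CDGModule.{u, v} B) {i j : ℤ} (h : i = j) : M.X i →+ M.X j :=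
  h ▸ AddMonoidHom.id (M.X i)

@[simp]
lemma castX_rfl (M : CDGModule.{u, v} B) {i : ℤ} (x : M.X i) : M.castX rfl x = x := rfl

/-- The cone of a closed morphism `f : M ⟶ N`: the graded module `M[1] ⊕ N` with
`d (x, y) = (d_{M[1]} x, f x + d y)`, where `d_{M[1]} = -d_M`. -/
def cone {M N : CDGModule.{u, v} B} (f : M ⟶ N) : CDGModule.{u, v} B where
  X i := (M.shift 1).X i × N.X i
  smul {i j l} h :=
    { toFun := fun a => AddMonoidHom.prodMap ((M.shift 1).smul h a) (N.smul h a)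
      map_zero' := by ext <;> simp
      map_add' := fun a b => by ext <;> simp }
  one_smul x := Prod.ext ((M.shift 1).one_smul x.1) (N.one_smul x.2)
  mul_smul h h' h'' a b x :=
    Prod.ext ((M.shift 1).mul_smul h h' h'' a b x.1) (N.mul_smul h h' h'' a b x.2)
  d {i j} h := AddMonoidHom.mk'
    (fun x => ((M.shift 1).d h x.1, f.f j (M.castX h x.1) + N.d h x.2))
    (fun x y => Prod.ext (map_add _ x.1 y.1) (by
      change f.f j (M.castX h (x.1 + y.1)) + N.d h (x.2 + y.2) =
        f.f j (M.castX h x.1) + N.d h x.2 + (f.f j (M.castX h y.1) + N.d h y.2)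
      have e : M.castX h (x.1 + y.1) = M.castX h x.1 + M.castX h y.1 := map_add (M.castX h) _ _
      rw [e, map_add, map_add]; abel))
  leibniz {i j l i' j' l'} h hi hj hl a x := by
    refine Prod.ext ((M.shift 1).leibniz h hi hj hl a x.1) ?_
    have h2 := N.leibniz h hi hj hl a x.2
    subst hi hj hl
    have h3 := f.map_smul (show i + (j + 1) = l + 1 by omega) a x.1
    change f.f (l + 1) ((1 * i).negOnePow • M.smul _ a x.1) + N.d rfl (N.smul h a x.2) =
      N.smul _ (CDGAlgebra.dH rfl a) x.2 + i.negOnePow • N.smul _ a (f.f (j + 1) x.1 + N.d rfl x.2)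
    simp only [one_mul, Units.smul_def, map_zsmul, map_add, h2, h3, smul_add]
    abel
  d_d {i j l} h h' x := by
    refine Prod.ext ((M.shift 1).d_d h h' x.1) ?_
    have h2 := N.d_d h h' x.2
    subst h h'
    have h3 := f.map_d rfl x.1
    change f.f (i + 1 + 1) ((1 : ℤ).negOnePow • M.d _ x.1) +
      N.d rfl (f.f (i + 1) x.1 + N.d rfl x.2) = N.smul _ B.curvH x.2
    simp [h2, h3]

/-- The direct sum of a family of cdg modules. -/
noncomputable def directSum {ι : Type u} (M : ι → CDGModule.{u, v} B) : CDGModule.{u, v} B where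
  X i := DirectSum ι fun s => (M s).X i
  smul h :=
    { toFun := fun a => DirectSum.map fun s => (M s).smul h a
      map_zero' := AddMonoidHom.ext fun x => DFinsupp.ext fun s =>
        congrArg (fun g => g (x s)) (map_zero ((M s).smul h))
      map_add' := fun a b => AddMonoidHom.ext fun x => DFinsupp.ext fun s =>
        congrArg (fun g => g (x s)) (map_add ((M s).smul h) a b) }
  one_smul x := DFinsupp.ext fun s => (M s).one_smul (x s)
  mul_smul h h' h'' a b x := DFinsupp.ext fun s => (M s).mul_smul h h' h'' a b (x s)
  d h := DirectSum.map fun s => (M s).d h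
  leibniz h hi hj hl a x := DFinsupp.ext fun s => (M s).leibniz h hi hj hl a (x s)
  d_d h h' x := DFinsupp.ext fun s => (M s).d_d h h' (x s)

/-- A cdg submodule of `P`: a graded submodule stable under `d`. -/
@[ext]
structure Sub (P : CDGModule.{u, v} B) where
  S : ∀ i, AddSubgroup (P.X i)
  smul_mem : ∀ {i j l : ℤ} (h : i + j = l) (a : B.gr i) {x : P.X j}, x ∈ S j → P.smul h a x ∈ S l
  d_mem : ∀ {i j : ℤ} (h : i + 1 = j) {x : P.X i}, x ∈ S i → P.d h x ∈ S j

/-- A cdg submodule, regarded as a cdg module. -/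
def Sub.toModule {P : CDGModule.{u, v} B} (F : Sub P) : CDGModule.{u, v} B where
  X i := F.S i
  smul {i j l} h :=
    { toFun := fun a => ((P.smul h a).comp (F.S j).subtype).codRestrict (F.S l)
        fun x => F.smul_mem h a x.2
      map_zero' := by ext; simp
      map_add' := fun a b => by ext; simp }
  one_smul x := Subtype.ext (P.one_smul x.1)
  mul_smul h h' h'' a b x := Subtype.ext (P.mul_smul h h' h'' a b x.1)
  d {i j} h := ((P.d h).comp (F.S i).subtype).codRestrict (F.S j) fun x => F.d_mem h x.2
  leibniz h hi hj hl a x := Subtype.ext (by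
    simpa [Units.smul_def] using P.leibniz h hi hj hl a x.1)
  d_d h h' x := Subtype.ext (P.d_d h h' x.1)

/-- The inclusion of nested cdg submodules. -/
def Sub.incl {P : CDGModule.{u, v} B} {F G : Sub P} (h : ∀ i, F.S i ≤ G.S i) :
    F.toModule ⟶ G.toModule where
  f i := AddSubgroup.inclusion (h i)
  map_smul _ _ _ := rfl
  map_d _ _ := rfl

/-- A closed morphism which is a split monomorphism of graded modules: it has a retraction which
is linear over the graded algebra underlying `B`, and need not commute with `d`. -/
def IsGradedSplitMono {M N : CDGModule.{u, v} B} (f : M ⟶ N) : Prop :=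
  ∃ r : ∀ i, N.X i →+ M.X i,
    (∀ {i j l : ℤ} (h : i + j = l) (a : B.gr i) (y : N.X j),
      r l (N.smul h a y) = M.smul h a (r j y)) ∧
    ∀ i (x : M.X i), r i (f.f i x) = x

/-- `q` exhibits its target as the cokernel `N / f(M)`. -/
def IsQuotientBy {M N Q : CDGModule.{u, v} B} (f : M ⟶ N) (q : N ⟶ Q) : Prop :=
  ∀ i, Function.Surjective (q.f i) ∧ ∀ y : N.X i, q.f i y = 0 ↔ ∃ x, f.f i x = y

/-- `P` is semifree on the family `X`: it has a filtration `0 = F 0 ⊆ F 1 ⊆ ...` by cdg submodules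
whose union is `P`, such that the inclusions `F m ⊆ F (m + 1)` split as morphisms of graded modules
and `F (m + 1) / F m` is isomorphic to a direct sum of copies of shifts of members of `X`. -/
def IsSemifree {σ : Type} (X : σ → CDGModule.{u, v} B) (P : CDGModule.{u, v} B) : Prop :=
  ∃ (F : ℕ → Sub P) (hF : ∀ m i, (F m).S i ≤ (F (m + 1)).S i),
    (∀ i, (F 0).S i = ⊥) ∧
    (∀ i (x : P.X i), ∃ m, x ∈ (F m).S i) ∧
    ∀ m, IsGradedSplitMono (Sub.incl (hF m)) ∧
      ∃ (ι : Type u) (s : ι → σ) (p : ι → ℤ)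
        (q : (F (m + 1)).toModule ⟶ directSum fun t => (X (s t)).shift (p t)),
        IsQuotientBy (Sub.incl (hF m)) q

end

end CDGModule

/-! ### The homotopy category -/

/-- The homotopy category `Hot(B) = H⁰(B-Mod)`: cdg modules and homotopy classes of closed
morphisms of degree `0`. -/
abbrev Hot {R : Type v} [CommRing R] (B : CDGAlgebra.{u, v} R) :=
  CategoryTheory.Quotient (CDGModule.Homotopic (B := B))

namespace Hot

section

variable {R : Type v} [CommRing R] {B : CDGAlgebra.{u, v} R}

/-- A cdg module, as an object of the homotopy category. -/
def of (M : CDGModule.{u, v} B) : Hot B := ⟨M⟩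

/-- The homotopy class of a closed morphism. -/
def mk {M N : CDGModule.{u, v} B} (f : M ⟶ N) : of M ⟶ of N :=
  (CategoryTheory.Quotient.functor _).map f

/-- A localizing subcategory of `Hot(B)`: a full subcategory which is triangulated, i.e. stable
under isomorphisms, under all shifts, and under two out of three in the triangles
`M ⟶ N ⟶ cone f ⟶ M[1]`, and which is closed under small coproducts. (Every distinguished triangle
of `Hot(B)` is isomorphic to such a cone triangle.) -/
structure IsLocalizing (T : ObjectProperty (Hot B)) : Prop where
  iso : T.IsClosedUnderIsomorphisms
  zero : ∀ Z : Hot B, Limits.IsZero Z → T Z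
  shift : ∀ (M : CDGModule.{u, v} B) (p : ℤ), T (of M) → T (of (M.shift p))
  cone₁ : ∀ {M N : CDGModule.{u, v} B} (f : M ⟶ N),
    T (of N) → T (of (CDGModule.cone f)) → T (of M)
  cone₂ : ∀ {M N : CDGModule.{u, v} B} (f : M ⟶ N),
    T (of M) → T (of (CDGModule.cone f)) → T (of N)
  cone₃ : ∀ {M N : CDGModule.{u, v} B} (f : M ⟶ N),
    T (of M) → T (of N) → T (of (CDGModule.cone f))
  coproduct : ∀ (ι : Type u) (Y : ι → Hot B) (c : Limits.Cofan Y),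
    Nonempty (Limits.IsColimit c) → (∀ s, T (Y s)) → T c.pt

/-- `M` is `X`-cell: it lies in the smallest localizing subcategory containing all `X s`. -/
def IsCell {σ : Type} (X : σ → CDGModule.{u, v} B) (M : Hot B) : Prop :=
  ∀ T : ObjectProperty (Hot B), IsLocalizing T → (∀ s, T (of (X s))) → T M

end

end Hot

/-! ### Deformations -/

/-- The ring `R_n = k[t]/(t^{n+1})`. -/
abbrev TruncPoly (k : Type v) [CommRing k] (n : ℕ) : Type v :=
  AdjoinRoot (Polynomial.X ^ (n + 1) : Polynomial k)

namespace TruncPoly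

/-- The class `t` of the variable. -/
noncomputable def t (k : Type v) [CommRing k] (n : ℕ) : TruncPoly k n := AdjoinRoot.root _

/-- The reduction `R_n → k`, `t ↦ 0`. -/
noncomputable def aug (k : Type v) [CommRing k] (n : ℕ) : TruncPoly k n →ₐ[k] k :=
  AdjoinRoot.liftAlgHom _ (AlgHom.id k k) 0 (by simp)

/-- The reduction modulo `t`, `R_n ⊗ V → V`, `r ⊗ a ↦ (r mod t) a`. -/
noncomputable def red (k : Type v) [CommRing k] (n : ℕ) (V : Type u) [AddCommGroup V]
    [Module k V] : TruncPoly k n ⊗[k] V →ₗ[k] V :=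
  TensorProduct.lift ((LinearMap.lsmul k V).comp (aug k n).toLinearMap)

end TruncPoly

/-- A cdg deformation of order `n` of the dg algebra `A`: a cdg algebra over `R_n = k[t]/(t^{n+1})`
whose underlying graded `R_n`-module is (identified by `e` with) `R_n ⊗ A`, and which reduces modulo
`t` to the dg algebra `A`: the reduction is a morphism of unital algebras, commutes with the
differentials, and sends the curvature to `0`. -/
structure CDGDeformation {k : Type v} [CommRing k] (A : DGAlgebra.{u, v} k) (n : ℕ)
    extends CDGAlgebra.{u, v} (TruncPoly k n) where
  e : TruncPoly k n ⊗[k] A.carrier ≃ₗ[TruncPoly k n] carrier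
  e_mem : ∀ (r : TruncPoly k n) {i : ℤ} {a : A.carrier}, a ∈ A.gr i → e (r ⊗ₜ a) ∈ gr i
  red_one : TruncPoly.red k n A.carrier (e.symm 1) = 1
  red_mul : ∀ x y : carrier, TruncPoly.red k n A.carrier (e.symm (x * y)) =
    TruncPoly.red k n A.carrier (e.symm x) * TruncPoly.red k n A.carrier (e.symm y)
  red_d : ∀ x : carrier, TruncPoly.red k n A.carrier (e.symm (d x)) =
    A.d (TruncPoly.red k n A.carrier (e.symm x))
  red_curv : TruncPoly.red k n A.carrier (e.symm curv) = 0

/-- Division by `t` on `R_n` with remainders. -/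
lemma TruncPoly.exists_div (k : Type v) [CommRing k] (n : ℕ) :
    ∃ (σ : TruncPoly k n →ₗ[k] TruncPoly k n) (π : TruncPoly k n →ₗ[k] k),
      (∀ r, algebraMap k _ (aug k n r) + t k n * σ r = r) ∧
      ∀ r, σ (t k n * r) + t k n ^ n * algebraMap k _ (π r) = r := by
  rcases subsingleton_or_nontrivial k with hk | hk
  · have : Subsingleton (TruncPoly k n) := Module.subsingleton k _
    exact ⟨0, 0, fun r => Subsingleton.elim _ _, fun r => Subsingleton.elim _ _⟩
  have hm : (Polynomial.X ^ (n + 1) : Polynomial k).Monic := Polynomial.monic_X_pow _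
  let b := (AdjoinRoot.powerBasis' hm).basis.reindex
    (finCongr (show (AdjoinRoot.powerBasis' hm).dim = n + 1 by simp))
  have hb : ∀ i : Fin (n + 1), b i = t k n ^ (i : ℕ) := fun i => by
    simp [b, t, AdjoinRoot.powerBasis'_gen]
  have ht : t k n ^ (n + 1) = 0 := by
    have := AdjoinRoot.eval₂_root (Polynomial.X ^ (n + 1) : Polynomial k)
    simpa [t] using this
  have haug : aug k n (t k n) = 0 := by simp [aug, t]
  let σ : TruncPoly k n →ₗ[k] TruncPoly k n :=
    b.constr k fun i => if (i : ℕ) = 0 then 0 else t k n ^ ((i : ℕ) - 1)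
  have hσ : ∀ m (hm : m < n + 1), σ (t k n ^ m) = if m = 0 then 0 else t k n ^ (m - 1) := by
    intro m hm
    have := b.constr_basis k (fun i : Fin (n + 1) =>
      if (i : ℕ) = 0 then (0 : TruncPoly k n) else t k n ^ ((i : ℕ) - 1)) ⟨m, hm⟩
    rwa [hb] at this
  refine ⟨σ, b.coord (Fin.last n), fun r => ?_, fun r => ?_⟩
  · have : Algebra.linearMap k (TruncPoly k n) ∘ₗ (aug k n).toLinearMap +
        LinearMap.mulLeft k (t k n) ∘ₗ σ = LinearMap.id := by
      refine b.ext fun ⟨m, hm⟩ => ?_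
      simp only [hb, LinearMap.add_apply, LinearMap.comp_apply, AlgHom.toLinearMap_apply, map_pow,
        haug, hσ m hm, LinearMap.mulLeft_apply, LinearMap.id_apply, Algebra.linearMap_apply]
      rcases m with _ | m
      · simp
      · simp [pow_succ']
    exact LinearMap.congr_fun this r
  · have : σ ∘ₗ LinearMap.mulLeft k (t k n) + LinearMap.mulLeft k (t k n ^ n) ∘ₗ
        Algebra.linearMap k (TruncPoly k n) ∘ₗ b.coord (Fin.last n) = LinearMap.id := by
      refine b.ext fun i => ?_
      simp only [LinearMap.add_apply, LinearMap.comp_apply, LinearMap.mulLeft_apply,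
        LinearMap.id_apply, Algebra.linearMap_apply, Module.Basis.coord_apply,
        Module.Basis.repr_self, Finsupp.single_apply]
      rw [hb, ← pow_succ']
      by_cases h : i = Fin.last n
      · subst h
        simp [ht]
      · have : (i : ℕ) < n := Fin.val_lt_last h
        rw [hσ _ (by omega)]
        simp [h]
    exact LinearMap.congr_fun this r

namespace CDGDeformation

section

variable {k : Type v} [CommRing k] {A : DGAlgebra.{u, v} k} {n : ℕ} (D : CDGDeformation A n)

lemma exists_t_smul_eq {x : D.carrier} (hx : TruncPoly.red k n A.carrier (D.e.symm x) = 0) :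
    ∃ y, TruncPoly.t k n • y = x := by
  obtain ⟨σ, -, h, -⟩ := TruncPoly.exists_div k n
  have key : ∀ z : TruncPoly k n ⊗[k] A.carrier,
      1 ⊗ₜ TruncPoly.red k n A.carrier z + TruncPoly.t k n • σ.rTensor A.carrier z = z := by
    intro z
    induction z with
    | zero => simp
    | tmul r a =>
      conv_rhs => rw [← h r]
      simp only [TruncPoly.red, TensorProduct.lift.tmul, LinearMap.comp_apply,
        AlgHom.toLinearMap_apply, LinearMap.lsmul_apply, LinearMap.rTensor_tmul,
        TensorProduct.add_tmul, Algebra.algebraMap_eq_smul_one, TensorProduct.tmul_smul,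
        TensorProduct.smul_tmul', smul_eq_mul]
    | add z w hz hw =>
      conv_rhs => rw [← hz, ← hw]
      simp only [map_add, TensorProduct.tmul_add, smul_add]
      abel
  refine ⟨D.e (σ.rTensor A.carrier (D.e.symm x)), ?_⟩
  have := key (D.e.symm x)
  rw [hx, TensorProduct.tmul_zero, zero_add] at this
  rw [← map_smul, this, LinearEquiv.apply_symm_apply]

lemma exists_pow_smul_eq {x : D.carrier} (hx : TruncPoly.t k n • x = 0) : ∃ y, TruncPoly.t k n ^ n • y = x := by
  obtain ⟨σ, π, -, h⟩ := TruncPoly.exists_div k n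
  let ρ : TruncPoly k n →ₗ[k] TruncPoly k n := Algebra.linearMap k _ ∘ₗ π
  have key : ∀ z : TruncPoly k n ⊗[k] A.carrier,
      σ.rTensor A.carrier (TruncPoly.t k n • z) + TruncPoly.t k n ^ n • ρ.rTensor A.carrier z = z := by
    intro z
    induction z with
    | zero => simp
    | tmul r a =>
      conv_rhs => rw [← h r]
      simp [ρ, TensorProduct.add_tmul, TensorProduct.smul_tmul']
    | add z w hz hw =>
      conv_rhs => rw [← hz, ← hw]
      simp only [map_add, smul_add]
      abel
  refine ⟨D.e (ρ.rTensor A.carrier (D.e.symm x)), ?_⟩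
  have := key (D.e.symm x)
  rw [← map_smul, hx, map_zero, map_zero, zero_add] at this
  rw [← map_smul, this, LinearEquiv.apply_symm_apply]

lemma exists_homogeneous {i : ℤ} (x : D.gr i) (r : TruncPoly k n) (h : ∃ y, r • y = x.1) :
    ∃ y : D.gr i, r • y = x := by
  obtain ⟨y, hy⟩ := h
  refine ⟨DirectSum.decompose D.gr y i, ?_⟩
  have h1 := congrArg (fun z => DirectSum.decompose D.gr z i) hy
  simp only [DirectSum.decompose_smul, DirectSum.decompose_coe, DirectSum.of_eq_same] at h1
  exact h1

lemma exists_curvDivT : ∃ y : D.gr 2, TruncPoly.t k n • y = D.curvH :=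
  D.exists_homogeneous D.curvH _ (D.exists_t_smul_eq D.red_curv)

/-- An element `c/t` of degree `2` with `t (c/t) = c`. -/
noncomputable def curvDivT : D.gr 2 := D.exists_curvDivT.choose

lemma t_smul_curvDivT : TruncPoly.t k n • D.curvDivT.1 = D.curv :=
  congrArg Subtype.val D.exists_curvDivT.choose_spec

lemma exists_pow_smul_eq_d_curvDivT {i : ℕ} (hi : i ≤ n) :
    ∃ y : D.gr 3, TruncPoly.t k n ^ i • y.1 = D.d D.curvDivT.1 := by
  have h : TruncPoly.t k n • D.d D.curvDivT.1 = 0 := by rw [← map_smul, t_smul_curvDivT, D.d_curv]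
  obtain ⟨y, hy⟩ := D.exists_pow_smul_eq h
  obtain ⟨z, hz⟩ := D.exists_homogeneous ⟨D.d D.curvDivT.1, D.d_mem D.curvDivT.2⟩ (TruncPoly.t k n ^ i)
    ⟨TruncPoly.t k n ^ (n - i) • y, by rw [smul_smul, ← pow_add, Nat.add_sub_cancel' hi, hy]⟩
  exact ⟨z, congrArg Subtype.val hz⟩

/-- The component of degree `j` of `A_n / t^m A_n`. For `m = i + 1` this is the `j`-th component of
the induced deformation `A_i` of order `i`, and for `m = 0` it is `0`. -/
abbrev trunc (m : ℕ) (j : ℤ) : Type u :=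
  D.gr j ⧸ LinearMap.range (TruncPoly.t k n ^ m • (LinearMap.id : D.gr j →ₗ[TruncPoly k n] D.gr j))

variable {D}

/-- The map `A_n / t^m A_n → A_n / t^{m'} A_n`, `m' ≤ m`, induced by an `R_n`-linear map. -/
noncomputable def truncMap {m m' : ℕ} (hm : m' ≤ m) {j l : ℤ} (φ : D.gr j →ₗ[TruncPoly k n] D.gr l) :
    D.trunc m j →ₗ[TruncPoly k n] D.trunc m' l :=
  Submodule.mapQ _ _ φ (by
    rintro _ ⟨x, rfl⟩
    refine ⟨TruncPoly.t k n ^ (m - m') • φ x, ?_⟩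
    simp [smul_smul, ← pow_add, Nat.sub_add_cancel hm])

/-- Multiplication by `t`, as a map `A_n / t^m A_n → A_n / t^{m+1} A_n`. -/
noncomputable def tMap (m : ℕ) {j l : ℤ} (h : j = l) : D.trunc m j →ₗ[TruncPoly k n] D.trunc (m + 1) l :=
  Submodule.mapQ _ _ (TruncPoly.t k n • Submodule.inclusion (h ▸ le_rfl : D.gr j ≤ D.gr l)) (by
    rintro _ ⟨x, rfl⟩
    refine ⟨Submodule.inclusion (h ▸ le_rfl : D.gr j ≤ D.gr l) x, ?_⟩
    simp [smul_smul, pow_succ])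

/-- Left multiplication by a homogeneous element. -/
noncomputable def mulLeft {i j l : ℤ} (h : i + j = l) (a : D.gr i) : D.gr j →ₗ[TruncPoly k n] D.gr l where
  toFun := CDGAlgebra.mulH h a
  map_add' x y := Subtype.ext (mul_add a.1 x.1 y.1)
  map_smul' r x := Subtype.ext (mul_smul_comm r a.1 x.1)

/-- Right multiplication by a homogeneous element. -/
noncomputable def mulRight {i j l : ℤ} (h : j + i = l) (a : D.gr i) : D.gr j →ₗ[TruncPoly k n] D.gr l where
  toFun x := CDGAlgebra.mulH h x a
  map_add' x y := Subtype.ext (add_mul x.1 y.1 a.1)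
  map_smul' r x := Subtype.ext (smul_mul_assoc r x.1 a.1)

/-- The predifferential in a fixed degree. -/
noncomputable def dLin {i j : ℤ} (h : i + 1 = j) : D.gr i →ₗ[TruncPoly k n] D.gr j where
  toFun := CDGAlgebra.dH h
  map_add' x y := Subtype.ext (map_add D.d x.1 y.1)
  map_smul' r x := Subtype.ext (map_smul D.d r x.1)

lemma truncMap_mk {m m' : ℕ} (hm : m' ≤ m) {j l : ℤ} (φ : D.gr j →ₗ[TruncPoly k n] D.gr l)
    (x : D.gr j) : truncMap hm φ (Submodule.Quotient.mk x) = Submodule.Quotient.mk (φ x) := rfl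

lemma tMap_mk (m : ℕ) {j l : ℤ} (h : j = l) (x : D.gr j) :
    tMap m h (Submodule.Quotient.mk x) =
      Submodule.Quotient.mk (TruncPoly.t k n • Submodule.inclusion (h ▸ le_rfl : D.gr j ≤ D.gr l) x) := rfl

lemma mulLeft_zero {i j l : ℤ} (h : i + j = l) : mulLeft h (0 : D.gr i) = 0 :=
  LinearMap.ext fun x => Subtype.ext (zero_mul x.1)

lemma mulLeft_add {i j l : ℤ} (h : i + j = l) (a b : D.gr i) :
    mulLeft h (a + b) = mulLeft h a + mulLeft h b :=
  LinearMap.ext fun x => Subtype.ext (add_mul a.1 b.1 x.1)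

lemma mulLeft_one {j : ℤ} (h : 0 + j = j) : mulLeft h D.oneH = LinearMap.id :=
  LinearMap.ext fun x => Subtype.ext (one_mul x.1)

lemma mulLeft_mul {i i' j l m p : ℤ} (h : i + i' = m) (h' : i' + j = l) (h'' : i + l = p)
    (h''' : m + j = p) (a : D.gr i) (b : D.gr i') :
    mulLeft h''' (CDGAlgebra.mulH h a b) = mulLeft h'' a ∘ₗ mulLeft h' b :=
  LinearMap.ext fun x => Subtype.ext (mul_assoc a.1 b.1 x.1)

lemma truncMap_zero {m m' : ℕ} (hm : m' ≤ m) {j l : ℤ} :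
    truncMap hm (0 : D.gr j →ₗ[TruncPoly k n] D.gr l) = 0 :=
  LinearMap.ext fun x => by
    obtain ⟨x, rfl⟩ := Submodule.Quotient.mk_surjective _ x
    rfl

lemma truncMap_add {m m' : ℕ} (hm : m' ≤ m) {j l : ℤ}
    (φ ψ : D.gr j →ₗ[TruncPoly k n] D.gr l) :
    truncMap hm (φ + ψ) = truncMap hm φ + truncMap hm ψ :=
  LinearMap.ext fun x => by
    obtain ⟨x, rfl⟩ := Submodule.Quotient.mk_surjective _ x
    rfl

lemma truncMap_id (m : ℕ) {j : ℤ} :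
    truncMap (le_refl m) (LinearMap.id : D.gr j →ₗ[TruncPoly k n] D.gr j) = LinearMap.id :=
  LinearMap.ext fun x => by
    obtain ⟨x, rfl⟩ := Submodule.Quotient.mk_surjective _ x
    rfl

lemma truncMap_comp {m m' m'' : ℕ} (hm : m' ≤ m) (hm' : m'' ≤ m') {j l p : ℤ}
    (φ : D.gr j →ₗ[TruncPoly k n] D.gr l) (ψ : D.gr l →ₗ[TruncPoly k n] D.gr p)
    (x : D.trunc m j) :
    truncMap (hm'.trans hm) (ψ ∘ₗ φ) x = truncMap hm' ψ (truncMap hm φ x) := by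
  obtain ⟨x, rfl⟩ := Submodule.Quotient.mk_surjective _ x
  rfl

lemma leibniz_left {p j l l' : ℤ} (h : p + j = l) (hl : l + 1 = l') (a : D.gr p) :
    dLin hl ∘ₗ mulLeft h a =
      mulLeft (show p + 1 + j = l' by omega) (CDGAlgebra.dH rfl a) +
        p.negOnePow • (mulLeft (show p + (j + 1) = l' by omega) a ∘ₗ dLin rfl) :=
  LinearMap.ext fun x => Subtype.ext (by
    simpa [dLin, mulLeft, CDGAlgebra.mulH, CDGAlgebra.dH, Units.smul_def] using
      D.leibniz a.2 x.1)

lemma truncMap_leibniz (m : ℕ) {p j l l' : ℤ} (h : p + j = l) (hl : l + 1 = l') (a : D.gr p)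
    (x : D.trunc m j) :
    truncMap le_rfl (dLin hl) (truncMap le_rfl (mulLeft h a) x) =
      truncMap le_rfl (mulLeft (show p + 1 + j = l' by omega) (CDGAlgebra.dH rfl a)) x +
        p.negOnePow • truncMap le_rfl (mulLeft (show p + (j + 1) = l' by omega) a)
          (truncMap le_rfl (dLin rfl) x) := by
  rw [← truncMap_comp, leibniz_left, truncMap_add, ← truncMap_comp le_rfl le_rfl (dLin rfl)]
  obtain ⟨x, rfl⟩ := Submodule.Quotient.mk_surjective _ x
  rfl

lemma tMap_mulLeft (m : ℕ) {p j l j' l' : ℤ} (h : p + j = l) (h' : p + j' = l') (hj : j = j')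
    (hl : l = l') (a : D.gr p) (x : D.trunc m j) :
    tMap m hl (truncMap le_rfl (mulLeft h a) x) =
      truncMap le_rfl (mulLeft h' a) (tMap m hj x) := by
  obtain ⟨x, rfl⟩ := Submodule.Quotient.mk_surjective _ x
  exact congrArg Submodule.Quotient.mk (Subtype.ext (mul_smul_comm (TruncPoly.t k n) a.1 x.1).symm)

lemma mulRight_mulLeft {m m' : ℕ} (hm : m' ≤ m) {p q j l j' l' : ℤ} (h : p + j = l)
    (hl : l + q = l') (hj : j + q = j') (h' : p + j' = l') (a : D.gr p) (b : D.gr q)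
    (x : D.trunc m j) :
    truncMap hm (mulRight hl b) (truncMap le_rfl (mulLeft h a) x) =
      truncMap le_rfl (mulLeft h' a) (truncMap hm (mulRight hj b) x) := by
  obtain ⟨x, rfl⟩ := Submodule.Quotient.mk_surjective _ x
  exact congrArg Submodule.Quotient.mk (Subtype.ext (mul_assoc a.1 x.1 b.1))

variable (D)

/-- The action of a homogeneous element `a` on `A_i ⊕ A_{i-1}[1]`:
`(α, β) ↦ (a α, (-1)^{|a|} a β)`. -/
noncomputable def gamSMul (i : ℕ) {p j l : ℤ} (h : p + j = l) (a : D.gr p) :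
    D.trunc (i + 1) j × D.trunc i (j + 1) →+ D.trunc (i + 1) l × D.trunc i (l + 1) :=
  AddMonoidHom.prodMap (truncMap le_rfl (mulLeft h a)).toAddMonoidHom
    (p.negOnePow • (truncMap le_rfl
      (mulLeft (show p + (j + 1) = l + 1 by omega) a)).toAddMonoidHom)

/-- The predifferential `d (α, β) = (d α + t β, -d β + π (α (c/t)))` on `A_i ⊕ A_{i-1}[1]`, where
`t : A_{i-1} → A_i` is multiplication by `t` and `π : A_i → A_{i-1}` is the projection. -/
noncomputable def gamD (i : ℕ) {j l : ℤ} (h : j + 1 = l) :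
    D.trunc (i + 1) j × D.trunc i (j + 1) →+ D.trunc (i + 1) l × D.trunc i (l + 1) :=
  AddMonoidHom.mk'
    (fun x =>
      (truncMap le_rfl (dLin h) x.1 + tMap i h x.2,
        -truncMap le_rfl (dLin (show j + 1 + 1 = l + 1 by omega)) x.2 +
          truncMap (Nat.le_succ i) (mulRight (show j + 2 = l + 1 by omega) D.curvDivT) x.1))
    (fun x y => by
      simp only [Prod.fst_add, Prod.snd_add, map_add, Prod.mk_add_mk]
      refine Prod.ext ?_ ?_ <;> dsimp only <;> abel)

lemma gamSMul_apply (i : ℕ) {p j l : ℤ} (h : p + j = l) (a : D.gr p)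
    (x : D.trunc (i + 1) j) (y : D.trunc i (j + 1)) :
    D.gamSMul i h a (x, y) = (truncMap le_rfl (mulLeft h a) x,
      p.negOnePow • truncMap le_rfl (mulLeft (show p + (j + 1) = l + 1 by omega) a) y) := rfl

lemma gamD_apply (i : ℕ) {j l : ℤ} (h : j + 1 = l)
    (x : D.trunc (i + 1) j) (y : D.trunc i (j + 1)) :
    D.gamD i h (x, y) = (truncMap le_rfl (dLin h) x + tMap i h y,
      -truncMap le_rfl (dLin (show j + 1 + 1 = l + 1 by omega)) y +
        truncMap (Nat.le_succ i) (mulRight (show j + 2 = l + 1 by omega) D.curvDivT) x) := rfl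

lemma leibniz_aux₁ {Y Z W : Type*} [AddCommGroup Y] [AddCommGroup Z] [AddCommGroup W] (ε : ℤˣ)
    (f : Y →+ Z) (g : W →+ Z) (y : Y) (u w : W) (r s : Z) (h1 : r = s + ε • g u)
    (h2 : f y = g w) : r + f (ε • y) = s + ε • g (u + w) := by
  rw [Units.smul_def, map_zsmul, h1, h2, map_add, smul_add, Units.smul_def, Units.smul_def]
  abel

lemma leibniz_aux₂ {Y Z W : Type*} [AddCommGroup Y] [AddCommGroup Z] [AddCommGroup W] (ε : ℤˣ)
    (f : Y →+ Z) (g : W →+ Z) (y : Y) (u w : W) (r s : Z) (h1 : f y = s + ε • g u)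
    (h2 : r = g w) : -f (ε • y) + r = (-ε) • s + ε • ε • g (-u + w) := by
  rw [Units.smul_def, map_zsmul, ← Units.smul_def, h1, h2, map_add, map_neg, smul_smul,
    Int.units_mul_self, one_smul, smul_add, smul_smul, Int.units_mul_self, one_smul,
    Units.neg_smul]
  abel

set_option maxHeartbeats 1000000 in
lemma gamD_leibniz (i : ℕ) {p j l p' j' l' : ℤ} (h : p + j = l) (hp : p + 1 = p')
    (hj : j + 1 = j') (hl : l + 1 = l') (a : D.gr p) (x : D.trunc (i + 1) j × D.trunc i (j + 1)) :
    D.gamD i hl (D.gamSMul i h a x) =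
      D.gamSMul i (show p' + j = l' by omega) (CDGAlgebra.dH hp a) x +
        p.negOnePow • D.gamSMul i (show p + j' = l' by omega) a (D.gamD i hj x) := by
  subst hp hj
  obtain ⟨x, y⟩ := x
  have h1 := truncMap_leibniz (i + 1) h hl a x
  have h2 := truncMap_leibniz i (show p + (j + 1) = l + 1 by omega)
    (show l + 1 + 1 = l' + 1 by omega) a y
  have h3 := tMap_mulLeft i (show p + (j + 1) = l + 1 by omega) (show p + (j + 1) = l' by omega)
    rfl hl a y
  have h4 := mulRight_mulLeft (Nat.le_succ i) h (show l + 2 = l' + 1 by omega)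
    (show j + 2 = j + 1 + 1 by omega) (show p + (j + 1 + 1) = l' + 1 by omega) a D.curvDivT x
  rw [gamSMul_apply, gamD_apply, gamD_apply, gamSMul_apply, gamSMul_apply]
  have k1 := leibniz_aux₁ p.negOnePow (tMap i hl).toAddMonoidHom
    (truncMap le_rfl (mulLeft (show p + (j + 1) = l' by omega) a)).toAddMonoidHom
    _ _ _ _ _ h1 h3
  have k2 := leibniz_aux₂ p.negOnePow
    (truncMap (le_refl i) (dLin (D := D) (show l + 1 + 1 = l' + 1 by omega))).toAddMonoidHom
    (truncMap le_rfl (mulLeft (show p + (j + 1 + 1) = l' + 1 by omega) a)).toAddMonoidHom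
    _ _ _ _ _ h2 h4
  rw [← Int.negOnePow_succ] at k2
  refine Prod.ext ?_ ?_
  · rw [Prod.fst_add, Prod.smul_fst]
    exact k1
  · rw [Prod.snd_add, Prod.smul_snd]
    exact k2

lemma gamD_gamD {i : ℕ} (hi : i ≤ n) {j l m : ℤ} (h : j + 1 = l) (h' : l + 1 = m)
    (x : D.trunc (i + 1) j × D.trunc i (j + 1)) :
    D.gamD i h' (D.gamD i h x) = D.gamSMul i (show 2 + j = m by omega) D.curvH x := by
  subst h h'
  obtain ⟨x, y⟩ := x
  obtain ⟨x, rfl⟩ := Submodule.Quotient.mk_surjective _ x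
  obtain ⟨y, rfl⟩ := Submodule.Quotient.mk_surjective _ y
  have hc := D.t_smul_curvDivT
  refine Prod.ext ?_ ?_
  · refine congrArg Submodule.Quotient.mk (Subtype.ext ?_)
    change D.d (D.d x.1 + TruncPoly.t k n • y.1) + TruncPoly.t k n • (-D.d y.1 + x.1 * D.curvDivT.1) = D.curv * x.1
    rw [map_add, D.d_d, map_smul, smul_add, ← mul_smul_comm, hc, smul_neg]
    abel
  · obtain ⟨z, hz⟩ := D.exists_pow_smul_eq_d_curvDivT hi
    rw [gamSMul_apply, Int.negOnePow_even 2 ⟨1, rfl⟩, one_smul]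
    let w : D.gr (j + 1 + 1 + 1) := mulLeft (show j + 3 = j + 1 + 1 + 1 by omega) x z
    refine (Submodule.Quotient.eq _).2 ⟨-(j.negOnePow • w), Subtype.ext ?_⟩
    change TruncPoly.t k n ^ i • -(j.negOnePow • (x.1 * z.1)) =
      -D.d (-D.d y.1 + x.1 * D.curvDivT.1) + (D.d x.1 + TruncPoly.t k n • y.1) * D.curvDivT.1 - D.curv * y.1
    rw [map_add, map_neg, D.d_d, D.leibniz x.2, ← hz, add_mul, smul_mul_assoc,
      ← mul_smul_comm (TruncPoly.t k n), hc, smul_neg, mul_smul_comm, Units.smul_def, Units.smul_def,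
      smul_comm (TruncPoly.t k n ^ i)]
    abel

/-- The cdg module `Γ_i`, for `i ≤ n`: the graded module `A_i ⊕ A_{i-1}[1]` (with `A_{-1} = 0`),
twisted by `t : A_{i-1} → A_i` and `π ∘ (c/t) : A_i → A_{i-1}`. -/
noncomputable def Gam (i : Fin (n + 1)) : CDGModule.{u, v} D.toCDGAlgebra where
  X j := D.trunc (i + 1) j × D.trunc i (j + 1)
  smul h :=
    { toFun := fun a => D.gamSMul i h a
      map_zero' := by
        refine AddMonoidHom.ext fun x => Prod.ext ?_ ?_ <;>
          simp [gamSMul, mulLeft_zero, truncMap_zero]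
      map_add' := fun a b => by
        refine AddMonoidHom.ext fun x => Prod.ext ?_ ?_ <;>
          simp [gamSMul, mulLeft_add, truncMap_add] }
  one_smul x := by
    refine Prod.ext ?_ ?_ <;> simp [gamSMul, mulLeft_one, truncMap_id]
  mul_smul {p p' j m l q} h h' h'' a b x := by
    refine Prod.ext ?_ ?_
    · simp [gamSMul, mulLeft_mul h h' h'', truncMap_comp le_rfl le_rfl]
    · subst h
      simp [gamSMul, mulLeft_mul rfl (show p' + (j + 1) = l + 1 by omega)
        (show p + (l + 1) = q + 1 by omega), truncMap_comp le_rfl le_rfl, Int.negOnePow_add,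
        Units.smul_def, smul_smul]
  d h := D.gamD i h
  leibniz h hp hj hl a x := D.gamD_leibniz i h hp hj hl a x
  d_d h h' x := D.gamD_gamD (Nat.le_of_lt_succ i.2) h h' x

/-! ### The `n`-derived category -/

/-- The element `t^m` of `A_n`, of degree `0`. -/
noncomputable def tPow (m : ℕ) : D.gr 0 := TruncPoly.t k n ^ m • D.oneH

/-- The `t`-adic filtration of a module: the component of degree `j` of `t^m M`. -/
noncomputable def tFil (M : CDGModule.{u, v} D.toCDGAlgebra) (m : ℕ) (j : ℤ) :
    AddSubgroup (M.X j) :=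
  (M.smul (zero_add j) (D.tPow m)).range

/-- `M` is `n`-acyclic: for every `m ≤ n` the complex `Gr_t^m(M) = t^m M / t^{m+1} M` (with the
differential induced by `d`) is acyclic, i.e. every cocycle, represented by `x ∈ t^m M` with
`d x ∈ t^{m+1} M`, is a coboundary. -/
def IsAcyclic (M : CDGModule.{u, v} D.toCDGAlgebra) : Prop :=
  ∀ m ≤ n, ∀ {i j l : ℤ} (h : i + 1 = j) (h' : j + 1 = l), ∀ x ∈ D.tFil M m j,
    M.d h' x ∈ D.tFil M (m + 1) l → ∃ y ∈ D.tFil M m i, x - M.d h y ∈ D.tFil M (m + 1) j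

/-- A closed morphism is an `n`-quasi-isomorphism if its cone is `n`-acyclic. -/
def IsQuasiIso {M N : CDGModule.{u, v} D.toCDGAlgebra} (f : M ⟶ N) : Prop :=
  D.IsAcyclic (CDGModule.cone f)

/-- The morphisms of `Hot(A_n)` with `n`-acyclic cone, i.e. the classes of
`n`-quasi-isomorphisms. -/
def quasiIso : MorphismProperty (Hot D.toCDGAlgebra) := fun M N f =>
  ∃ g : M.as ⟶ N.as, D.IsQuasiIso g ∧ (CategoryTheory.Quotient.functor _).map g = f

/-- The `n`-derived category `Dⁿ(A_n)`: the Verdier quotient of `Hot(A_n)` by the subcategory of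
`n`-acyclic modules, i.e. the localization of `Hot(A_n)` at the morphisms with `n`-acyclic cone. -/
abbrev NDerived := D.quasiIso.Localization

/-- The quotient functor `Hot(A_n) ⥤ Dⁿ(A_n)`. -/
noncomputable abbrev quotientFunctor : Hot D.toCDGAlgebra ⥤ D.NDerived := D.quasiIso.Q

/-- `P` is `n`-homotopy projective: `Hom_{Hot(A_n)}(P, N) = 0` for every `n`-acyclic `N`. -/
def IsHomotopyProjective (P : Hot D.toCDGAlgebra) : Prop :=
  ∀ N : CDGModule.{u, v} D.toCDGAlgebra, D.IsAcyclic N → Subsingleton (P ⟶ Hot.of N)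

/-- `n`-semifree modules: those which are semifree on `Γ_0, ..., Γ_n`. -/
def IsSemifree (P : CDGModule.{u, v} D.toCDGAlgebra) : Prop :=
  CDGModule.IsSemifree D.Gam P

/-- `n`-cell modules: the smallest localizing subcategory of `Hot(A_n)` containing
`Γ_0, ..., Γ_n`. -/
def IsCell (M : Hot D.toCDGAlgebra) : Prop :=
  Hot.IsCell D.Gam M

end

end CDGDeformation

/-! The modules Γ_0, …, Γ_n detect n-acyclicity; the rest is the theory of cell objects.

As a graded module Γ_m is generated by u in degree 0, killed by t^{m+1}, and v in degree -1, killed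
by t^m, with dv = tu and du = (c/t)v. A homogeneous map Γ_m → M is thus a pair (x, y) of elements
with t^{m+1}x = 0 and t^m y = 0. Up to signs it is closed when dy = tx and dx = (c/t)y, and a
boundary when x = dx' + (c/t)y' and y = dy' + tx' for another such pair. `PairExact M` says that
every closed pair is a boundary, that is, that all maps from Γ_0, …, Γ_n to shifts of M are
null-homotopic. The core is `isAcyclic_iff_pairExact`. Both directions pass through two simpler
conditions: `SocleExact`, on elements killed by t, and `TorsionExact`, on elements killed by t^m,
taken modulo multiples of t. Two facts control the curvature: d² = t(c/t), so d² vanishes modulo t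
and on elements killed by t; and t d(c/t) = dc = 0 puts d(c/t) in t^n A_n, so c/t commutes with d on
elements killed by t^m, m ≤ n.

Resolutions come from a small object argument (`exists_cellular_approximation`). Starting from 0 →
M, each stage attaches a cone on every map from a shifted Γ_m whose image in M comes with a
null-homotopy. A closed pair in the cone of the union P → M involves two elements of P, so it comes
from one stage and is bounded by the next; hence the cone is `PairExact`. The union is the cokernel
of 1 - shift on the sum of the stages. This map splits as a graded map, so the union is homotopy
equivalent to its cone and is a cell module.

The conclusion is formal. The n-homotopy projective modules form a localizing subcategory containing
every Γ_m, hence all cell modules. So maps out of a cell module do not distinguish the two ends of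
an n-quasi-isomorphism, and resolution is right adjoint to the inclusion of the cell modules and is
itself a localization (`exists_leftAdjoint_of_resolutions`). Conversely, if M is n-homotopy
projective, the cone of its resolution is both n-acyclic and n-homotopy projective, hence zero, and
M is a cell module. -/

namespace CDGAlgebra

variable {R : Type v} [CommRing R] (B : CDGAlgebra.{u, v} R)

lemma d_one : B.d 1 = 0 := by
  have h := B.leibniz (SetLike.one_mem_graded B.gr) 1
  simpa using h

lemma dH_smul_oneH (r : R) : dH (zero_add 1) (r • B.oneH) = 0 :=
  Subtype.ext (by simp [dH, oneH, d_one])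

variable {B}

lemma mulH_smul_oneH {i : ℤ} (r : R) (a : B.gr i) :
    mulH (add_zero i) a (r • B.oneH) = r • a := Subtype.ext (by simp [mulH, oneH])

lemma smul_oneH_mulH {i : ℤ} (r : R) (a : B.gr i) :
    mulH (zero_add i) (r • B.oneH) a = r • a := Subtype.ext (by simp [mulH, oneH])

end CDGAlgebra

namespace CDGModule

variable {R : Type v} [CommRing R] {B : CDGAlgebra.{u, v} R}

/-! ### The action of the base ring on modules -/

section Linear

variable (M : CDGModule.{u, v} B)

/-- The base ring acts on the homogeneous components through the elements of degree `0`. -/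
instance moduleX (j : ℤ) : Module R (M.X j) where
  smul r x := M.smul (zero_add j) (r • B.oneH) x
  one_smul x := by
    change M.smul (zero_add j) ((1 : R) • B.oneH) x = x
    rw [_root_.one_smul, M.one_smul]
  mul_smul r s x := by
    change M.smul (zero_add j) ((r * s) • B.oneH) x =
      M.smul (zero_add j) (r • B.oneH) (M.smul (zero_add j) (s • B.oneH) x)
    rw [← M.mul_smul (zero_add 0), CDGAlgebra.smul_oneH_mulH, SemigroupAction.mul_smul]
  smul_zero r := map_zero (M.smul (zero_add j) (r • B.oneH))
  smul_add r := map_add (M.smul (zero_add j) (r • B.oneH))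
  add_smul r s x := by
    change M.smul (zero_add j) ((r + s) • B.oneH) x =
      M.smul (zero_add j) (r • B.oneH) x + M.smul (zero_add j) (s • B.oneH) x
    rw [_root_.add_smul, map_add, AddMonoidHom.add_apply]
  zero_smul x := by
    change M.smul (zero_add j) ((0 : R) • B.oneH) x = 0
    rw [_root_.zero_smul, map_zero, AddMonoidHom.zero_apply]

lemma smul_def {j : ℤ} (r : R) (x : M.X j) : r • x = M.smul (zero_add j) (r • B.oneH) x := rfl

lemma smul_base {i j l : ℤ} (h : i + j = l) (a : B.gr i) (r : R) (x : M.X j) :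
    M.smul h a (r • x) = r • M.smul h a x := by
  rw [smul_def, smul_def, ← M.mul_smul (add_zero i) (zero_add j) h,
    ← M.mul_smul (zero_add i) h (zero_add l), CDGAlgebra.mulH_smul_oneH,
    CDGAlgebra.smul_oneH_mulH]

lemma base_smul {i j l : ℤ} (h : i + j = l) (a : B.gr i) (r : R) (x : M.X j) :
    M.smul h (r • a) x = r • M.smul h a x := by
  rw [smul_def, ← M.mul_smul (zero_add i) h (zero_add l), CDGAlgebra.smul_oneH_mulH]

/-- The scalar r acts as r · 1, which has degree 0 and zero differential, so the Leibniz rule leaves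
a single term without sign. -/
lemma d_base {i j : ℤ} (h : i + 1 = j) (r : R) (x : M.X i) : M.d h (r • x) = r • M.d h x := by
  rw [smul_def, M.leibniz (zero_add i) (zero_add 1) h h, CDGAlgebra.dH_smul_oneH, map_zero,
    AddMonoidHom.zero_apply, zero_add, Int.negOnePow_zero, _root_.one_smul, ← smul_def]

variable {M}

lemma Hom.map_base {N : CDGModule.{u, v} B} (f : M ⟶ N) {i : ℤ} (r : R) (x : M.X i) :
    f.f i (r • x) = r • f.f i x := f.map_smul _ _ _

@[simp]
lemma comp_f {N L : CDGModule.{u, v} B} (f : M ⟶ N) (g : N ⟶ L) (i : ℤ) (x : M.X i) :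
    (f ≫ g).f i x = g.f i (f.f i x) := rfl

@[simp]
lemma id_f (i : ℤ) (x : M.X i) : Hom.f (𝟙 M) i x = x := rfl

lemma Hom.ext' {N : CDGModule.{u, v} B} {f g : M ⟶ N} (h : ∀ i (x : M.X i), f.f i x = g.f i x) :
    f = g := Hom.ext (funext fun i => AddMonoidHom.ext (h i))

end Linear

/-! ### Homogeneous maps, closed maps and boundaries -/

/-- Homogeneous maps of degree `p`, linear over the graded algebra underlying `B` up to the
Koszul sign. -/
structure GMap (M N : CDGModule.{u, v} B) (p : ℤ) where
  f : ∀ {i j : ℤ}, i + p = j → M.X i →+ N.X j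
  map_smul : ∀ {i j l j' l' : ℤ} (h : i + j = l) (hj : j + p = j') (hl : l + p = l') (a : B.gr i)
    (x : M.X j), f hl (M.smul h a x) =
      (p * i).negOnePow • N.smul (show i + j' = l' by omega) a (f hj x)

namespace GMap

variable {M N L : CDGModule.{u, v} B} {p q : ℤ}

lemma map_base (φ : GMap M N p) {i j : ℤ} (h : i + p = j) (r : R) (x : M.X i) :
    φ.f h (r • x) = r • φ.f h x := by
  rw [smul_def, φ.map_smul (zero_add i) h h, mul_zero, Int.negOnePow_zero, _root_.one_smul,
    ← smul_def]

/-- Sums of homogeneous maps. -/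
def add (φ ψ : GMap M N p) : GMap M N p where
  f h := φ.f h + ψ.f h
  map_smul h hj hl a x := by simp [φ.map_smul h hj hl, ψ.map_smul h hj hl]

/-- The negative of a homogeneous map. -/
def neg (φ : GMap M N p) : GMap M N p where
  f h := -φ.f h
  map_smul h hj hl a x := by simp [φ.map_smul h hj hl]

/-- A homogeneous map, multiplied by a sign. -/
def sgn (ε : ℤˣ) (φ : GMap M N p) : GMap M N p where
  f h := ε • φ.f h
  map_smul h hj hl a x := by
    simp [φ.map_smul h hj hl, Units.smul_def, smul_comm (ε : ℤ)]

/-- The composite with a closed morphism on the left. -/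
def precomp (f : M ⟶ N) (φ : GMap N L p) : GMap M L p where
  f h := (φ.f h).comp (f.f _)
  map_smul h hj hl a x := by simp [φ.map_smul h hj hl, f.map_smul]

/-- The composite with a closed morphism on the right. -/
def postcomp (φ : GMap M N p) (f : N ⟶ L) : GMap M L p where
  f h := (f.f _).comp (φ.f h)
  map_smul h hj hl a x := by simp [φ.map_smul h hj hl, ← f.map_smul, Units.smul_def]

@[simp] lemma add_f (φ ψ : GMap M N p) {i j : ℤ} (h : i + p = j) (x : M.X i) :
    (φ.add ψ).f h x = φ.f h x + ψ.f h x := rfl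

@[simp] lemma neg_f (φ : GMap M N p) {i j : ℤ} (h : i + p = j) (x : M.X i) :
    φ.neg.f h x = -φ.f h x := rfl

@[simp] lemma sgn_f (ε : ℤˣ) (φ : GMap M N p) {i j : ℤ} (h : i + p = j) (x : M.X i) :
    (φ.sgn ε).f h x = ε • φ.f h x := rfl

@[simp] lemma precomp_f (f : M ⟶ N) (φ : GMap N L p) {i j : ℤ} (h : i + p = j) (x : M.X i) :
    (φ.precomp f).f h x = φ.f h (f.f i x) := rfl

@[simp] lemma postcomp_f (φ : GMap M N p) (f : N ⟶ L) {i j : ℤ} (h : i + p = j) (x : M.X i) :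
    (φ.postcomp f).f h x = f.f j (φ.f h x) := rfl

/-- The differential `d φ - (-1)^p φ d` of a homogeneous map of degree `p`. -/
def diff (φ : GMap M N p) (hq : p + 1 = q) : GMap M N q where
  f {i j} h := (N.d (show i + p + 1 = j by omega)).comp (φ.f rfl) -
    p.negOnePow • (φ.f (show i + 1 + p = j by omega)).comp (M.d rfl)
  map_smul {i j l j' l'} h hj hl a x := by
    have h1 := N.leibniz (show i + (j + p) = l + p by omega) rfl (show j + p + 1 = j' by omega)
      (show l + p + 1 = l' by omega) a (φ.f rfl x)
    have h2 := M.leibniz h rfl (show j + 1 = j + 1 by omega) rfl a x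
    have h3 := φ.map_smul h rfl rfl a x
    have h4 := φ.map_smul (show i + 1 + j = l + 1 by omega) rfl (show l + 1 + p = l' by omega)
      (CDGAlgebra.dH rfl a) x
    have h5 := φ.map_smul (show i + (j + 1) = l + 1 by omega) (show j + 1 + p = j' by omega)
      (show l + 1 + p = l' by omega) a (M.d rfl x)
    subst hq
    simp only [AddMonoidHom.sub_apply, AddMonoidHom.comp_apply, AddMonoidHom.smul_apply,
      Units.smul_def, h3, map_zsmul, h1, h2, map_add, h4, h5, smul_add, smul_sub, map_sub]
    simp only [← Units.smul_def, smul_smul, ← Int.negOnePow_add]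
    have e1 : (p + p * (i + 1)).negOnePow = (p * i).negOnePow := by
      rw [show p + p * (i + 1) = p * i + 2 * p by ring, Int.negOnePow_add,
        Int.negOnePow_even (2 * p) (even_two_mul p), mul_one]
    rw [e1]
    have e2 : p * i + i = (p + 1) * i := by ring
    have e3 : p + (i + p * i) = (p + 1) * i + p := by ring
    rw [e2, e3]
    abel

/-- All degrees enter through equations instead of as literal sums, so the formula can be applied
without transport between equal degrees. -/
lemma diff_f (φ : GMap M N p) (hq : p + 1 = q) {i i' j j' : ℤ} (h : i + q = j) (hi : i + 1 = i')
    (hj : i + p = j') (x : M.X i) : (φ.diff hq).f h x = N.d (show j' + 1 = j by omega) (φ.f hj x) -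
      p.negOnePow • φ.f (show i' + p = j by omega) (M.d hi x) := by
  subst hi hj
  rfl

/-- Closed homogeneous maps. -/
def Closed (φ : GMap M N p) : Prop :=
  ∀ {i i' j j' : ℤ} (hj : i + p = j) (hj' : j + 1 = j') (hi : i + 1 = i') (x : M.X i),
    N.d hj' (φ.f hj x) = p.negOnePow • φ.f (show i' + p = j' by omega) (M.d hi x)

/-- The map `φ` is the differential of `ψ`. -/
def IsDiff (φ : GMap M N q) (ψ : GMap M N p) : Prop :=
  ∀ {i i' j j' : ℤ} (h : i + q = j) (hj : i + p = j') (hj' : j' + 1 = j) (hi : i + 1 = i')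
    (x : M.X i), φ.f h x = N.d hj' (ψ.f hj x) -
      p.negOnePow • ψ.f (show i' + p = j by omega) (M.d hi x)

/-- The homogeneous map of degree `0` underlying a closed morphism. -/
def ofHom (f : M ⟶ N) : GMap M N 0 where
  f {i j} h := (f.f j).comp (M.castX (by omega))
  map_smul {i j l j' l'} h hj hl a x := by
    obtain rfl : j = j' := by omega
    obtain rfl : l = l' := by omega
    simpa using f.map_smul h a x

@[simp] lemma ofHom_f (f : M ⟶ N) {i : ℤ} (h : i + 0 = i) (x : M.X i) :
    (ofHom f).f h x = f.f i x := rfl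

lemma ofHom_closed (f : M ⟶ N) : (ofHom f).Closed := by
  intro i i' j j' hj hj' hi x
  obtain rfl : i = j := by omega
  obtain rfl : i' = j' := by omega
  simpa using (f.map_d hi x).symm

/-- The closed morphism given by a closed homogeneous map of degree `0`. -/
def toHom (φ : GMap M N 0) (h : φ.Closed) : M ⟶ N where
  f i := φ.f (add_zero i)
  map_smul e a x := by simpa using φ.map_smul e (add_zero _) (add_zero _) a x
  map_d e x := by simpa using (h (add_zero _) e e x).symm

@[simp] lemma toHom_f (φ : GMap M N 0) (h : φ.Closed) (i : ℤ) (x : M.X i) :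
    (toHom φ h).f i x = φ.f (add_zero i) x := rfl

/-- A homogeneous map of degree `-1` with `f - g = d s + s d` is a homotopy. -/
lemma homotopic {f g : M ⟶ N} (s : GMap M N (-1))
    (hs : ∀ {i p q : ℤ} (hp : i + -1 = p) (hq : i + 1 = q) (x : M.X i),
      f.f i x - g.f i x = N.d (show p + 1 = i by omega) (s.f hp x) +
        s.f (show q + -1 = i by omega) (M.d hq x)) : Homotopic f g := by
  refine ⟨fun {i j} h => s.f (show i + -1 = j by omega), ?_, ?_⟩
  · intro i j l j' l' h hj hl a x
    simpa using s.map_smul h (show j + -1 = j' by omega) (show l + -1 = l' by omega) a x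
  · intro i p q hp hq x
    exact hs (by omega) hq x

end GMap

lemma Homotopic.exists_gMap {M N : CDGModule.{u, v} B} {f g : M ⟶ N} (h : Homotopic f g) :
    ∃ s : GMap M N (-1), ∀ {i p q : ℤ} (hp : i + -1 = p) (hq : i + 1 = q) (x : M.X i),
      f.f i x - g.f i x = N.d (show p + 1 = i by omega) (s.f hp x) +
        s.f (show q + -1 = i by omega) (M.d hq x) := by
  obtain ⟨s, hs, h⟩ := h
  refine ⟨⟨fun {i j} e => s (show i = j + 1 by omega), ?_⟩, ?_⟩
  · intro i j l j' l' e hj hl a x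
    simpa using hs e (show j = j' + 1 by omega) (show l = l' + 1 by omega) a x
  · intro i p q hp hq x
    exact h (by omega) hq x

end CDGModule

namespace CDGModule

variable {R : Type v} [CommRing R] {B : CDGAlgebra.{u, v} R}

/-! ### Maps out of direct sums -/

section DirectSum

variable {ι : Type u} (M : ι → CDGModule.{u, v} B)

open Classical in
/-- The inclusion of a direct summand. -/
noncomputable def inc (s : ι) : M s ⟶ directSum M where
  f i := DirectSum.of (fun s => (M s).X i) s
  map_smul h a x := (DirectSum.map_of (fun s => (M s).smul h a) s x).symm
  map_d h x := (DirectSum.map_of (fun s => (M s).d h) s x).symm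

open Classical in
/-- The additive map out of a component of a direct sum with given restrictions. -/
noncomputable def sumDesc {Y : Type*} [AddCommGroup Y] {i : ℤ} (g : ∀ s, (M s).X i →+ Y) :
    (directSum M).X i →+ Y :=
  DirectSum.toAddMonoid g

/-- The projection to a direct summand. -/
def proj (s : ι) (i : ℤ) : (directSum M).X i →+ (M s).X i := DFinsupp.evalAddMonoidHom s

variable {M}

@[simp]
lemma sumDesc_inc {Y : Type*} [AddCommGroup Y] {i : ℤ} (g : ∀ s, (M s).X i →+ Y) (s : ι)
    (x : (M s).X i) : sumDesc M g ((inc M s).f i x) = g s x := by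
  classical
  exact DirectSum.toAddMonoid_of g s x

lemma directSum_induction {i : ℤ} {C : (directSum M).X i → Prop} (x : (directSum M).X i)
    (h0 : C 0) (hi : ∀ s (y : (M s).X i), C ((inc M s).f i y))
    (ha : ∀ y z, C y → C z → C (y + z)) : C x := by
  classical
  exact DirectSum.induction_on (motive := C) x h0 hi ha

lemma proj_inc_self (s : ι) {i : ℤ} (x : (M s).X i) : proj M s i ((inc M s).f i x) = x := by
  classical
  exact DirectSum.of_eq_same (β := fun s => (M s).X i) s x

lemma proj_inc_of_ne {s t : ι} (h : s ≠ t) {i : ℤ} (x : (M s).X i) :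
    proj M t i ((inc M s).f i x) = 0 := by
  classical
  exact DirectSum.of_eq_of_ne (β := fun s => (M s).X i) s t x h.symm

/-- The homogeneous map out of a direct sum with given components. -/
noncomputable def GMap.desc {N : CDGModule.{u, v} B} {p : ℤ} (φ : ∀ s, GMap (M s) N p) :
    GMap (directSum M) N p where
  f h := sumDesc M fun s => (φ s).f h
  map_smul h hj hl a x := by
    induction x using directSum_induction with
    | h0 => simp
    | ha y z hy hz => simp only [map_add, hy, hz, smul_add]
    | hi s y =>
      rw [← (inc M s).map_smul h, sumDesc_inc, sumDesc_inc]
      exact (φ s).map_smul h hj hl a y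

@[simp]
lemma GMap.desc_inc {N : CDGModule.{u, v} B} {p : ℤ} (φ : ∀ s, GMap (M s) N p) (s : ι)
    {i j : ℤ} (h : i + p = j) (x : (M s).X i) :
    (GMap.desc φ).f h ((inc M s).f i x) = (φ s).f h x :=
  sumDesc_inc _ _ _

/-- The closed morphism out of a direct sum with given components. -/
noncomputable def descHom {N : CDGModule.{u, v} B} (φ : ∀ s, M s ⟶ N) : directSum M ⟶ N where
  f i := sumDesc M fun s => (φ s).f i
  map_smul {i j l} h a x := by
    induction x using directSum_induction with
    | h0 => simp
    | ha y z hy hz => simp only [map_add, hy, hz]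
    | hi s y => rw [← (inc M s).map_smul h, sumDesc_inc, sumDesc_inc, Hom.map_smul]
  map_d {i j} h x := by
    induction x using directSum_induction with
    | h0 => simp
    | ha y z hy hz => simp only [map_add, hy, hz]
    | hi s y => rw [← (inc M s).map_d h, sumDesc_inc, sumDesc_inc, Hom.map_d]

@[simp]
lemma descHom_inc {N : CDGModule.{u, v} B} (φ : ∀ s, M s ⟶ N) (s : ι) {i : ℤ} (x : (M s).X i) :
    (descHom φ).f i ((inc M s).f i x) = (φ s).f i x :=
  sumDesc_inc _ _ _

end DirectSum

/-! ### Shifts, and orthogonality of modules -/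

section Shift

/-- The identification of the components of a shift. -/
def unsh (M : CDGModule.{u, v} B) (p : ℤ) {i j : ℤ} (h : i + p = j) :
    (M.shift p).X i ≃+ M.X j :=
  h ▸ AddEquiv.refl (M.X (i + p))

/-- The inverse of the identification `unsh`. -/
def sh (M : CDGModule.{u, v} B) (p : ℤ) {i j : ℤ} (h : i + p = j) : M.X j ≃+ (M.shift p).X i :=
  (M.unsh p h).symm

variable {M N : CDGModule.{u, v} B} {p q r : ℤ}

@[simp] lemma unsh_sh {i j : ℤ} (h : i + p = j) (x : M.X j) :
    M.unsh p h (M.sh p h x) = x := (M.unsh p h).apply_symm_apply x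

@[simp] lemma sh_unsh {i j : ℤ} (h : i + p = j) (x : (M.shift p).X i) :
    M.sh p h (M.unsh p h x) = x := (M.unsh p h).symm_apply_apply x

lemma unsh_d {i i' j j' : ℤ} (h : i + 1 = i') (hj : i + p = j) (hj' : i' + p = j')
    (x : (M.shift p).X i) : M.unsh p hj' ((M.shift p).d h x) =
      p.negOnePow • M.d (show j + 1 = j' by omega) (M.unsh p hj x) := by
  subst hj hj'
  rfl

lemma unsh_smul {i j j' l l' : ℤ} (h : i + j = l) (hj : j + p = j') (hl : l + p = l')
    (a : B.gr i) (x : (M.shift p).X j) : M.unsh p hl ((M.shift p).smul h a x) =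
      (p * i).negOnePow • M.smul (show i + j' = l' by omega) a (M.unsh p hj x) := by
  subst hj hl
  rfl

lemma sh_d {i i' j j' : ℤ} (h : i + 1 = i') (hj : i + p = j) (hj' : i' + p = j')
    (x : M.X j) : (M.shift p).d h (M.sh p hj x) =
      p.negOnePow • M.sh p hj' (M.d (show j + 1 = j' by omega) x) := by
  subst hj hj'
  rfl

lemma sh_smul {i j j' l l' : ℤ} (h : i + j = l) (hj : j + p = j') (hl : l + p = l')
    (a : B.gr i) (x : M.X j') : (M.shift p).smul h a (M.sh p hj x) =
      (p * i).negOnePow • M.sh p hl (M.smul (show i + j' = l' by omega) a x) := by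
  subst hj hl
  rfl

lemma sh_base {i j : ℤ} (h : i + p = j) (a : R) (x : M.X j) :
    M.sh p h (a • x) = a • M.sh p h x := by
  rw [smul_def, smul_def, sh_smul (zero_add i) h h, mul_zero, Int.negOnePow_zero,
    _root_.one_smul]

lemma unsh_base {i j : ℤ} (h : i + p = j) (a : R) (x : (M.shift p).X i) :
    M.unsh p h (a • x) = a • M.unsh p h x := by
  rw [smul_def, smul_def, unsh_smul (zero_add i) h h, mul_zero, Int.negOnePow_zero,
    _root_.one_smul]

lemma negOnePow_add_add (q r : ℤ) : (q + r + r).negOnePow = q.negOnePow := by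
  rw [add_assoc, Int.negOnePow_add, ← two_mul, Int.negOnePow_even (2 * r) (even_two_mul r),
    mul_one]

lemma units_smul_map {Y Z : Type*} [AddCommGroup Y] [AddCommGroup Z] (g : Y →+ Z) (ε : ℤˣ)
    (y : Y) : g (ε • y) = ε • g y := by
  rw [Units.smul_def, map_zsmul, ← Units.smul_def]

/-- A homogeneous map out of a shift, regarded as a map out of the unshifted module. -/
def GMap.ofShiftDom (φ : GMap (M.shift r) N p) (h : q + r = p) : GMap M N q where
  f {i j} e := (φ.f (show i - r + p = j by omega)).comp
    (M.sh r (show i - r + r = i by omega)).toAddMonoidHom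
  map_smul {i j l j' l'} e hj hl a x := by
    have h1 := φ.map_smul (show i + (j - r) = l - r by omega) (show j - r + p = j' by omega)
      (show l - r + p = l' by omega) a (M.sh r (show j - r + r = j by omega) x)
    rw [sh_smul _ _ (show l - r + r = l by omega), units_smul_map, ← eq_inv_smul_iff, smul_smul,
      Int.units_inv_eq_self, ← Int.negOnePow_add] at h1
    refine h1.trans ?_
    have e : (r * i + p * i).negOnePow = (q * i).negOnePow := by
      rw [← h, show r * i + (q + r) * i = q * i + r * i + r * i by ring, negOnePow_add_add]
    rw [e]
    rfl

lemma GMap.ofShiftDom_f (φ : GMap (M.shift r) N p) (h : q + r = p) {i j k : ℤ} (e : i + q = j)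
    (hk : k + r = i) (e' : k + p = j) (x : M.X i) :
    (φ.ofShiftDom h).f e x = φ.f e' (M.sh r hk x) := by
  obtain rfl : k = i - r := by omega
  rfl

/-- A homogeneous map, regarded as a map out of a shift. -/
def GMap.toShiftDom (φ : GMap M N q) (h : q + r = p) : GMap (M.shift r) N p where
  f {i j} e := (φ.f (show i + r + q = j by omega)).comp (M.unsh r rfl).toAddMonoidHom
  map_smul {i j l j' l'} e hj hl a x := by
    have h1 := φ.map_smul (show i + (j + r) = l + r by omega) (show j + r + q = j' by omega)
      (show l + r + q = l' by omega) a (M.unsh r rfl x)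
    refine (congrArg (φ.f _) (unsh_smul e rfl rfl a x)).trans ?_
    rw [units_smul_map, h1, smul_smul, ← Int.negOnePow_add,
      show r * i + q * i = p * i by rw [← h]; ring]
    rfl

lemma GMap.toShiftDom_f (φ : GMap M N q) (h : q + r = p) {i j k : ℤ} (e : i + p = j)
    (hk : i + r = k) (e' : k + q = j) (x : (M.shift r).X i) :
    (φ.toShiftDom h).f e x = φ.f e' (M.unsh r hk x) := by
  subst hk
  rfl

/-- A homogeneous map, regarded as a map to a shift. -/
def GMap.toShift (φ : GMap M N p) (h : q + r = p) : GMap M (N.shift r) q where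
  f {i j} e := (N.sh r rfl).toAddMonoidHom.comp (φ.f (show i + p = j + r by omega))
  map_smul {i j l j' l'} e hj hl a x := by
    have h1 := φ.map_smul e (show j + p = j' + r by omega) (show l + p = l' + r by omega) a x
    change N.sh r rfl (φ.f _ _) = _ • (N.shift r).smul _ a (N.sh r rfl (φ.f _ _))
    rw [sh_smul _ _ rfl, h1, smul_smul, ← Int.negOnePow_add]
    refine (units_smul_map (N.sh r rfl).toAddMonoidHom _ _).trans ?_
    rw [show q * i + r * i = p * i by rw [← h]; ring]
    rfl

lemma GMap.toShift_f (φ : GMap M N p) (h : q + r = p) {i j k : ℤ} (e : i + q = j)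
    (hk : j + r = k) (e' : i + p = k) (x : M.X i) :
    (φ.toShift h).f e x = N.sh r hk (φ.f e' x) := by
  subst hk
  rfl

/-- A homogeneous map to a shift, regarded as a map to the unshifted module. -/
def GMap.ofShift (φ : GMap M (N.shift r) q) (h : q + r = p) : GMap M N p where
  f {i j} e := (N.unsh r (show i + q + r = j by omega)).toAddMonoidHom.comp (φ.f rfl)
  map_smul {i j l j' l'} e hj hl a x := by
    have h1 := φ.map_smul e rfl rfl a x
    change N.unsh r _ (φ.f rfl _) = _ • N.smul _ a (N.unsh r _ (φ.f rfl _))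
    rw [h1]
    refine (units_smul_map (N.unsh r _).toAddMonoidHom _ _).trans ?_
    refine (congrArg _ (unsh_smul _ (show j + q + r = j' by omega) _ a _)).trans ?_
    rw [smul_smul, ← Int.negOnePow_add, show q * i + r * i = p * i by rw [← h]; ring]

lemma GMap.ofShift_f (φ : GMap M (N.shift r) q) (h : q + r = p) {i j k : ℤ} (e : i + p = k)
    (hk : j + r = k) (e' : i + q = j) (x : M.X i) :
    (φ.ofShift h).f e x = N.unsh r hk (φ.f e' x) := by
  subst e'
  rfl

/-- The differential of M[r] carries the sign (-1)^r, and the closedness sign changes from (-1)^p to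
(-1)^q with p = q + r; the two changes cancel, so the identification needs no sign of its own. -/
lemma GMap.Closed.ofShiftDom {φ : GMap (M.shift r) N p} (hφ : φ.Closed) (h : q + r = p) :
    (φ.ofShiftDom h).Closed := by
  intro i i' j j' hj hj' hi x
  have h1 := hφ (show i - r + p = j by omega) hj' (show i - r + 1 = i' - r by omega)
    (M.sh r (by omega) x)
  rw [ofShiftDom_f φ h hj (show i - r + r = i by omega) (by omega), h1,
    ofShiftDom_f φ h _ (show i' - r + r = i' by omega) (by omega),
    sh_d _ _ (show i' - r + r = i' by omega), units_smul_map, smul_smul,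
    ← Int.negOnePow_add]
  subst h
  rw [negOnePow_add_add]

lemma GMap.Closed.toShiftDom {φ : GMap M N q} (hφ : φ.Closed) (h : q + r = p) :
    (φ.toShiftDom h : GMap (M.shift r) N p).Closed := by
  intro i i' j j' hj hj' hi x
  have h1 := hφ (show i + r + q = j by omega) hj' (show i + r + 1 = i' + r by omega)
    (M.unsh r rfl x)
  rw [toShiftDom_f φ h _ rfl (by omega), toShiftDom_f φ h _ rfl (by omega), h1,
    unsh_d hi rfl rfl, units_smul_map, smul_smul, ← Int.negOnePow_add]
  subst h
  rw [negOnePow_add_add]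

lemma GMap.Closed.toShift {φ : GMap M N p} (hφ : φ.Closed) (h : q + r = p) :
    (φ.toShift h : GMap M (N.shift r) q).Closed := by
  intro i i' j j' hj hj' hi x
  have h1 := hφ (show i + p = j + r by omega) (show j + r + 1 = j' + r by omega) hi x
  rw [toShift_f φ h _ rfl (by omega), toShift_f φ h _ rfl (by omega), sh_d _ _ rfl, h1]
  refine (congrArg _ (units_smul_map (N.sh r rfl).toAddMonoidHom _ _)).trans ?_
  rw [smul_smul, ← Int.negOnePow_add]
  have : (r + p).negOnePow = q.negOnePow := by rw [← h, add_comm, negOnePow_add_add]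
  rw [this]
  rfl

/-- Every closed homogeneous map `M → N` of any degree is a differential. -/
def Orthogonal (M N : CDGModule.{u, v} B) : Prop :=
  ∀ {p q : ℤ} (_ : p + 1 = q) (φ : GMap M N q), φ.Closed → ∃ ψ : GMap M N p, φ.IsDiff ψ

lemma orthogonal_shift (h : Orthogonal M N) (r : ℤ) : Orthogonal (M.shift r) N := by
  intro p q hq φ hφ
  obtain ⟨ψ, hψ⟩ := h (show p - r + 1 = q - r by omega) (φ.ofShiftDom (by omega))
    (hφ.ofShiftDom (by omega))
  refine ⟨ψ.toShiftDom (by omega), ?_⟩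
  intro i i' j j' h hj hj' hi x
  have h1 := hψ (show i + r + (q - r) = j by omega) (show i + r + (p - r) = j' by omega) hj'
    (show i + r + 1 = i' + r by omega) (M.unsh r rfl x)
  rw [GMap.ofShiftDom_f φ _ _ rfl h, sh_unsh] at h1
  rw [h1, GMap.toShiftDom_f ψ _ _ rfl (by omega), GMap.toShiftDom_f ψ _ _ rfl (by omega),
    unsh_d hi rfl rfl, units_smul_map, smul_smul, ← Int.negOnePow_add]
  rw [← negOnePow_add_add (p - r) r, show p - r + r + r = p + r by ring]

end Shift

/-! ### Cones, and orthogonality along cone triangles -/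

section Cone

variable {M N Z : CDGModule.{u, v} B} (f : M ⟶ N) {p q : ℤ}

/-- The component of an element of the cone in the source. -/
def cfst {i j : ℤ} (h : i + 1 = j) : (cone f).X i →+ M.X j :=
  (M.unsh 1 h).toAddMonoidHom.comp (AddMonoidHom.fst ((M.shift 1).X i) (N.X i))

/-- The component of an element of the cone in the target. -/
def csnd (i : ℤ) : (cone f).X i →+ N.X i := AddMonoidHom.snd ((M.shift 1).X i) (N.X i)

/-- An element of the source, as an element of the cone. -/
def cinl {i j : ℤ} (h : i + 1 = j) : M.X j →+ (cone f).X i :=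
  (AddMonoidHom.inl ((M.shift 1).X i) (N.X i)).comp (M.sh 1 h).toAddMonoidHom

/-- An element of the target, as an element of the cone. -/
def cinr (i : ℤ) : N.X i →+ (cone f).X i := AddMonoidHom.inr ((M.shift 1).X i) (N.X i)

variable {f}

@[simp] lemma cfst_cinl {i j : ℤ} (h : i + 1 = j) (x : M.X j) : cfst f h (cinl f h x) = x :=
  unsh_sh h x

@[simp] lemma csnd_cinl {i j : ℤ} (h : i + 1 = j) (x : M.X j) : csnd f i (cinl f h x) = 0 := rfl

@[simp] lemma cfst_cinr {i j : ℤ} (h : i + 1 = j) (x : N.X i) : cfst f h (cinr f i x) = 0 :=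
  map_zero (M.unsh 1 h)

@[simp] lemma csnd_cinr {i : ℤ} (x : N.X i) : csnd f i (cinr f i x) = x := rfl

lemma cone_eq {i j : ℤ} (h : i + 1 = j) (x : (cone f).X i) :
    cinl f h (cfst f h x) + cinr f i (csnd f i x) = x :=
  Prod.ext ((add_zero _).trans (sh_unsh h x.1)) (zero_add _)

lemma cone_ext {i j : ℤ} (h : i + 1 = j) {x y : (cone f).X i} (h1 : cfst f h x = cfst f h y)
    (h2 : csnd f i x = csnd f i y) : x = y := by
  rw [← cone_eq h x, h1, h2, cone_eq]

lemma cfst_d {i j l : ℤ} (h : i + 1 = j) (h' : j + 1 = l) (x : (cone f).X i) :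
    cfst f h' ((cone f).d h x) = -M.d h' (cfst f h x) := by
  refine (unsh_d h h h' x.1).trans ?_
  rw [Int.negOnePow_one, Units.neg_smul, _root_.one_smul]
  rfl

lemma csnd_d {i j : ℤ} (h : i + 1 = j) (x : (cone f).X i) :
    csnd f j ((cone f).d h x) = f.f j (cfst f h x) + N.d h (csnd f i x) := by
  subst h
  rfl

lemma d_cinl {i j l : ℤ} (h : i + 1 = j) (h' : j + 1 = l) (x : M.X j) :
    (cone f).d h (cinl f h x) = -cinl f h' (M.d h' x) + cinr f j (f.f j x) :=
  cone_ext h' (by simp [cfst_d h h']) (by simp [csnd_d h])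

lemma d_cinr {i j : ℤ} (h : i + 1 = j) (x : N.X i) :
    (cone f).d h (cinr f i x) = cinr f j (N.d h x) :=
  cone_ext rfl (by simp [cfst_d h rfl]) (by simp [csnd_d h])

lemma cfst_smul {i j l j' l' : ℤ} (h : i + j = l) (hj : j + 1 = j') (hl : l + 1 = l') (a : B.gr i)
    (x : (cone f).X j) : cfst f hl ((cone f).smul h a x) =
      i.negOnePow • M.smul (show i + j' = l' by omega) a (cfst f hj x) := by
  refine (unsh_smul h hj hl a x.1).trans ?_
  rw [one_mul]
  rfl

lemma csnd_smul {i j l : ℤ} (h : i + j = l) (a : B.gr i) (x : (cone f).X j) :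
    csnd f l ((cone f).smul h a x) = N.smul h a (csnd f j x) := rfl

lemma smul_cinl {i j l j' l' : ℤ} (h : i + j = l) (hj : j + 1 = j') (hl : l + 1 = l') (a : B.gr i)
    (x : M.X j') : (cone f).smul h a (cinl f hj x) =
      i.negOnePow • cinl f hl (M.smul (show i + j' = l' by omega) a x) :=
  cone_ext hl (by simp [cfst_smul h hj hl, Units.smul_def])
    (by simp [csnd_smul, Units.smul_def])

lemma smul_cinr {i j l : ℤ} (h : i + j = l) (a : B.gr i) (x : N.X j) :
    (cone f).smul h a (cinr f j x) = cinr f l (N.smul h a x) :=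
  cone_ext rfl (by simp [cfst_smul h rfl rfl]) (by simp [csnd_smul])

lemma cfst_base {i j : ℤ} (h : i + 1 = j) (r : R) (x : (cone f).X i) :
    cfst f h (r • x) = r • cfst f h x := by
  rw [smul_def, cfst_smul (zero_add i) h h, Int.negOnePow_zero, _root_.one_smul, smul_def]

lemma csnd_base {i : ℤ} (r : R) (x : (cone f).X i) : csnd f i (r • x) = r • csnd f i x := rfl

lemma cinl_base {i j : ℤ} (h : i + 1 = j) (r : R) (x : M.X j) :
    cinl f h (r • x) = r • cinl f h x :=
  cone_ext h (by simp [cfst_base]) (by simp [csnd_base])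

variable (f) in
/-- The inclusion of the target into the cone. -/
def coneInr : N ⟶ cone f where
  f := cinr f
  map_smul h a x := (smul_cinr h a x).symm
  map_d h x := (d_cinr h x).symm

@[simp] lemma coneInr_f (i : ℤ) (x : N.X i) : (coneInr f).f i x = cinr f i x := rfl

/-- The homogeneous map out of a cone with given components. -/
def GMap.coneDesc (f : M ⟶ N) (hq : p + 1 = q) (α : GMap M Z p) (β : GMap N Z q) :
    GMap (cone f) Z q where
  f {i j} h := (α.f (show i + 1 + p = j by omega)).comp (cfst f rfl) + (β.f h).comp (csnd f i)
  map_smul {i j l j' l'} h hj hl a x := by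
    simp only [AddMonoidHom.add_apply, AddMonoidHom.comp_apply]
    rw [cfst_smul h rfl rfl, units_smul_map, csnd_smul, β.map_smul h hj hl,
      α.map_smul (show i + (j + 1) = l + 1 by omega) (show j + 1 + p = j' by omega), map_add,
      smul_add, smul_smul, ← Int.negOnePow_add]
    subst hq
    congr 3
    ring

lemma GMap.coneDesc_f (hq : p + 1 = q) (α : GMap M Z p) (β : GMap N Z q) {i j k : ℤ}
    (h : i + q = j) (hk : i + 1 = k) (x : (cone f).X i) : (GMap.coneDesc f hq α β).f h x =
      α.f (show k + p = j by omega) (cfst f hk x) + β.f h (csnd f i x) := by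
  subst hk
  rfl

/-- The restriction of a homogeneous map to the source of a cone. -/
def GMap.coneInl (hq : p + 1 = q) (φ : GMap (cone f) Z q) : GMap M Z p where
  f {i j} h := (φ.f (show i - 1 + q = j by omega)).comp (cinl f (show i - 1 + 1 = i by omega))
  map_smul {i j l j' l'} h hj hl a x := by
    have h1 := φ.map_smul (show i + (j - 1) = l - 1 by omega) (show j - 1 + q = j' by omega)
      (show l - 1 + q = l' by omega) a (cinl f (show j - 1 + 1 = j by omega) x)
    rw [smul_cinl _ _ (show l - 1 + 1 = l by omega), units_smul_map, ← eq_inv_smul_iff, smul_smul,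
      Int.units_inv_eq_self, ← Int.negOnePow_add] at h1
    refine h1.trans ?_
    have e : (i + q * i).negOnePow = (p * i).negOnePow := by
      rw [← hq, show i + (p + 1) * i = p * i + i + i by ring, negOnePow_add_add]
    rw [e]
    rfl

lemma GMap.coneInl_f (hq : p + 1 = q) (φ : GMap (cone f) Z q) {i j k : ℤ} (h : i + p = j)
    (hk : k + 1 = i) (x : M.X i) :
    (φ.coneInl hq).f h x = φ.f (show k + q = j by omega) (cinl f hk x) := by
  obtain rfl : k = i - 1 := by omega
  rfl

lemma negOnePow_of_add_one (h : p + 1 = q) : q.negOnePow = -p.negOnePow := by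
  rw [← h, Int.negOnePow_succ]

/-- A closed map φ on the cone restricts to a closed map on N, bounded by some b. The restriction of
φ to M is then not closed, but becomes so after adding ± b f; if a bounds the sum, then a and b
together bound φ. -/
lemma orthogonal_cone (hM : Orthogonal M Z) (hN : Orthogonal N Z) :
    Orthogonal (cone f) Z := by
  intro p q hq φ hφ
  have ε := negOnePow_of_add_one hq
  have ε' := negOnePow_of_add_one (show p - 1 + 1 = p by omega)
  obtain ⟨b, hb⟩ := hN hq (φ.precomp (coneInr f)) (by
    intro i i' j j' hj hj' hi x
    simpa only [GMap.precomp_f, Hom.map_d] using hφ hj hj' hi ((coneInr f).f i x))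
  obtain ⟨a, ha⟩ := hM (show p - 1 + 1 = p by omega)
    ((φ.coneInl hq).add ((b.precomp f).sgn p.negOnePow)) (by
    intro i i' j j' hj hj' hi x
    have h1 := hφ (show i - 1 + q = j by omega) hj' (show i - 1 + 1 = i by omega)
      (cinl f (by omega) x)
    have h2 := hb (show i + q = j' by omega) hj hj' hi (f.f i x)
    rw [d_cinl _ hi] at h1
    simp only [GMap.precomp_f, coneInr_f, GMap.add_f, GMap.sgn_f, map_add, map_neg, units_smul_map,
      GMap.coneInl_f hq φ hj (show i - 1 + 1 = i by omega), f.map_d,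
      GMap.coneInl_f hq φ _ hi] at h1 h2 ⊢
    rw [h1, h2]
    rcases Int.units_eq_one_or p.negOnePow with e | e <;>
      simp only [ε, e, _root_.one_smul, Units.neg_smul, neg_neg] <;> abel)
  refine ⟨GMap.coneDesc f (by omega) a b, ?_⟩
  intro i i' j j' h hj hj' hi x
  have h1 := ha (show i' + p = j by omega) (show i' + (p - 1) = j' by omega) hj' rfl (cfst f hi x)
  have h2 := hb h hj hj' hi (csnd f i x)
  simp only [GMap.precomp_f, coneInr_f, GMap.add_f, GMap.sgn_f,
      GMap.coneInl_f hq φ _ hi] at h1 h2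
  rw [GMap.coneDesc_f _ _ _ _ hi, GMap.coneDesc_f _ _ _ _ rfl, cfst_d hi rfl, csnd_d hi, map_add,
    map_add, map_neg]
  conv_lhs => rw [← cone_eq hi x, map_add, h2, eq_sub_of_add_eq h1]
  rw [ε']
  rcases Int.units_eq_one_or (p - 1).negOnePow with e | e <;>
    simp only [e, _root_.one_smul, Units.neg_smul, neg_neg] <;> abel

/-- For β closed on N, the composite β f is bounded by some a, and the pair (a, β) is a closed map
on the cone. A bound for it restricts to a bound for β on N. -/
lemma orthogonal_cone_target (hM : Orthogonal M Z) (hf : Orthogonal (cone f) Z) :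
    Orthogonal N Z := by
  intro p q hq β hβ
  have ε := negOnePow_of_add_one hq
  obtain ⟨a, ha⟩ := hM hq ((β.precomp f).sgn q.negOnePow) (by
    intro i i' j j' hj hj' hi x
    simp only [GMap.sgn_f, GMap.precomp_f, units_smul_map, f.map_d, hβ hj hj' hi (f.f _ x)])
  obtain ⟨ψ, hψ⟩ := hf hq (GMap.coneDesc f hq a β) (by
    intro i i' j j' hj hj' hi x
    have h1 := ha (show i' + q = j' by omega) (show i' + p = j by omega) hj' rfl (cfst f hi x)
    have h2 := hβ hj hj' hi (csnd f i x)
    rw [GMap.coneDesc_f _ _ _ _ hi, GMap.coneDesc_f _ _ _ _ rfl, cfst_d hi rfl, csnd_d hi, map_add,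
      map_add, map_neg, h2]
    rw [GMap.sgn_f, GMap.precomp_f] at h1
    rw [eq_add_of_sub_eq h1.symm, ε]
    rcases Int.units_eq_one_or p.negOnePow with e | e <;>
      simp only [e, _root_.one_smul, Units.neg_smul, neg_neg] <;> abel)
  refine ⟨ψ.precomp (coneInr f), ?_⟩
  intro i i' j j' h hj hj' hi x
  have h1 := hψ h hj hj' hi ((coneInr f).f i x)
  rw [GMap.coneDesc_f _ _ _ _ hi, ← Hom.map_d] at h1
  simpa using h1

/-- A closed map α on M, extended by zero on N, is closed on the cone, hence bounded by some ψ. On N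
the map ψ is closed, because the extension vanishes there; if b bounds it, the restriction of ψ to M
corrected by ± b f bounds α. -/
lemma orthogonal_cone_source (hN : Orthogonal N Z) (hf : Orthogonal (cone f) Z) :
    Orthogonal M Z := by
  intro p q hq α hα
  have ε := negOnePow_of_add_one hq
  have ε' := negOnePow_of_add_one (show q + 1 = q + 1 from rfl)
  obtain ⟨ψ, hψ⟩ := hf (show q + 1 = q + 1 from rfl)
    (GMap.coneDesc f rfl α ⟨fun _ => 0, by intros; simp⟩) (by
    intro i i' j j' hj hj' hi x
    rw [GMap.coneDesc_f _ _ _ _ hi, GMap.coneDesc_f _ _ _ _ rfl, cfst_d hi rfl]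
    simp [hα (show i' + q = j by omega) hj' rfl (cfst f hi x), ε'])
  obtain ⟨b, hb⟩ := hN hq (ψ.precomp (coneInr f)) (by
    intro i i' j j' hj hj' hi x
    have h1 := hψ (show i + (q + 1) = j' by omega) hj hj' hi ((coneInr f).f i x)
    rw [GMap.coneDesc_f _ _ _ _ hi, ← Hom.map_d] at h1
    simp only [coneInr_f, cfst_cinr, map_zero, AddMonoidHom.zero_apply, add_zero] at h1
    exact (sub_eq_zero.1 h1.symm))
  refine ⟨(ψ.coneInl hq).add ((b.precomp f).sgn p.negOnePow), ?_⟩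
  intro i i' j j' h hj hj' hi x
  have h1 := hψ (show i - 1 + (q + 1) = j by omega) (show i - 1 + q = j' by omega) hj'
    (show i - 1 + 1 = i by omega) (cinl f (by omega) x)
  have h2 := hb h hj hj' hi (f.f i x)
  rw [GMap.coneDesc_f _ _ _ _ (show i - 1 + 1 = i by omega), d_cinl _ hi] at h1
  simp only [cfst_cinl, AddMonoidHom.zero_apply, add_zero, GMap.precomp_f, coneInr_f, map_add,
    map_neg] at h1 h2
  rw [h2] at h1
  rw [h1]
  simp only [GMap.add_f, GMap.sgn_f, GMap.precomp_f, map_add, units_smul_map,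
    GMap.coneInl_f hq ψ hj (show i - 1 + 1 = i by omega), f.map_d, GMap.coneInl_f hq ψ _ hi, ε]
  rcases Int.units_eq_one_or p.negOnePow with e | e <;>
    simp only [e, _root_.one_smul, Units.neg_smul, neg_neg] <;> abel

end Cone

end CDGModule

namespace CDGModule

variable {R : Type v} [CommRing R] {B : CDGAlgebra.{u, v} R}

/-! ### Homotopies, and lifting along morphisms with orthogonal cone -/

section Homotopy

variable {M N L P : CDGModule.{u, v} B} {p q r : ℤ}

/-- The zero morphism. -/
def zeroHom (M N : CDGModule.{u, v} B) : M ⟶ N := ⟨fun _ => 0, by intros; simp, by intros; simp⟩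

lemma GMap.Closed.sub {φ ψ : GMap M N p} (hφ : φ.Closed) (hψ : ψ.Closed) :
    (φ.add ψ.neg).Closed := by
  intro i i' j j' hj hj' hi x
  simp [hφ hj hj' hi, hψ hj hj' hi]

lemma homotopic_of_isDiff {f g : M ⟶ N} {ψ : GMap M N (-1)}
    (h : ((GMap.ofHom f).add (GMap.ofHom g).neg).IsDiff ψ) : Homotopic f g := by
  refine GMap.homotopic ψ fun {i p q} hp hq x => ?_
  have := h (add_zero i) hp (by omega) hq x
  simpa [← sub_eq_add_neg] using this

lemma homotopic_of_orthogonal (h : Orthogonal M N) (f g : M ⟶ N) : Homotopic f g := by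
  obtain ⟨ψ, hψ⟩ := h (show -1 + 1 = (0 : ℤ) by omega)
    ((GMap.ofHom f).add (GMap.ofHom g).neg)
    (GMap.Closed.sub (GMap.ofHom_closed f) (GMap.ofHom_closed g))
  exact homotopic_of_isDiff hψ

/-- A closed map of degree q to N is a closed morphism of degree 0 to N[q], and a homotopy from it
to zero is a bounding map of degree q - 1 up to the sign of the shifted differential. -/
lemma orthogonal_of_homotopic (h : ∀ (r : ℤ) (f g : M ⟶ N.shift r), Homotopic f g) :
    Orthogonal M N := by
  intro p q hq φ hφ
  obtain ⟨s, hs⟩ := (h q (GMap.toHom (φ.toShift (zero_add q)) (hφ.toShift _))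
    (zeroHom _ _)).exists_gMap
  refine ⟨(s.ofShift (show -1 + q = p by omega)).sgn q.negOnePow, ?_⟩
  intro i i' j j' h hj hj' hi x
  have h1 := congrArg (N.unsh q h) (hs (show i + -1 = i - 1 by omega) hi x)
  have h2 : (zeroHom M (N.shift q)).f i x = 0 := rfl
  rw [h2, sub_zero, GMap.toHom_f, GMap.toShift_f φ _ _ h h, unsh_sh, map_add,
    unsh_d _ (show i - 1 + q = j' by omega)] at h1
  rw [h1, negOnePow_of_add_one hq, GMap.sgn_f, GMap.sgn_f, units_smul_map,
    GMap.ofShift_f s _ _ (show i - 1 + q = j' by omega) (by omega),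
    GMap.ofShift_f s _ _ h (by omega)]
  rcases Int.units_eq_one_or p.negOnePow with e | e <;>
      simp only [e, _root_.one_smul, Units.neg_smul, neg_neg] <;> abel

/-- Homotopies chosen on the summands assemble with no finiteness condition, since a map out of a
direct sum is an arbitrary family. -/
lemma homotopic_of_inc {ι : Type u} {M : ι → CDGModule.{u, v} B} {f g : directSum M ⟶ N}
    (h : ∀ s, Homotopic (inc M s ≫ f) (inc M s ≫ g)) : Homotopic f g := by
  choose s hs using fun t => (h t).exists_gMap
  refine GMap.homotopic (GMap.desc s) fun {i p q} hp hq x => ?_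
  induction x using directSum_induction with
  | h0 => simp
  | ha y z hy hz =>
    simp only [map_add]
    rw [add_sub_add_comm, hy, hz]
    abel
  | hi t y =>
    rw [← (inc M t).map_d, GMap.desc_inc, GMap.desc_inc]
    exact hs t hp hq y

/-- The homogeneous map to a cone with given components. -/
def GMap.coneLift (f : M ⟶ N) (hq : p + 1 = q) (α : GMap P M q) (β : GMap P N p) :
    GMap P (cone f) p where
  f {i j} h := (cinl f rfl).comp (α.f (show i + q = j + 1 by omega)) + (cinr f j).comp (β.f h)
  map_smul {i j l j' l'} h hj hl a x := by
    simp only [AddMonoidHom.add_apply, AddMonoidHom.comp_apply]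
    rw [β.map_smul h hj hl, α.map_smul h (show j + q = j' + 1 by omega), map_add,
      smul_cinl _ rfl rfl, smul_cinr, units_smul_map, units_smul_map, smul_add, smul_smul,
      ← Int.negOnePow_add, show p * i + i = q * i by rw [← hq]; ring]

lemma GMap.coneLift_f (f : M ⟶ N) (hq : p + 1 = q) (α : GMap P M q) (β : GMap P N p)
    {i j k : ℤ} (h : i + p = j) (hk : j + 1 = k) (x : P.X i) :
    (GMap.coneLift f hq α β).f h x =
      cinl f hk (α.f (show i + q = k by omega) x) + cinr f j (β.f h x) := by
  subst hk
  rfl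

/-- The component of a homogeneous map to a cone in the source. -/
def GMap.coneFst {f : M ⟶ N} (hq : p + 1 = q) (φ : GMap P (cone f) p) : GMap P M q where
  f {i j} h := (cfst f (show i + p + 1 = j by omega)).comp (φ.f rfl)
  map_smul {i j l j' l'} h hj hl a x := by
    simp only [AddMonoidHom.comp_apply]
    rw [φ.map_smul h rfl rfl, units_smul_map, cfst_smul _ (show j + p + 1 = j' by omega), smul_smul,
      ← Int.negOnePow_add, show p * i + i = q * i by rw [← hq]; ring]

lemma GMap.coneFst_f {f : M ⟶ N} (hq : p + 1 = q) (φ : GMap P (cone f) p) {i j k : ℤ}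
    (h : i + q = j) (hk : k + 1 = j) (x : P.X i) :
    (φ.coneFst hq).f h x = cfst f hk (φ.f (show i + p = k by omega) x) := by
  obtain rfl : k = i + p := by omega
  rfl

/-- The component of a homogeneous map to a cone in the target. -/
def GMap.coneSnd {f : M ⟶ N} (φ : GMap P (cone f) p) : GMap P N p where
  f {i j} h := (csnd f j).comp (φ.f h)
  map_smul h hj hl a x := by
    simp only [AddMonoidHom.comp_apply]
    rw [φ.map_smul h hj hl, units_smul_map, csnd_smul]

lemma GMap.coneSnd_f {f : M ⟶ N} (φ : GMap P (cone f) p) {i j : ℤ} (h : i + p = j) (x : P.X i) :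
    φ.coneSnd.f h x = csnd f j (φ.f h x) := rfl

/-- The composite of g with N → cone f is bounded by some ψ. Its component in M is a closed morphism
a, and its component in N is a homotopy from g to a f. -/
lemma exists_lift_of_orthogonal {f : M ⟶ N} (h : Orthogonal P (cone f)) (g : P ⟶ N) :
    ∃ a : P ⟶ M, Homotopic g (a ≫ f) := by
  obtain ⟨ψ, hψ⟩ := h (show -1 + 1 = (0 : ℤ) by omega) ((GMap.ofHom g).postcomp (coneInr f))
    (by
      intro i i' j j' hj hj' hi x
      simp only [GMap.postcomp_f, ← Hom.map_d]
      rw [GMap.ofHom_closed g hj hj' hi, units_smul_map])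
  have e1 : ∀ {i i' : ℤ} (hi : i + 1 = i') (x : P.X i),
      cinr f i (g.f i x) = (cone f).d (show i - 1 + 1 = i by omega) (ψ.f (by omega) x) +
        ψ.f (by omega) (P.d hi x) := by
    intro i i' hi x
    have := hψ (add_zero i) (show i + -1 = i - 1 by omega) (by omega) hi x
    simpa using this
  have e2 : (ψ.coneFst (show -1 + 1 = (0 : ℤ) by omega)).Closed := by
    intro i i' j j' hj hj' hi x
    obtain rfl : i = j := by omega
    obtain rfl : i' = j' := by omega
    have := congrArg (cfst f hi) (e1 hi x)
    rw [map_add, cfst_d (show i - 1 + 1 = i by omega), cfst_cinr] at this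
    rw [GMap.coneFst_f _ _ _ (show i - 1 + 1 = i by omega), GMap.coneFst_f _ _ _ hi,
      Int.negOnePow_zero, _root_.one_smul]
    exact (neg_add_eq_zero.1 this.symm)
  refine ⟨GMap.toHom _ e2, GMap.homotopic ψ.coneSnd fun {i p q} hp hq x => ?_⟩
  have := congrArg (csnd f i) (e1 hq x)
  rw [map_add, csnd_d, csnd_cinr] at this
  obtain rfl : p = i - 1 := by omega
  rw [comp_f, GMap.toHom_f, GMap.coneFst_f _ _ _ (show i - 1 + 1 = i by omega), GMap.coneSnd_f,
    GMap.coneSnd_f, this]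
  abel

/-- If s is a homotopy between the composites with f, then (a - b, -s) is a closed map of degree -1
to the cone. The component in M of a bound for it is, up to sign, a homotopy from a to b. -/
lemma homotopic_of_comp_homotopic {f : M ⟶ N} (h : Orthogonal P (cone f)) {a b : P ⟶ M}
    (hab : Homotopic (a ≫ f) (b ≫ f)) : Homotopic a b := by
  obtain ⟨s, hs⟩ := hab.exists_gMap
  have hcl : ((GMap.ofHom a).add (GMap.ofHom b).neg).Closed :=
    GMap.Closed.sub (GMap.ofHom_closed a) (GMap.ofHom_closed b)
  obtain ⟨ψ, hψ⟩ := h (show -2 + 1 = (-1 : ℤ) by omega)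
    (GMap.coneLift f (show -1 + 1 = (0 : ℤ) by omega)
      ((GMap.ofHom a).add (GMap.ofHom b).neg) s.neg) (by
    intro i i' j j' hj hj' hi x
    obtain rfl : i = j' := by omega
    have h1 := hcl (add_zero i) hi hi x
    have h2 := hs hj hi x
    rw [GMap.coneLift_f _ _ _ _ _ hj', GMap.coneLift_f _ _ _ _ _ hi, map_add, d_cinl _ hi, d_cinr,
      h1]
    simp only [GMap.neg_f, GMap.add_f, GMap.ofHom_f, comp_f] at h2 ⊢
    rw [← sub_eq_add_neg (a.f i x), map_sub (f.f i), h2]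
    simp only [Int.negOnePow_zero, _root_.one_smul, map_add, map_neg, Int.negOnePow_neg,
      Int.negOnePow_one, Units.neg_smul]
    abel)
  refine homotopic_of_isDiff (ψ := (ψ.coneFst (show -2 + 1 = (-1 : ℤ) by omega)).neg) ?_
  intro i i' j j' h hj hj' hi x
  have h1 := congrArg (cfst f hj') (hψ hj (show i + -2 = j' - 1 by omega)
    (show j' - 1 + 1 = j' by omega) hi x)
  rw [GMap.coneLift_f _ _ _ _ _ hj', map_add, cfst_cinl, cfst_cinr, add_zero, map_sub,
    cfst_d _ hj', show (-2 : ℤ).negOnePow = 1 from rfl, _root_.one_smul] at h1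
  rw [h1, GMap.neg_f, GMap.neg_f, GMap.coneFst_f _ _ _ (show j' - 1 + 1 = j' by omega),
    GMap.coneFst_f _ _ _ hj']
  simp

end Homotopy

/-! ### Graded split monomorphisms -/

section GradedSplit

variable {M N Q : CDGModule.{u, v} B} {f : M ⟶ N} {q : N ⟶ Q}

/-- The projection from the cone of `f` to a quotient by `f`. -/
def coneToQuotient (hq : IsQuotientBy f q) : cone f ⟶ Q where
  f i := (q.f i).comp (csnd f i)
  map_smul h a x := by
    simp only [AddMonoidHom.comp_apply]
    rw [csnd_smul, Hom.map_smul]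
  map_d {i j} h x := by
    simp only [AddMonoidHom.comp_apply]
    rw [csnd_d, map_add, Hom.map_d, ((hq j).2 _).2 ⟨_, rfl⟩, zero_add]

/-- The cone of a graded split monomorphism is homotopy equivalent to the quotient. -/
lemma exists_homotopy_inverse (hf : IsGradedSplitMono f) (hq : IsQuotientBy f q) :
    ∃ κ : Q ⟶ cone f, κ ≫ coneToQuotient hq = 𝟙 Q ∧ Homotopic (𝟙 _) (coneToQuotient hq ≫ κ) := by
  obtain ⟨ρ, hρ, hρf⟩ := hf
  have hqf : ∀ i (x : M.X i), q.f i (f.f i x) = 0 := fun i x => ((hq i).2 _).2 ⟨x, rfl⟩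
  have hinj : ∀ i (x : M.X i), f.f i x = 0 → x = 0 := fun i x h => by
    rw [← hρf i x, h, map_zero]
  have hker : ∀ i (y : N.X i), q.f i y = 0 → f.f i (ρ i y) = y := fun i y h => by
    obtain ⟨x, rfl⟩ := ((hq i).2 y).1 h
    rw [hρf]
  let g : ∀ i, N.X i →+ N.X i := fun i => AddMonoidHom.id _ - (f.f i).comp (ρ i)
  have hg : ∀ i (y : N.X i), g i y = y - f.f i (ρ i y) := fun _ _ => rfl
  -- The graded section of q complementary to f: it sends the class of y to y - f ρ y, so that ρ σ =
  -- 0.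
  let σ : ∀ i, Q.X i →+ N.X i := fun i => (q.f i).liftOfSurjective (hq i).1
    ⟨g i, fun y hy => (AddMonoidHom.mem_ker).2 (by rw [hg, hker i y hy, sub_self])⟩
  have hσ : ∀ i (y : N.X i), σ i (q.f i y) = y - f.f i (ρ i y) := fun i y =>
    AddMonoidHom.liftOfRightInverse_comp_apply _ _ _ _ y
  have hqσ : ∀ i (x : Q.X i), q.f i (σ i x) = x := fun i x => by
    obtain ⟨y, rfl⟩ := (hq i).1 x
    rw [hσ, map_sub, hqf, sub_zero]
  have hρσ : ∀ i (x : Q.X i), ρ i (σ i x) = 0 := fun i x => by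
    obtain ⟨y, rfl⟩ := (hq i).1 x
    rw [hσ, map_sub, hρf, sub_self]
  have hσs : ∀ {i j l : ℤ} (h : i + j = l) (a : B.gr i) (x : Q.X j),
      σ l (Q.smul h a x) = N.smul h a (σ j x) := fun {i j l} h a x => by
    obtain ⟨y, rfl⟩ := (hq j).1 x
    rw [← Hom.map_smul, hσ, hσ, hρ, Hom.map_smul, map_sub]
  -- The section σ need not commute with d. The defect σ d - d σ takes values in the image of f, and
  -- τ is its preimage in M; adjoining it as the M-component makes σ a closed map to the cone.
  let τ : ∀ {i j : ℤ}, i + 1 = j → Q.X i →+ M.X j := fun {i j} h =>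
    -((ρ j).comp ((N.d h).comp (σ i)))
  have hτ : ∀ {i j : ℤ} (h : i + 1 = j) (x : Q.X i), τ h x = -ρ j (N.d h (σ i x)) :=
    fun _ _ => rfl
  have hfτ : ∀ {i j : ℤ} (h : i + 1 = j) (x : Q.X i),
      f.f j (τ h x) = σ j (Q.d h x) - N.d h (σ i x) := fun {i j} h x => by
    have h1 : q.f j (σ j (Q.d h x) - N.d h (σ i x)) = 0 := by
      rw [map_sub, hqσ, Hom.map_d, hqσ, sub_self]
    have h2 := hker _ _ h1
    rw [map_sub, hρσ, zero_sub] at h2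
    exact h2
  have hτs : ∀ {i j l j' l' : ℤ} (h : i + j = l) (hj : j + 1 = j') (hl : l + 1 = l') (a : B.gr i)
      (x : Q.X j), τ hl (Q.smul h a x) =
        i.negOnePow • M.smul (show i + j' = l' by omega) a (τ hj x) := by
    intro i j l j' l' h hj hl a x
    rw [hτ, hτ, hσs, N.leibniz h rfl hj hl, map_add, hρ, hρσ, map_zero, zero_add,
      units_smul_map, hρ, map_neg, smul_neg]
  have hτd : ∀ {i j l : ℤ} (h : i + 1 = j) (h' : j + 1 = l) (x : Q.X i),
      τ h' (Q.d h x) = -M.d h' (τ h x) := by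
    intro i j l h h' x
    refine eq_neg_of_add_eq_zero_left (hinj _ _ ?_)
    rw [map_add, Hom.map_d, hfτ, hfτ, map_sub, Q.d_d, N.d_d, hσs]
    abel
  let κ : Q ⟶ cone f :=
    { f := fun i => (cinr f i).comp (σ i) + (cinl f rfl).comp (τ rfl)
      map_smul := fun {i j l} h a x => by
        simp only [AddMonoidHom.add_apply, AddMonoidHom.comp_apply]
        rw [hσs, hτs h rfl, map_add, smul_cinr, smul_cinl _ rfl rfl, units_smul_map]
      map_d := fun {i j} h x => by
        subst h
        simp only [AddMonoidHom.add_apply, AddMonoidHom.comp_apply]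
        rw [hτd rfl rfl, map_add, d_cinr, d_cinl rfl rfl, hfτ, map_sub, map_neg]
        abel }
  have hκ : ∀ {i j : ℤ} (h : i + 1 = j) (x : Q.X i),
      κ.f i x = cinr f i (σ i x) + cinl f h (τ h x) := by
    intro i j h x
    subst h
    rfl
  have hπ : ∀ i (x : (cone f).X i), (coneToQuotient hq).f i x = q.f i (csnd f i x) :=
    fun _ _ => rfl
  refine ⟨κ, Hom.ext' fun i x => ?_, ?_⟩
  · rw [comp_f, hκ rfl, hπ, map_add, csnd_cinr, csnd_cinl, add_zero, hqσ, id_f]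
  -- The homotopy applies ρ to the N-component and places the result in the M-component; it
  -- contracts the copy of M inside N against the shifted one.
  · refine GMap.homotopic
      ⟨fun {i j} h => (cinl f (show j + 1 = i by omega)).comp ((ρ i).comp (csnd f i)), ?_⟩ ?_
    · intro i j l j' l' h hj hl a x
      simp only [AddMonoidHom.comp_apply]
      rw [csnd_smul, hρ, smul_cinl _ _ (show l' + 1 = l by omega), smul_smul,
        ← Int.negOnePow_add]
      simp
    · intro i p r hp hr x
      simp only [AddMonoidHom.comp_apply, comp_f, id_f]
      rw [hπ, hκ hr, hσ, hτ, hσ, d_cinl _ hr, csnd_d, map_add (ρ r), hρf, map_sub (N.d hr),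
        map_sub (ρ r), ← Hom.map_d, hρf]
      refine (congrArg (· - _) (cone_eq hr x).symm).trans ?_
      simp only [map_add, map_sub, map_neg]
      abel

end GradedSplit

end CDGModule

/-! ### The homotopy category and its localizing subcategories -/

namespace Hot

open CDGModule

variable {R : Type v} [CommRing R] {B : CDGAlgebra.{u, v} R}

lemma mk_eq_iff {M N : CDGModule.{u, v} B} (f g : M ⟶ N) : mk f = mk g ↔ Homotopic f g :=
  CategoryTheory.Quotient.functor_map_eq_iff _ f g

lemma mk_surjective {M N : CDGModule.{u, v} B} (f : of M ⟶ of N) : ∃ g : M ⟶ N, mk g = f :=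
  (CategoryTheory.Quotient.functor (Homotopic (B := B))).map_surjective f

lemma mk_comp {M N L : CDGModule.{u, v} B} (f : M ⟶ N) (g : N ⟶ L) :
    mk (f ≫ g) = mk f ≫ mk g := rfl

lemma mk_id (M : CDGModule.{u, v} B) : mk (𝟙 M) = 𝟙 (of M) := rfl

lemma isZero_of_homotopic {M : CDGModule.{u, v} B} (h : Homotopic (𝟙 M) (zeroHom M M)) :
    Limits.IsZero (of M) := by
  have h1 : 𝟙 (of M) = mk (zeroHom M M) := (mk_eq_iff _ _).2 h
  refine ⟨fun X => ⟨⟨⟨mk (zeroHom M X.as)⟩, fun a => ?_⟩⟩,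
    fun X => ⟨⟨⟨mk (zeroHom X.as M)⟩, fun a => ?_⟩⟩⟩
  · obtain ⟨a, rfl⟩ := mk_surjective (N := X.as) a
    rw [← Category.id_comp (mk a), h1, ← mk_comp]
    exact congrArg mk (Hom.ext' fun i x => map_zero (a.f i))
  · obtain ⟨a, rfl⟩ := mk_surjective (M := X.as) a
    rw [← Category.comp_id (mk a), h1, ← mk_comp]
    rfl

/-- This is exactness of Hom(P, -) on the triangle of f: orthogonality in degree 0 gives
surjectivity, in degree -1 injectivity. -/
lemma bijective_comp_mk {M N P : CDGModule.{u, v} B} {f : M ⟶ N} (h : Orthogonal P (cone f)) :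
    Function.Bijective fun a : of P ⟶ of M => a ≫ mk f := by
  constructor
  · intro a b hab
    obtain ⟨a, rfl⟩ := mk_surjective a
    obtain ⟨b, rfl⟩ := mk_surjective b
    exact (mk_eq_iff _ _).2 (homotopic_of_comp_homotopic h ((mk_eq_iff _ _).1 hab))
  · intro g
    obtain ⟨g, rfl⟩ := mk_surjective g
    obtain ⟨a, ha⟩ := exists_lift_of_orthogonal h g
    exact ⟨mk a, ((mk_eq_iff _ _).2 ha).symm⟩

variable {T : ObjectProperty (Hot B)}

/-- The direct sum of modules is also the coproduct in the homotopy category: representatives of the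
components give existence, and componentwise homotopies give uniqueness. -/
lemma mem_directSum (hT : IsLocalizing T) {ι : Type u} (M : ι → CDGModule.{u, v} B)
    (h : ∀ s, T (of (M s))) :
    T (of (directSum M)) := by
  choose r hr using fun (t : Limits.Cofan fun s => of (M s)) (s : ι) =>
    mk_surjective (M := M s) (N := t.pt.as) (t.inj s)
  refine hT.coproduct ι (fun s => of (M s))
    (Limits.Cofan.mk (of (CDGModule.directSum M)) fun s => mk (inc M s))
    ⟨Limits.Cofan.IsColimit.mk _ (fun t => mk (descHom (r t))) (fun t s => ?_) (fun t m hm => ?_)⟩ h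
  · refine Eq.trans ?_ (hr t s)
    change mk (inc M s ≫ descHom (r t)) = _
    exact congrArg mk (Hom.ext' fun i x => descHom_inc _ _ _)
  · obtain ⟨m, rfl⟩ := mk_surjective (M := CDGModule.directSum M) (N := t.pt.as) m
    refine (mk_eq_iff _ _).2 (homotopic_of_inc fun s => (mk_eq_iff _ _).1 ?_)
    refine (hm s).trans ((hr t s).symm.trans ?_)
    exact congrArg mk (Hom.ext' fun i x => (descHom_inc _ _ _).symm)

/-- A short exact sequence that splits as graded modules behaves as a triangle, because the quotient
is homotopy equivalent to the cone. -/
lemma mem_quotient (hT : IsLocalizing T) {M N Q : CDGModule.{u, v} B} {f : M ⟶ N} {q : N ⟶ Q}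
    (hf : IsGradedSplitMono f) (hq : IsQuotientBy f q) (hM : T (of M)) (hN : T (of N)) :
    T (of Q) := by
  obtain ⟨κ, h1, h2⟩ := exists_homotopy_inverse hf hq
  have := hT.iso
  refine T.prop_of_iso (⟨mk (coneToQuotient hq), mk κ, ?_, ?_⟩ : of (cone f) ≅ of Q)
    (hT.cone₃ f hM hN)
  · rw [← mk_comp, ← mk_id]
    exact ((mk_eq_iff _ _).2 h2).symm
  · rw [← mk_comp, h1, mk_id]

end Hot

namespace CDGModule

variable {R : Type v} [CommRing R] {B : CDGAlgebra.{u, v} R}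

/-! ### Attaching cells -/

section Attach

variable {M N Z : CDGModule.{u, v} B} {p q : ℤ}

lemma GMap.coneDesc_closed {f : M ⟶ N} (hq : p + 1 = q) {α : GMap M Z p} {β : GMap N Z q}
    (hβ : β.Closed) (hα : ∀ {i i' j j' : ℤ} (hj : i + p = j) (hj' : j + 1 = j') (hi : i + 1 = i')
      (x : M.X i), Z.d hj' (α.f hj x) = p.negOnePow • α.f (show i' + p = j' by omega) (M.d hi x) +
        q.negOnePow • β.f (show i + q = j' by omega) (f.f i x)) :
    (GMap.coneDesc f hq α β).Closed := by
  intro i i' j j' hj hj' hi x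
  have h1 := hα (show i' + p = j by omega) hj' rfl (cfst f hi x)
  have h2 := hβ hj hj' hi (csnd f i x)
  rw [GMap.coneDesc_f _ _ _ _ hi, GMap.coneDesc_f _ _ _ _ rfl, cfst_d hi rfl, csnd_d hi, map_add,
    map_add, map_neg, h1, h2, negOnePow_of_add_one hq]
  rcases Int.units_eq_one_or p.negOnePow with e | e <;>
    simp only [e, _root_.one_smul, Units.neg_smul, neg_neg] <;> abel

/-- A contracting homotopy of a closed morphism. -/
structure NullHomotopy (g : M ⟶ N) where
  s : GMap M N (-1)
  eq : ∀ {i p q : ℤ} (hp : i + -1 = p) (hq : i + 1 = q) (x : M.X i),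
    g.f i x = N.d (show p + 1 = i by omega) (s.f hp x) +
      s.f (show q + -1 = i by omega) (M.d hq x)

/-- A cell, to be attached to the source of `f`: a closed morphism from a shift of a member of the
family `X`, whose composite with `f` is contracted. -/
structure Cell {σ : Type} (X : σ → CDGModule.{u, v} B) (f : N ⟶ M) where
  s : σ
  p : ℤ
  φ : (X s).shift p ⟶ N
  h : NullHomotopy (φ ≫ f)

variable {σ : Type} (X : σ → CDGModule.{u, v} B)

lemma coneInr_isGradedSplitMono (f : M ⟶ N) : IsGradedSplitMono (coneInr f) :=
  ⟨csnd f, fun _ _ _ => rfl, fun _ _ => rfl⟩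

/-- The identification of `M[p][1]` with `M[p + 1]`. -/
def shiftSucc (M : CDGModule.{u, v} B) (p : ℤ) : GMap (M.shift p) (M.shift (p + 1)) (-1) :=
  ((GMap.ofHom (𝟙 M)).toShiftDom (zero_add p)).toShift (by omega)

lemma shiftSucc_closed (M : CDGModule.{u, v} B) (p : ℤ) : (shiftSucc M p).Closed :=
  GMap.Closed.toShift (GMap.Closed.toShiftDom (GMap.ofHom_closed (𝟙 M)) _) _

lemma shiftSucc_f (M : CDGModule.{u, v} B) (p : ℤ) {i j k : ℤ} (h : i + -1 = j) (hk : i + p = k)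
    (x : (M.shift p).X i) :
    (shiftSucc M p).f h x = M.sh (p + 1) (show j + (p + 1) = k by omega) (M.unsh p hk x) := by
  rw [shiftSucc, GMap.toShift_f _ _ _ (show j + (p + 1) = k by omega) (by omega),
    GMap.toShiftDom_f _ _ _ hk (by omega), GMap.ofHom_f, id_f]

/-- The inverse of `shiftSucc`. -/
def shiftPred (M : CDGModule.{u, v} B) (p : ℤ) : GMap (M.shift (p + 1)) (M.shift p) 1 :=
  ((GMap.ofHom (𝟙 M)).toShiftDom (zero_add (p + 1))).toShift (by omega)

lemma shiftPred_f (M : CDGModule.{u, v} B) (p : ℤ) {i j k : ℤ} (h : i + 1 = j) (hk : j + p = k)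
    (x : (M.shift (p + 1)).X i) :
    (shiftPred M p).f h x = M.sh p hk (M.unsh (p + 1) (show i + (p + 1) = k by omega) x) := by
  rw [shiftPred, GMap.toShift_f _ _ _ hk (by omega),
    GMap.toShiftDom_f _ _ _ (show i + (p + 1) = k by omega) (by omega), GMap.ofHom_f, id_f]

lemma GMap.desc_closed {ι : Type u} {L : ι → CDGModule.{u, v} B} {φ : ∀ s, GMap (L s) Z p}
    (h : ∀ s, (φ s).Closed) : (GMap.desc φ).Closed := by
  intro i i' j j' hj hj' hi x
  induction x using directSum_induction with
  | h0 => simp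
  | ha y z hy hz => simp only [map_add, smul_add, hy, hz]
  | hi s y => rw [← Hom.map_d, GMap.desc_inc, GMap.desc_inc, h s hj hj' hi y]

/-- Modulo N, the cone of g is its source shifted by one, and the sum of the M[p] shifted by one is
the sum of the M[p + 1]. The maps θ and θ' below realize this identification in both directions. -/
lemma exists_cone_quotient {ι : Type u} (s : ι → σ) (p : ι → ℤ)
    (g : (directSum fun t => (X (s t)).shift (p t)) ⟶ N) :
    ∃ q : cone g ⟶ directSum fun t => (X (s t)).shift (p t + 1), IsQuotientBy (coneInr g) q := by
  let θ : GMap (directSum fun t => (X (s t)).shift (p t))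
      (directSum fun t => (X (s t)).shift (p t + 1)) (-1) :=
    GMap.desc fun t => (shiftSucc (X (s t)) (p t)).postcomp
      (inc (fun t => (X (s t)).shift (p t + 1)) t)
  have hθ : θ.Closed := GMap.desc_closed fun t {i i' j j'} hj hj' hi x => by
    rw [GMap.postcomp_f, GMap.postcomp_f, ← Hom.map_d, shiftSucc_closed _ _ hj hj' hi x,
      units_smul_map]
  let θ' : GMap (directSum fun t => (X (s t)).shift (p t + 1))
      (directSum fun t => (X (s t)).shift (p t)) 1 :=
    GMap.desc fun t => (shiftPred (X (s t)) (p t)).postcomp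
      (inc (fun t => (X (s t)).shift (p t)) t)
  have h1 : ∀ {i j : ℤ} (h : j + 1 = i) (x : (directSum fun t => (X (s t)).shift (p t)).X i),
      θ'.f h (θ.f (show i + -1 = j by omega) x) = x := fun {i j} h x => by
    induction x using directSum_induction with
    | h0 => simp
    | ha y z hy hz => simp only [map_add, hy, hz]
    | hi t y =>
      rw [GMap.desc_inc, GMap.postcomp_f, GMap.desc_inc, GMap.postcomp_f, shiftSucc_f _ _ _ rfl,
        shiftPred_f _ _ _ rfl, unsh_sh, sh_unsh]
  have h2 : ∀ {i j : ℤ} (h : j + 1 = i) (x : (directSum fun t => (X (s t)).shift (p t + 1)).X j),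
      θ.f (show i + -1 = j by omega) (θ'.f h x) = x := fun {i j} h x => by
    induction x using directSum_induction with
    | h0 => simp
    | ha y z hy hz => simp only [map_add, hy, hz]
    | hi t y =>
      rw [GMap.desc_inc, GMap.postcomp_f, GMap.desc_inc, GMap.postcomp_f, shiftPred_f _ _ _ rfl,
        shiftSucc_f _ _ _ rfl, unsh_sh, sh_unsh]
  let zero : GMap N (directSum fun t => (X (s t)).shift (p t + 1)) 0 :=
    ⟨fun _ => 0, by intros; simp⟩
  have hcl : (GMap.coneDesc g (show -1 + 1 = (0 : ℤ) by omega) θ zero).Closed :=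
    GMap.coneDesc_closed _ (fun _ _ _ _ => by simp [zero]) fun hj hj' hi x => by
      rw [hθ hj hj' hi x]
      simp [zero]
  have hq : ∀ i (x : (cone g).X i), (GMap.toHom _ hcl).f i x = θ.f (by omega) (cfst g rfl x) :=
    fun i x => by
      rw [GMap.toHom_f, GMap.coneDesc_f _ _ _ _ rfl]
      exact add_zero _
  refine ⟨GMap.toHom _ hcl, fun i => ⟨fun x => ⟨cinl g rfl (θ'.f rfl x), ?_⟩, fun x => ⟨?_, ?_⟩⟩⟩
  · rw [hq, cfst_cinl, h2]
  · intro h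
    rw [hq] at h
    refine ⟨csnd g i x, cone_ext (show i + 1 = i + 1 from rfl) ?_ ?_⟩
    · rw [coneInr_f, cfst_cinr, ← h1 rfl (cfst g rfl x), h, map_zero]
    · rw [coneInr_f, csnd_cinr]
  · rintro ⟨y, rfl⟩
    rw [hq, coneInr_f, cfst_cinr, map_zero]

/-- Attaching all cells to the source of `f`. -/
lemma exists_attach (f : N ⟶ M) : ∃ (N' : CDGModule.{u, v} B) (f' : N' ⟶ M) (j : N ⟶ N'),
    j ≫ f' = f ∧ IsGradedSplitMono j ∧
    (∃ (ι : Type u) (s : ι → σ) (p : ι → ℤ) (q : N' ⟶ directSum fun t => (X (s t)).shift (p t)),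
      IsQuotientBy j q) ∧
    (∀ T : ObjectProperty (Hot B), Hot.IsLocalizing T → (∀ s, T (Hot.of (X s))) → T (Hot.of N) →
      T (Hot.of N')) ∧
    ∀ c : Cell X f, ∃ k : NullHomotopy (c.φ ≫ j),
      ∀ {i l : ℤ} (h : i + -1 = l) x, f'.f l (k.s.f h x) = c.h.s.f h x := by
  -- The sum runs over all cells at once, each with a chosen null-homotopy; these form a type in the
  -- universe `u`, so the direct sum is available. The null-homotopies together extend f over the
  -- cone of g.
  let g : (directSum fun t : Cell X f => (X t.s).shift t.p) ⟶ N := descHom fun t => t.φ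
  let H : GMap (directSum fun t : Cell X f => (X t.s).shift t.p) M (-1) :=
    GMap.desc fun t => t.h.s
  have hcl : (GMap.coneDesc g (show -1 + 1 = (0 : ℤ) by omega) H (GMap.ofHom f)).Closed := by
    refine GMap.coneDesc_closed _ (GMap.ofHom_closed f) ?_
    intro i i' j j' hj hj' hi x
    obtain rfl : i = j' := by omega
    induction x using directSum_induction with
    | h0 => simp
    | ha y z hy hz =>
      simp only [map_add, smul_add, hy, hz]
      abel
    | hi s y =>
      have h1 := s.h.eq hj hi y
      rw [← Hom.map_d, GMap.desc_inc, GMap.desc_inc, GMap.ofHom_f, descHom_inc]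
      rw [comp_f] at h1
      rw [h1]
      simp
  have hf' : ∀ i (x : (cone g).X i), (GMap.toHom _ hcl).f i x =
      H.f (by omega) (cfst g rfl x) + f.f i (csnd g i x) := fun i x => by
    rw [GMap.toHom_f, GMap.coneDesc_f _ _ _ _ rfl, GMap.ofHom_f]
  refine ⟨cone g, GMap.toHom _ hcl, coneInr g, Hom.ext' fun i x => ?_,
    coneInr_isGradedSplitMono g, ?_, ?_, ?_⟩
  · rw [comp_f, hf', coneInr_f, cfst_cinr, csnd_cinr, map_zero, zero_add]
  · obtain ⟨q, hq⟩ := exists_cone_quotient X (fun t : Cell X f => t.s) (fun t => t.p) g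
    exact ⟨Cell X f, fun t => t.s, fun t => t.p + 1, q, hq⟩
  · intro T hT hX hN
    exact hT.cone₃ g (Hot.mem_directSum hT _ fun t => hT.shift _ _ (hX t.s)) hN
  · intro c
    -- The summand of index c, placed in the source part of the cone, contracts the attaching map of
    -- c; the extension of f was defined there by the null-homotopy belonging to c.
    refine ⟨⟨⟨fun {i l} h => (cinl g (show l + 1 = i by omega)).comp
      ((inc (fun t : Cell X f => (X t.s).shift t.p) c).f i), ?_⟩, ?_⟩, ?_⟩
    · intro i j l j' l' h hj hl a x
      simp only [AddMonoidHom.comp_apply]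
      rw [Hom.map_smul, smul_cinl _ _ (show l' + 1 = l by omega), smul_smul, ← Int.negOnePow_add]
      simp
    · intro i p q hp hq x
      simp only [AddMonoidHom.comp_apply]
      rw [d_cinl _ hq, ← Hom.map_d, descHom_inc, comp_f, coneInr_f]
      abel
    · intro i l h x
      obtain rfl : l + 1 = i := by omega
      simp only [AddMonoidHom.comp_apply]
      rw [hf', cfst_cinl, csnd_cinl, map_zero, add_zero, GMap.desc_inc]

end Attach

/-! ### Cokernels -/

section Cokernel

variable {M N L : CDGModule.{u, v} B}

/-- The cokernel of a closed morphism. -/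
def coker (f : M ⟶ N) : CDGModule.{u, v} B where
  X i := N.X i ⧸ (f.f i).range
  smul {i j l} h :=
    { toFun := fun a => QuotientAddGroup.map _ _ (N.smul h a) (by
        rintro _ ⟨x, rfl⟩
        exact ⟨M.smul h a x, f.map_smul h a x⟩)
      map_zero' := AddMonoidHom.ext fun x => by
        obtain ⟨x, rfl⟩ := QuotientAddGroup.mk_surjective x
        exact congrArg QuotientAddGroup.mk (by rw [map_zero, AddMonoidHom.zero_apply])
      map_add' := fun a b => AddMonoidHom.ext fun x => by
        obtain ⟨x, rfl⟩ := QuotientAddGroup.mk_surjective x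
        exact congrArg QuotientAddGroup.mk (by rw [map_add, AddMonoidHom.add_apply]) }
  one_smul x := by
    obtain ⟨x, rfl⟩ := QuotientAddGroup.mk_surjective x
    exact congrArg QuotientAddGroup.mk (N.one_smul x)
  mul_smul h h' h'' a b x := by
    obtain ⟨x, rfl⟩ := QuotientAddGroup.mk_surjective x
    exact congrArg QuotientAddGroup.mk (N.mul_smul h h' h'' a b x)
  d {i j} h := QuotientAddGroup.map _ _ (N.d h) (by
    rintro _ ⟨x, rfl⟩
    exact ⟨M.d h x, f.map_d h x⟩)
  leibniz h hi hj hl a x := by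
    obtain ⟨x, rfl⟩ := QuotientAddGroup.mk_surjective x
    exact congrArg QuotientAddGroup.mk (N.leibniz h hi hj hl a x)
  d_d h h' x := by
    obtain ⟨x, rfl⟩ := QuotientAddGroup.mk_surjective x
    exact congrArg QuotientAddGroup.mk (N.d_d h h' x)

lemma exists_isQuotientBy (f : M ⟶ N) :
    ∃ (Q : CDGModule.{u, v} B) (q : N ⟶ Q), IsQuotientBy f q :=
  ⟨coker f, ⟨fun i => QuotientAddGroup.mk' (f.f i).range, fun _ _ _ => rfl, fun _ _ => rfl⟩,
    fun _ => ⟨QuotientAddGroup.mk_surjective, fun y => QuotientAddGroup.eq_zero_iff y⟩⟩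

lemma IsQuotientBy.exists_desc {Q : CDGModule.{u, v} B} {f : M ⟶ N} {q : N ⟶ Q}
    (hq : IsQuotientBy f q) (g : N ⟶ L) (hg : ∀ i x, g.f i (f.f i x) = 0) :
    ∃ g' : Q ⟶ L, q ≫ g' = g := by
  let γ : ∀ i, Q.X i →+ L.X i := fun i => (q.f i).liftOfSurjective (hq i).1
    ⟨g.f i, fun y hy => by
      obtain ⟨x, rfl⟩ := ((hq i).2 y).1 hy
      exact hg i x⟩
  have hγ : ∀ i (y : N.X i), γ i (q.f i y) = g.f i y := fun i y =>
    AddMonoidHom.liftOfRightInverse_comp_apply _ _ _ _ y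
  refine ⟨⟨γ, fun {i j l} h a x => ?_, fun {i j} h x => ?_⟩, Hom.ext' hγ⟩
  · obtain ⟨y, rfl⟩ := (hq j).1 x
    rw [← Hom.map_smul, hγ, hγ, Hom.map_smul]
  · obtain ⟨y, rfl⟩ := (hq i).1 x
    rw [← Hom.map_d, hγ, hγ, Hom.map_d]

end Cokernel

/-! ### Sequential colimits of graded split monomorphisms -/

section Colimit

variable {F : ℕ → CDGModule.{u, v} B} (j : ∀ m, F m ⟶ F (m + 1))

/-- The sum of the terms of a sequence of cdg modules. -/
noncomputable abbrev seqSum (F : ℕ → CDGModule.{u, v} B) : CDGModule.{u, v} B :=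
  directSum fun m : ULift.{u} ℕ => F m.down

/-- The inclusion of a term of a sequence. -/
noncomputable def seqInc (F : ℕ → CDGModule.{u, v} B) (m : ℕ) : F m ⟶ seqSum F :=
  inc (fun m : ULift.{u} ℕ => F m.down) ⟨m⟩

lemma seqSum_induction {i : ℤ} {C : (seqSum F).X i → Prop} (x : (seqSum F).X i)
    (h0 : C 0) (hi : ∀ m (y : (F m).X i), C ((seqInc F m).f i y))
    (ha : ∀ y z, C y → C z → C (y + z)) : C x :=
  directSum_induction (M := fun m : ULift.{u} ℕ => F m.down) x h0 (fun m y => hi m.down y) ha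

/-- The map `1 - shift`, whose cokernel is the colimit of the sequence. -/
noncomputable def seqMap : seqSum F ⟶ seqSum F :=
  descHom fun m => ⟨fun i => (seqInc F m.down).f i - ((seqInc F (m.down + 1)).f i).comp
      ((j m.down).f i), fun h a x => by simp [Hom.map_smul], fun h x => by simp [Hom.map_d]⟩

lemma seqMap_inc (m : ℕ) {i : ℤ} (x : (F m).X i) : (seqMap j).f i ((seqInc F m).f i x) =
    (seqInc F m).f i x - (seqInc F (m + 1)).f i ((j m).f i x) :=
  descHom_inc _ _ _

variable {j}

/-- The retractions of the individual maps j_m telescope to a retraction of 1 - shift on the whole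
sum. -/
lemma seqMap_isGradedSplitMono (hj : ∀ m, IsGradedSplitMono (j m)) :
    IsGradedSplitMono (seqMap j) := by
  choose r hr hrj using hj
  -- S_m sends x in F_m to the sum of its successive retracts in F_{m-1}, …, F_0. Since S_{m+1}(j x)
  -- = S_m x + x, the map -S is a left inverse of 1 - shift.
  let S : ∀ (m : ℕ) (i : ℤ), (F m).X i →+ (seqSum F).X i := fun m => Nat.rec (fun i => 0)
    (fun m S i => (S i).comp (r m i) + ((seqInc F m).f i).comp (r m i)) m
  have hS : ∀ m i (x : (F (m + 1)).X i),
      S (m + 1) i x = S m i (r m i x) + (seqInc F m).f i (r m i x) := fun _ _ _ => rfl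
  have hSs : ∀ m {i l p : ℤ} (h : i + l = p) (a : B.gr i) (x : (F m).X l),
      S m p ((F m).smul h a x) = (seqSum F).smul h a (S m l x) := by
    intro m
    induction m with
    | zero =>
      intro i l p h a x
      exact (map_zero _).symm
    | succ m ih =>
      intro i l p h a x
      rw [hS, hS, hr, ih, map_add, Hom.map_smul]
  have hρ : ∀ m {i : ℤ} (x : (F m).X i),
      sumDesc (fun m : ULift.{u} ℕ => F m.down) (fun m => -S m.down i) ((seqInc F m).f i x) =
        -S m i x := fun m i x => sumDesc_inc _ _ _
  refine ⟨fun i => sumDesc _ fun m => -S m.down i, fun {i l p} h a y => ?_, fun i x => ?_⟩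
  · induction y using seqSum_induction with
    | h0 => simp
    | ha y z hy hz => simp only [map_add, hy, hz]
    | hi m y => rw [← Hom.map_smul, hρ, hρ, hSs, map_neg]
  · induction x using seqSum_induction with
    | h0 => simp
    | ha y z hy hz => simp only [map_add, hy, hz]
    | hi m y =>
      rw [seqMap_inc, map_sub, hρ, hρ, hS, hrj]
      abel

/-- The component of index `m`. -/
def seqProj (m : ℕ) (i : ℤ) : (seqSum F).X i →+ (F m).X i :=
  proj (fun m : ULift.{u} ℕ => F m.down) ⟨m⟩ i

lemma seqProj_inc_self (m : ℕ) {i : ℤ} (x : (F m).X i) :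
    seqProj m i ((seqInc F m).f i x) = x := proj_inc_self _ _

lemma seqProj_inc_of_ne {m m' : ℕ} (h : m ≠ m') {i : ℤ} (x : (F m).X i) :
    seqProj m' i ((seqInc F m).f i x) = 0 :=
  proj_inc_of_ne (fun e => h (congrArg ULift.down e)) _

lemma seqProj_seqMap_zero {i : ℤ} (z : (seqSum F).X i) :
    seqProj 0 i ((seqMap j).f i z) = seqProj 0 i z := by
  induction z using seqSum_induction with
  | h0 => simp
  | ha y z hy hz => simp only [map_add, hy, hz]
  | hi m y => rw [seqMap_inc, map_sub, seqProj_inc_of_ne (Nat.succ_ne_zero m), sub_zero]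

lemma seqProj_seqMap_succ (m : ℕ) {i : ℤ} (z : (seqSum F).X i) :
    seqProj (m + 1) i ((seqMap j).f i z) = seqProj (m + 1) i z - (j m).f i (seqProj m i z) := by
  induction z using seqSum_induction with
  | h0 => simp
  | ha y z hy hz =>
    simp only [map_add, hy, hz]
    abel
  | hi m' y =>
    rw [seqMap_inc, map_sub]
    by_cases h : m' = m
    · subst h
      rw [seqProj_inc_self, seqProj_inc_self]
    · rw [seqProj_inc_of_ne h, seqProj_inc_of_ne (fun e => h (Nat.succ_injective e)), map_zero]

lemma exists_forall_seqProj_eq_zero {i : ℤ} (z : (seqSum F).X i) :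
    ∃ K, ∀ m, K ≤ m → seqProj m i z = 0 := by
  induction z using seqSum_induction with
  | h0 => exact ⟨0, fun m _ => map_zero _⟩
  | ha y z hy hz =>
    obtain ⟨K, hK⟩ := hy
    obtain ⟨K', hK'⟩ := hz
    refine ⟨max K K', fun m hm => ?_⟩
    rw [map_add, hK m (by omega), hK' m (by omega), add_zero]
  | hi m y => exact ⟨m + 1, fun m' hm => seqProj_inc_of_ne (by omega) y⟩

/-- This gives injectivity of F_m → colim. Reading the equation by components, z vanishes below m,
equals x at m, and afterwards satisfies z_{k+1} = j_k z_k. As z has finite support and every j_k is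
injective, descent from a vanishing component back to m gives x = 0. -/
lemma eq_zero_of_seqMap_eq (hj : ∀ m i, Function.Injective ((j m).f i)) {m : ℕ} {i : ℤ}
    {x : (F m).X i} {z : (seqSum F).X i} (h : (seqMap j).f i z = (seqInc F m).f i x) : x = 0 := by
  have h0 : ∀ k, k < m → seqProj k i z = 0 := by
    intro k
    induction k with
    | zero =>
      intro hk
      rw [← seqProj_seqMap_zero (j := j), h, seqProj_inc_of_ne (by omega)]
    | succ k ih =>
      intro hk
      have := seqProj_seqMap_succ (j := j) k z
      rw [h, seqProj_inc_of_ne (by omega), ih (by omega), map_zero, sub_zero] at this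
      exact this.symm
  have h1 : seqProj m i z = x := by
    rcases m with _ | m
    · rw [← seqProj_seqMap_zero (j := j), h, seqProj_inc_self]
    · have := seqProj_seqMap_succ (j := j) m z
      rw [h, seqProj_inc_self, h0 m (by omega), map_zero, sub_zero] at this
      exact this.symm
  have h2 : ∀ k, m ≤ k → seqProj (k + 1) i z = 0 → seqProj k i z = 0 := by
    intro k hk hz
    have := seqProj_seqMap_succ (j := j) k z
    rw [h, seqProj_inc_of_ne (by omega), hz, zero_sub] at this
    exact hj k i (by rw [map_zero, ← neg_eq_zero, ← this])
  obtain ⟨K, hK⟩ := exists_forall_seqProj_eq_zero z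
  have h3 : ∀ k l, m ≤ k → k + l = m + K → seqProj k i z = 0 := by
    intro k l
    induction l generalizing k with
    | zero => exact fun _ hk => hK k (by omega)
    | succ l ih => exact fun hm hk => h2 k hm (ih (k + 1) (by omega) (by omega))
  rw [← h1, h3 m K le_rfl rfl]

lemma IsGradedSplitMono.injective {M N : CDGModule.{u, v} B} {f : M ⟶ N}
    (hf : IsGradedSplitMono f) (i : ℤ) : Function.Injective (f.f i) := by
  obtain ⟨r, -, hr⟩ := hf
  exact Function.LeftInverse.injective (hr i)

/-- The colimit of a sequence of graded split monomorphisms. -/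
lemma exists_colimit (hj : ∀ m, IsGradedSplitMono (j m)) :
    ∃ (P : CDGModule.{u, v} B) (ι : ∀ m, F m ⟶ P), (∀ m, j m ≫ ι (m + 1) = ι m) ∧
      (∀ m i, Function.Injective ((ι m).f i)) ∧
      (∀ i (x : P.X i), ∃ m y, (ι m).f i y = x) ∧
      (∀ T : ObjectProperty (Hot B), Hot.IsLocalizing T → (∀ m, T (Hot.of (F m))) →
        T (Hot.of P)) ∧
      ∀ (L : CDGModule.{u, v} B) (g : ∀ m, F m ⟶ L), (∀ m, j m ≫ g (m + 1) = g m) →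
        ∃ g' : P ⟶ L, ∀ m, ι m ≫ g' = g m := by
  obtain ⟨P, q, hq⟩ := exists_isQuotientBy (seqMap j)
  have hι : ∀ m, j m ≫ seqInc F (m + 1) ≫ q = seqInc F m ≫ q := fun m =>
    Hom.ext' fun i x => by
      have h1 := ((hq i).2 ((seqMap j).f i ((seqInc F m).f i x))).2 ⟨_, rfl⟩
      rw [seqMap_inc, map_sub] at h1
      exact (sub_eq_zero.1 h1).symm
  -- Representatives can be moved to later stages; this is needed to add two of them.
  have hι' : ∀ m k i (x : (F m).X i), ∃ y : (F (m + k)).X i,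
      q.f i ((seqInc F (m + k)).f i y) = q.f i ((seqInc F m).f i x) := by
    intro m k i x
    induction k with
    | zero => exact ⟨x, rfl⟩
    | succ k ih =>
      obtain ⟨y, hy⟩ := ih
      exact ⟨(j (m + k)).f i y, (congrArg (fun φ => Hom.f φ i y) (hι (m + k))).trans hy⟩
  refine ⟨P, fun m => seqInc F m ≫ q, hι, ?_, ?_, ?_, ?_⟩
  · intro m i
    refine (injective_iff_map_eq_zero _).2 fun x hx => ?_
    obtain ⟨z, hz⟩ := ((hq i).2 _).1 hx
    exact eq_zero_of_seqMap_eq (fun m i => (hj m).injective i) hz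
  · intro i x
    obtain ⟨y, rfl⟩ := (hq i).1 x
    induction y using seqSum_induction with
    | h0 => exact ⟨0, 0, by simp⟩
    | ha y z hy hz =>
      obtain ⟨m, y', hy⟩ := hy
      obtain ⟨m', z', hz⟩ := hz
      obtain ⟨y'', hy''⟩ := hι' m m' i y'
      obtain ⟨z'', hz''⟩ : ∃ z'' : (F (m + m')).X i,
          q.f i ((seqInc F (m + m')).f i z'') = q.f i ((seqInc F m').f i z') := by
        rw [Nat.add_comm]
        exact hι' m' m i z'
      refine ⟨m + m', y'' + z'', ?_⟩
      rw [comp_f] at hy hz ⊢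
      rw [map_add, map_add, map_add, hy'', hz'', hy, hz]
    | hi m y => exact ⟨m, y, rfl⟩
  · intro T hT hF
    -- The colimit is the quotient of a sum of stages by a graded split copy of the same sum, both
    -- terms lying in T.
    have := Hot.mem_directSum hT (fun m : ULift.{u} ℕ => F m.down) fun m => hF m.down
    exact Hot.mem_quotient hT (seqMap_isGradedSplitMono hj) hq this this
  · intro L g hg
    have hd : ∀ m i (x : (F m).X i),
        (descHom (M := fun m : ULift.{u} ℕ => F m.down) fun m => g m.down).f i
          ((seqInc F m).f i x) = (g m).f i x := fun m i x => descHom_inc _ _ _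
    obtain ⟨g', hg'⟩ := hq.exists_desc (descHom fun m => g m.down) (by
      intro i x
      induction x using seqSum_induction with
      | h0 => simp
      | ha y z hy hz => rw [map_add, map_add, hy, hz, add_zero]
      | hi m y => rw [seqMap_inc, map_sub, hd, hd, ← hg m, comp_f, sub_self])
    refine ⟨g', fun m => ?_⟩
    rw [Category.assoc, hg']
    exact Hom.ext' (hd m)

end Colimit

/-! ### Semifree modules and cellular approximation -/

section Semifree

variable {σ : Type} {X : σ → CDGModule.{u, v} B}

/-- The image of a closed morphism. -/
def imageSub {M N : CDGModule.{u, v} B} (f : M ⟶ N) : Sub N where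
  S i := (f.f i).range
  smul_mem h a := by
    rintro _ ⟨x, rfl⟩
    exact ⟨M.smul h a x, f.map_smul h a x⟩
  d_mem h := by
    rintro _ ⟨x, rfl⟩
    exact ⟨M.d h x, f.map_d h x⟩

/-- The filtration consists of the images of the stages. Each stage is isomorphic to its image by
injectivity, and the splittings and quotients are transported along these isomorphisms `e`. -/
lemma isSemifree_of_sequence {F : ℕ → CDGModule.{u, v} B} {j : ∀ m, F m ⟶ F (m + 1)}
    {P : CDGModule.{u, v} B} {ι : ∀ m, F m ⟶ P} (h0 : ∀ i (x : (F 0).X i), x = 0)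
    (hι : ∀ m, j m ≫ ι (m + 1) = ι m) (hinj : ∀ m i, Function.Injective ((ι m).f i))
    (hsurj : ∀ i (x : P.X i), ∃ m y, (ι m).f i y = x) (hj : ∀ m, IsGradedSplitMono (j m))
    (hq : ∀ m, ∃ (κ : Type u) (s : κ → σ) (p : κ → ℤ)
      (q : F (m + 1) ⟶ directSum fun t => (X (s t)).shift (p t)), IsQuotientBy (j m) q) :
    IsSemifree X P := by
  have hιx : ∀ m i (x : (F m).X i), (ι (m + 1)).f i ((j m).f i x) = (ι m).f i x := fun m i x => by
    rw [← hι m, comp_f]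
  let e : ∀ m i, (F m).X i ≃+ (imageSub (ι m)).S i := fun m i =>
    AddMonoidHom.ofInjective (hinj m i)
  have he : ∀ m i (x : (F m).X i), (e m i x).1 = (ι m).f i x := fun _ _ _ => rfl
  have hes : ∀ m i (x : (F m).X i) (y : (imageSub (ι m)).S i), (ι m).f i x = y.1 →
      (e m i).symm y = x := fun m i x y h =>
    (AddEquiv.symm_apply_eq _).2 (Subtype.ext h.symm)
  have hes' : ∀ m i (y : (imageSub (ι m)).S i), (ι m).f i ((e m i).symm y) = y.1 := fun m i y => by
    rw [← he, AddEquiv.apply_symm_apply]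
  have hsmul : ∀ m {i l p : ℤ} (h : i + l = p) (a : B.gr i)
      (y : (imageSub (ι (m + 1))).toModule.X l),
      (e (m + 1) p).symm ((imageSub (ι (m + 1))).toModule.smul h a y) =
        (F (m + 1)).smul h a ((e (m + 1) l).symm y) := fun m i l p h a y =>
    hes _ _ _ _ ((Hom.map_smul _ _ _ _).trans (congrArg (P.smul h a) (hes' (m + 1) l y)))
  have hd : ∀ m {i l : ℤ} (h : i + 1 = l) (y : (imageSub (ι (m + 1))).toModule.X i),
      (e (m + 1) l).symm ((imageSub (ι (m + 1))).toModule.d h y) =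
        (F (m + 1)).d h ((e (m + 1) i).symm y) := fun m i l h y =>
    hes _ _ _ _ ((Hom.map_d _ _ _).trans (congrArg (P.d h) (hes' (m + 1) i y)))
  refine ⟨fun m => imageSub (ι m), fun m i => ?_, fun i => ?_, fun i x => ?_, fun m => ⟨?_, ?_⟩⟩
  · rintro _ ⟨x, rfl⟩
    exact ⟨(j m).f i x, hιx m i x⟩
  · refine (AddSubgroup.eq_bot_iff_forall _).2 ?_
    rintro _ ⟨x, rfl⟩
    rw [h0 i x, map_zero]
  · obtain ⟨m, y, rfl⟩ := hsurj i x
    exact ⟨m, y, rfl⟩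
  · obtain ⟨r, hr, hrj⟩ := hj m
    refine ⟨fun i => (e m i).toAddMonoidHom.comp ((r i).comp (e (m + 1) i).symm.toAddMonoidHom),
      fun {i l p} h a y => ?_, fun i x => ?_⟩
    · refine Subtype.ext ((congrArg (fun z => (ι m).f p (r p z)) (hsmul m h a y)).trans ?_)
      rw [hr, Hom.map_smul]
      rfl
    · obtain ⟨_, x, rfl⟩ := x
      exact Subtype.ext ((congrArg (fun z => (ι m).f i (r i z))
        (hes (m + 1) i ((j m).f i x) ⟨(ι m).f i x, (j m).f i x, hιx m i x⟩ (hιx m i x))).trans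
        (congrArg ((ι m).f i) (hrj i x)))
  · obtain ⟨κ, s, p, q, hq⟩ := hq m
    refine ⟨κ, s, p, ⟨fun i => (q.f i).comp (e (m + 1) i).symm.toAddMonoidHom,
      fun {i l p} h a y => ?_, fun {i l} h y => ?_⟩, fun i => ⟨?_, ?_⟩⟩
    · exact (congrArg (q.f p) (hsmul m h a y)).trans (Hom.map_smul _ _ _ _)
    · exact (congrArg (q.f l) (hd m h y)).trans (Hom.map_d _ _ _)
    · exact ((hq i).1).comp (e (m + 1) i).symm.surjective
    · intro y
      refine ((hq i).2 _).trans ⟨?_, ?_⟩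
      · rintro ⟨x, hx⟩
        refine ⟨e m i x, Subtype.ext ?_⟩
        change (ι m).f i x = y.1
        rw [← hιx, hx]
        exact hes' (m + 1) i y
      · rintro ⟨x, rfl⟩
        refine ⟨(e m i).symm x, ((AddEquiv.symm_apply_eq _).2 (Subtype.ext ?_)).symm⟩
        exact ((hιx m i _).trans (hes' m i x)).symm

/-- Every cdg module `M` is approximated by a semifree, cellular module `P`, which is the union of
a sequence of submodules such that every cell of a submodule over `M` is contracted in the next. -/
lemma exists_cellular_approximation (X : σ → CDGModule.{u, v} B) (M : CDGModule.{u, v} B) :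
    ∃ (P : CDGModule.{u, v} B) (f : P ⟶ M) (F : ℕ → CDGModule.{u, v} B)
      (j : ∀ m, F m ⟶ F (m + 1)) (ι : ∀ m, F m ⟶ P),
      IsSemifree X P ∧ Hot.IsCell X (Hot.of P) ∧ (∀ m, j m ≫ ι (m + 1) = ι m) ∧
      (∀ m i, Function.Injective ((ι m).f i)) ∧ (∀ i (x : P.X i), ∃ m y, (ι m).f i y = x) ∧
      ∀ m (c : Cell X (ι m ≫ f)), ∃ k : NullHomotopy (c.φ ≫ j m),
        ∀ {i l : ℤ} (h : i + -1 = l) x,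
          f.f l ((ι (m + 1)).f l (k.s.f h x)) = c.h.s.f h x := by
  have step : ∀ Ff : Σ N : CDGModule.{u, v} B, N ⟶ M, ∃ (Ff' : Σ N : CDGModule.{u, v} B, N ⟶ M)
    (j : Ff.1 ⟶ Ff'.1), j ≫ Ff'.2 = Ff.2 ∧ IsGradedSplitMono j ∧
    (∃ (ι : Type u) (s : ι → σ) (p : ι → ℤ)
      (q : Ff'.1 ⟶ directSum fun t => (X (s t)).shift (p t)), IsQuotientBy j q) ∧
    (∀ T : ObjectProperty (Hot B), Hot.IsLocalizing T → (∀ s, T (Hot.of (X s))) →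
      T (Hot.of Ff.1) → T (Hot.of Ff'.1)) ∧
    ∀ c : Cell X Ff.2, ∃ k : NullHomotopy (c.φ ≫ j),
      ∀ {i l : ℤ} (h : i + -1 = l) x, Ff'.2.f l (k.s.f h x) = c.h.s.f h x := by
    rintro ⟨N, f⟩
    obtain ⟨N', f', j, h⟩ := exists_attach X f
    exact ⟨⟨N', f'⟩, j, h⟩
  choose next j' h1 h2 h3 h4 h5 using step
  -- The empty direct sum serves as the zero module F 0, and as an empty coproduct it lies in every
  -- localizing subcategory.
  let Z : CDGModule.{u, v} B := directSum (ι := PEmpty) nofun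
  have hZ : ∀ i (x : Z.X i), x = 0 := fun i x => DFinsupp.ext nofun
  let A : ℕ → Σ N : CDGModule.{u, v} B, N ⟶ M := fun m =>
    Nat.rec ⟨Z, zeroHom Z M⟩ (fun _ => next) m
  let F : ℕ → CDGModule.{u, v} B := fun m => (A m).1
  let j : ∀ m, F m ⟶ F (m + 1) := fun m => j' (A m)
  obtain ⟨P, ι, hι, hinj, hsurj, hT, hd⟩ := exists_colimit (F := F) (j := j) fun m => h2 (A m)
  obtain ⟨f, hf⟩ := hd M (fun m => (A m).2) fun m => h1 (A m)
  refine ⟨P, f, F, j, ι, isSemifree_of_sequence hZ hι hinj hsurj (fun m => h2 (A m))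
    (fun m => h3 (A m)), ?_, hι, hinj, hsurj, ?_⟩
  · intro T hT' hX
    refine hT T hT' fun m => ?_
    induction m with
    | zero => exact Hot.mem_directSum hT' _ nofun
    | succ m ih => exact h4 (A m) T hT' hX ih
  · intro m
    rw [hf]
    intro c
    obtain ⟨k, hk⟩ := h5 (A m) c
    refine ⟨k, fun {i l} h x => ?_⟩
    rw [← comp_f, hf]
    exact hk h x

end Semifree

end CDGModule

/-! ### Acyclicity in terms of torsion elements -/

namespace CDGDeformation

open CDGModule

variable {k : Type v} [CommRing k] {A : DGAlgebra.{u, v} k} {n : ℕ} {D : CDGDeformation A n}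

local notation "τ" => TruncPoly.t k n

lemma t_pow_eq_zero (k : Type v) [CommRing k] (n : ℕ) : TruncPoly.t k n ^ (n + 1) = 0 := by
  have := AdjoinRoot.eval₂_root (Polynomial.X ^ (n + 1) : Polynomial k)
  simpa [TruncPoly.t] using this

lemma pow_succ_smul {S Y : Type*} [Monoid S] [MulAction S Y] (r : S) (m : ℕ) (y : Y) :
    r ^ (m + 1) • y = r ^ m • r • y := by
  rw [pow_succ, SemigroupAction.mul_smul]

lemma pow_succ_smul' {S Y : Type*} [Monoid S] [MulAction S Y] (r : S) (m : ℕ) (y : Y) :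
    r ^ (m + 1) • y = r • r ^ m • y := by
  rw [pow_succ', SemigroupAction.mul_smul]

section CurvAct

variable (M : CDGModule.{u, v} D.toCDGAlgebra)

/-- The action of the element `c/t`. -/
noncomputable def curvAct {i j : ℤ} (h : 2 + i = j) : M.X i →+ M.X j := M.smul h D.curvDivT

lemma curvAct_base {i j : ℤ} (h : 2 + i = j) (r : TruncPoly k n) (x : M.X i) :
    curvAct M h (r • x) = r • curvAct M h x := M.smul_base h _ r x

lemma d_d_eq {i j l : ℤ} (h : i + 1 = j) (h' : j + 1 = l) (h'' : 2 + i = l) (x : M.X i) :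
    M.d h' (M.d h x) = τ • curvAct M h'' x := by
  rw [M.d_d, curvAct, ← base_smul]
  exact congrArg (fun a => M.smul h'' a x) (Subtype.ext D.t_smul_curvDivT.symm)

/-- The Leibniz error term is d(c/t) x. Since d(c/t) is divisible by t^n, hence by t^m, it kills x.
-/
lemma d_curvAct {m : ℕ} (hm : m ≤ n) {i i' j j' : ℤ} (h : 2 + i = j) (hi : i + 1 = i')
    (hj : j + 1 = j') {x : M.X i} (hx : τ ^ m • x = 0) :
    M.d hj (curvAct M h x) = curvAct M (show 2 + i' = j' by omega) (M.d hi x) := by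
  obtain ⟨z, hz⟩ := D.exists_pow_smul_eq_d_curvDivT hm
  have h1 : CDGAlgebra.dH (show (2 : ℤ) + 1 = 3 by omega) D.curvDivT = τ ^ m • z :=
    Subtype.ext hz.symm
  rw [curvAct, M.leibniz h (show (2 : ℤ) + 1 = 3 by omega) hi hj, h1, base_smul, ← smul_base, hx,
    map_zero, zero_add, Int.negOnePow_even 2 ⟨1, rfl⟩, _root_.one_smul]
  rfl

/-- Elements of t^m M are written t^m z, which removes the subgroups from the definition and leaves
equations in M. -/
lemma isAcyclic_iff : D.IsAcyclic M ↔ ∀ m ≤ n, ∀ {i j l : ℤ} (h : i + 1 = j) (h' : j + 1 = l)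
    (z : M.X j) (w : M.X l), τ ^ m • M.d h' z = τ ^ (m + 1) • w →
      ∃ (y : M.X i) (x : M.X j), τ ^ m • z = τ ^ m • M.d h y + τ ^ (m + 1) • x := by
  constructor
  · intro hM m hm i j l h h' z w hw
    obtain ⟨_, ⟨y, rfl⟩, x, hx⟩ := hM m hm h h' (τ ^ m • z) ⟨z, rfl⟩
      ⟨w, hw.symm.trans (d_base _ _ _ _).symm⟩
    exact ⟨y, x, eq_add_of_sub_eq' ((congrArg _ (d_base _ _ _ _).symm).trans hx.symm)⟩
  · rintro hM m hm i j l h h' _ ⟨z, rfl⟩ ⟨w, hw⟩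
    obtain ⟨y, x, hx⟩ := hM m hm h h' z w ((d_base _ _ _ _).symm.trans hw.symm)
    exact ⟨_, ⟨y, rfl⟩, x, (eq_sub_of_add_eq' hx.symm).trans
      (congrArg _ (d_base _ _ _ _).symm)⟩

end CurvAct

/-- Elements `x`, `y` with `t^{m+1} x = 0`, `t^m y = 0`, `d y = t x` and `d x = (c/t) y` correspond
to the closed maps from `Γ_m`. All of them are coboundaries. -/
def PairExact (M : CDGModule.{u, v} D.toCDGAlgebra) : Prop :=
  ∀ m ≤ n, ∀ {e b a l : ℤ} (hb : e + 1 = b) (ha : b + 1 = a) (hl : a + 1 = l) (x : M.X a)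
    (y : M.X b), τ ^ (m + 1) • x = 0 → τ ^ m • y = 0 → M.d ha y = τ • x →
    M.d hl x = curvAct M (show 2 + b = l by omega) y →
    ∃ (x' : M.X b) (y' : M.X e), τ ^ (m + 1) • x' = 0 ∧ τ ^ m • y' = 0 ∧
      x = M.d ha x' + curvAct M (show 2 + e = a by omega) y' ∧ y = M.d hb y' + τ • x'

/-- The complexes of elements annihilated by `t^m`, modulo multiples of `t`, are exact. -/
def TorsionExact (M : CDGModule.{u, v} D.toCDGAlgebra) (m : ℕ) : Prop :=
  ∀ {e b a : ℤ} (hb : e + 1 = b) (ha : b + 1 = a) (y : M.X b) (x : M.X a), τ ^ m • y = 0 →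
    M.d ha y = τ • x → ∃ (y' : M.X e) (x' : M.X b), τ ^ m • y' = 0 ∧ y = M.d hb y' + τ • x'

/-- The complex of elements annihilated by `t` is exact. -/
def SocleExact (M : CDGModule.{u, v} D.toCDGAlgebra) : Prop :=
  ∀ {e b a : ℤ} (hb : e + 1 = b) (ha : b + 1 = a) (x : M.X b), τ • x = 0 → M.d ha x = 0 →
    ∃ x' : M.X e, τ • x' = 0 ∧ x = M.d hb x'

variable {M : CDGModule.{u, v} D.toCDGAlgebra}

/-- Acyclicity of M/tM gives y = dv + tu, but v need not be killed by t^m. Since t^m y = 0, t^m v is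
a cocycle in t^m M/t^{m+1}M, so t^m v = t^m (dw + ts) for some w and s. Subtracting dw + ts from v
makes it t^m-torsion, and d²w = t(c/t)w is absorbed into the multiple of t. -/
lemma IsAcyclic.torsionExact (hM : D.IsAcyclic M) {m : ℕ} (hm : m ≤ n + 1) :
    TorsionExact M m := by
  intro e b a hb ha y x hy hx
  rw [isAcyclic_iff] at hM
  obtain ⟨v, u, hu⟩ := hM 0 (Nat.zero_le n) hb ha y x (by simpa using hx)
  replace hu : y = M.d hb v + τ • u := by simpa using hu
  rcases hm.lt_or_eq with hm | rfl
  · obtain ⟨w, s, hs⟩ := hM m (by omega) (show e - 1 + 1 = e by omega) hb v (-u)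
      (by rw [smul_neg, pow_succ_smul, eq_neg_iff_add_eq_zero, ← smul_add, ← hu, hy])
    refine ⟨v - M.d (show e - 1 + 1 = e by omega) w - τ • s,
      u + curvAct M (by omega) w + M.d hb s, ?_, ?_⟩
    · rw [smul_sub, smul_sub, hs, pow_succ_smul]; abel
    · rw [map_sub, map_sub, d_base, d_d_eq _ _ _ (show 2 + (e - 1) = b by omega), smul_add,
        smul_add, hu]
      abel
  -- For m = n + 1 the torsion condition is empty, as t^{n+1} = 0.
  · refine ⟨v, u, ?_, ?_⟩
    · rw [t_pow_eq_zero, zero_smul]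
    · exact hu

/-- The element x is pushed step by step into t^j M, modulo differentials of elements killed by t,
until t^{n+1} = 0 ends the process. -/
lemma socleExact_of_torsionExact (hM : ∀ m ≤ n + 1, TorsionExact M m) : SocleExact M := by
  intro e b a hb ha x hx hdx
  have key : ∀ j ≤ n + 1, ∃ (x' : M.X e) (z : M.X b), τ • x' = 0 ∧ x = M.d hb x' + τ ^ j • z := by
    intro j
    induction j with
    | zero => exact fun _ => ⟨0, x, smul_zero _, by simp⟩
    | succ j ih =>
      intro hj
      obtain ⟨x', z, hx', hz⟩ := ih (by omega)
      have h1 : τ ^ (j + 1) • z = 0 := by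
        have := congrArg (τ • ·) hz
        simpa only [hx, smul_add, ← d_base, hx', map_zero, zero_add, ← pow_succ_smul',
          eq_comm] using this
      have h2 : τ ^ j • M.d ha z = 0 := by
        have := congrArg (M.d ha) hz
        rwa [hdx, map_add, d_d_eq _ _ _ (show 2 + e = a by omega), ← curvAct_base, hx', map_zero,
          zero_add, d_base, eq_comm] at this
      -- Here dz is killed by t^j and d(dz) = t(c/t)z, so dz = dy' + tw with t^j y' = 0. Replacing z
      -- by z - y' leaves t^j z unchanged and makes the differential divisible by t, so torsion
      -- exactness applies again at level j + 1.
      obtain ⟨y', w, hy', hw⟩ := hM j (by omega) ha rfl (M.d ha z) (curvAct M (by omega) z) h2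
        (d_d_eq _ _ _ _ _)
      obtain ⟨y, z', hy, hz'⟩ := hM (j + 1) hj hb ha (z - y') w
        (by rw [smul_sub, h1, pow_succ_smul', hy', smul_zero, sub_zero])
        (by rw [map_sub, hw]; abel)
      refine ⟨x' + τ ^ j • y, z', ?_, ?_⟩
      · rw [smul_add, hx', ← pow_succ_smul', hy, zero_add]
      · have h3 := congrArg (τ ^ j • ·) hz'
        simp only [smul_sub, hy', sub_zero, smul_add, ← pow_succ_smul, ← d_base] at h3
        rw [hz, h3, map_add]
        abel
  obtain ⟨x', z, hx', hz⟩ := key (n + 1) le_rfl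
  rw [t_pow_eq_zero, zero_smul, add_zero] at hz
  exact ⟨x', hx', hz⟩

/-- Torsion exactness solves the equation for y. The remaining error x - dx' - (c/t)y' in the other
equation is then killed by t and by d, so socle exactness writes it as dz with tz = 0; adding z to
x' does not disturb the first equation. -/
lemma IsAcyclic.pairExact (hM : D.IsAcyclic M) : PairExact M := by
  intro m hm e b a l hb ha hl x y hx hy hdy hdx
  obtain ⟨y', x', hy', h⟩ := hM.torsionExact (show m ≤ n + 1 by omega) hb ha y x hy hdy
  obtain ⟨z, hz, hxz⟩ := socleExact_of_torsionExact (fun _ => hM.torsionExact) ha hl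
    (x - M.d ha x' - curvAct M (show 2 + e = a by omega) y')
    (by rw [smul_sub, smul_sub, ← hdy, ← d_d_eq _ hb ha, ← d_base, h, map_add]; abel)
    (by rw [map_sub, map_sub, hdx, d_d_eq _ _ _ (show 2 + b = l by omega),
          d_curvAct _ hm _ hb _ hy', h, map_add, curvAct_base]; abel)
  refine ⟨x' + z, y', ?_, hy', ?_, ?_⟩
  · have h1 := congrArg (τ ^ m • ·) h
    simp only [hy, smul_add, ← d_base, hy', map_zero, zero_add, ← pow_succ_smul] at h1
    rw [smul_add, ← h1, pow_succ_smul, hz, smul_zero, add_zero]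
  · rw [map_add, ← hxz]; abel
  · rw [smul_add, hz, add_zero, h]

namespace PairExact

/-- This is the case m = 0, where t^0 y = 0 forces y = 0. -/
lemma socleExact (hM : PairExact M) : SocleExact M := by
  intro e b a hb ha x hx hdx
  obtain ⟨x', y', hx', hy', h, -⟩ := hM 0 (Nat.zero_le n) (show e - 1 + 1 = e by omega) hb ha x 0
    (by simpa using hx) (smul_zero _) (by rw [map_zero, hx]) (by rw [map_zero, hdx])
  obtain rfl : y' = 0 := by simpa using hy'
  exact ⟨x', by simpa using hx', by simpa using h⟩

/-- The pair (x, y) may violate dx = (c/t)y, but the defect is killed by t and by d. Hence it equals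
dz with tz = 0, and (x - z, y) is a closed pair. -/
lemma torsionExact (hM : PairExact M) {m : ℕ} (hm : m ≤ n) : TorsionExact M m := by
  intro e b a hb ha y x hy hdy
  have h0 : τ ^ (m + 1) • x = 0 := by
    rw [pow_succ_smul, ← hdy, ← d_base, hy, map_zero]
  obtain ⟨z, hz, hxz⟩ := hM.socleExact (show a + 1 = a + 1 from rfl) rfl
    (M.d rfl x - curvAct M (show 2 + b = a + 1 by omega) y)
    (by rw [smul_sub, ← d_base, ← hdy, d_d_eq _ _ _ (show 2 + b = a + 1 by omega), sub_self])
    (by rw [map_sub, d_d_eq _ _ _ (show 2 + a = a + 1 + 1 by omega), d_curvAct _ hm _ ha _ hy, hdy,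
          curvAct_base, sub_self])
  obtain ⟨x', y', -, hy', -, h⟩ := hM m hm hb ha rfl (x - z) y
    (by rw [smul_sub, h0, pow_succ_smul, hz, smul_zero, sub_zero]) hy
    (by rw [smul_sub, hz, hdy, sub_zero]) (by rw [map_sub, ← hxz]; abel)
  exact ⟨y', x', hy', h⟩

/-- This is acyclicity of the top graded piece t^n M. Socle exactness gives t^n z = dw with tw = 0,
and the induction trades this w for one with t^n z = t^j dw, raising j up to n. -/
lemma exists_top (hM : PairExact M) {e b a : ℤ} (hb : e + 1 = b) (ha : b + 1 = a) (z : M.X b)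
    (hz : τ ^ n • M.d ha z = 0) : ∃ w : M.X e, τ ^ n • z = τ ^ n • M.d hb w := by
  have key : ∀ j ≤ n, ∃ w : M.X e, τ ^ (j + 1) • w = 0 ∧ τ ^ n • z = τ ^ j • M.d hb w := by
    intro j
    induction j with
    | zero =>
      intro _
      obtain ⟨w, hw, h⟩ := hM.socleExact hb ha (τ ^ n • z)
        (by rw [← pow_succ_smul', t_pow_eq_zero, zero_smul]) (by rw [d_base, hz])
      exact ⟨w, by simpa using hw, by simpa using h⟩
    | succ j ih =>
      intro hj
      obtain ⟨w, hw, h⟩ := ih (by omega)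
      obtain ⟨r, hr⟩ : ∃ r, n = j + (r + 1) := ⟨n - (j + 1), by omega⟩
      -- With n = j + r + 1, the element t^{r+1}z - dw is killed by t^j. Writing it as dy' + tx'
      -- makes d(w + y') divisible by t, so w + y' = dy + tx at level j + 1, and x is the next w:
      -- t^j y' and t^{j+1} y vanish.
      obtain ⟨y', x', hy', h1⟩ := hM.torsionExact (show j ≤ n by omega) hb ha
        (τ ^ (r + 1) • z - M.d hb w) (τ ^ r • M.d ha z - curvAct M (by omega) w)
        (by rw [smul_sub, ← h, smul_smul, ← pow_add, ← hr, sub_self])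
        (by rw [map_sub, d_base, d_d_eq, smul_sub, ← pow_succ_smul'])
      obtain ⟨y, x, hy, h2⟩ := hM.torsionExact hj (show e - 1 + 1 = e by omega) hb (w + y')
        (τ ^ r • z - x')
        (by rw [smul_add, hw, pow_succ_smul', hy', smul_zero, zero_add])
        (by rw [map_add, smul_sub, ← pow_succ_smul', eq_sub_iff_add_eq, add_assoc, ← h1]
            abel)
      refine ⟨x, ?_, ?_⟩
      · have h3 := congrArg (τ ^ (j + 1) • ·) h2
        simp only [smul_add, hw, ← d_base, hy, map_zero, zero_add, ← pow_succ_smul] at h3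
        rw [← h3, pow_succ_smul', hy', smul_zero]
      · have h3 := congrArg (fun q => τ ^ j • M.d hb q) h2
        simp only [map_add, d_d_eq _ _ hb (show 2 + (e - 1) = b by omega), d_base, smul_add,
          ← pow_succ_smul, ← curvAct_base, hy, map_zero, zero_add] at h3
        rw [h, ← h3, ← d_base _ _ _ y', hy', map_zero, add_zero]
  obtain ⟨w, -, hw⟩ := key n le_rfl
  exact ⟨w, hw⟩

/-- This is acyclicity of M/tM. As t^n dz = t^{n+1}w = 0, subtracting a boundary makes z killed by
t^n, and torsion exactness at level n applies. -/
lemma exists_of_d_eq (hM : PairExact M) {e b a : ℤ} (hb : e + 1 = b) (ha : b + 1 = a) (z : M.X b)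
    (w : M.X a) (hz : M.d ha z = τ • w) : ∃ (y : M.X e) (x : M.X b), z = M.d hb y + τ • x := by
  obtain ⟨v, hv⟩ := hM.exists_top hb ha z
    (by rw [hz, ← pow_succ_smul, t_pow_eq_zero, zero_smul])
  obtain ⟨y, x, -, h⟩ := hM.torsionExact le_rfl hb ha (z - M.d hb v)
    (w - curvAct M (by omega) v) (by rw [smul_sub, hv, sub_self])
    (by rw [map_sub, hz, d_d_eq, smul_sub])
  exact ⟨v + y, x, by rw [map_add, add_assoc, ← h]; abel⟩

/-- The hypothesis says that dz - tw is killed by t^m. Torsion exactness provides y' with t^m y' = 0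
and d(z - y') divisible by t; the case of M/tM then applies to z - y', and multiplication by t^m
removes y'. -/
lemma isAcyclic (hM : PairExact M) : D.IsAcyclic M := by
  rw [isAcyclic_iff]
  intro m hm i j l h h' z w hw
  obtain ⟨y', x', hy', h1⟩ := hM.torsionExact hm h' rfl (M.d h' z - τ • w)
    (curvAct M (show 2 + j = l + 1 by omega) z - M.d rfl w)
    (by rw [smul_sub, ← pow_succ_smul, hw, sub_self])
    (by rw [map_sub, d_base, d_d_eq, smul_sub])
  obtain ⟨y, x, h2⟩ := hM.exists_of_d_eq h h' (z - y') (w + x')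
    (by rw [map_sub, smul_add, sub_eq_iff_eq_add, add_assoc, add_comm (τ • x'), ← h1]; abel)
  refine ⟨y, x, ?_⟩
  have h3 := congrArg (τ ^ m • ·) h2
  simp only [smul_sub, hy', sub_zero, smul_add, ← pow_succ_smul] at h3
  exact h3

end PairExact

lemma isAcyclic_iff_pairExact : D.IsAcyclic M ↔ PairExact M :=
  ⟨IsAcyclic.pairExact, PairExact.isAcyclic⟩

lemma IsAcyclic.shift (hM : D.IsAcyclic M) (p : ℤ) : D.IsAcyclic (M.shift p) := by
  rw [isAcyclic_iff] at hM ⊢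
  intro m hm i j l h h' z w hw
  have h1 := congrArg (M.unsh p rfl) hw
  rw [unsh_base, unsh_d _ rfl, unsh_base] at h1
  obtain ⟨y, x, hx⟩ := hM m hm (show i + p + 1 = j + p by omega)
    (show j + p + 1 = l + p by omega) (M.unsh p rfl z) (p.negOnePow • M.unsh p rfl w)
    (by rw [Units.smul_def, smul_comm _ (p.negOnePow : ℤ), ← h1, Units.smul_def,
          smul_comm (τ ^ m), smul_smul, ← Units.val_mul, Int.units_mul_self,
          Units.val_one, _root_.one_smul])
  refine ⟨p.negOnePow • M.sh p rfl y, M.sh p rfl x, ?_⟩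
  have h2 : (M.shift p).d h (p.negOnePow • M.sh p rfl y) = M.sh p rfl (M.d (by omega) y) := by
    rw [units_smul_map, sh_d _ rfl rfl, smul_smul, Int.units_mul_self, _root_.one_smul]
  have h3 := congrArg (M.sh p rfl) hx
  rw [map_add, sh_base, sh_base, sh_base, sh_unsh] at h3
  rw [h2, h3]

end CDGDeformation

/-! ### Cells from homogeneous maps -/

namespace CDGModule

variable {R : Type v} [CommRing R] {B : CDGAlgebra.{u, v} R} {σ : Type}

lemma GMap.IsDiff.map_d {M N L : CDGModule.{u, v} B} {p q : ℤ} {φ : GMap M N q} {ψ : GMap M N p}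
    (h : φ.IsDiff ψ) (g : N ⟶ L) : (φ.postcomp g).IsDiff (ψ.postcomp g) := by
  intro i i' j j' hj hj' hj'' hi x
  rw [GMap.postcomp_f, h hj hj' hj'' hi, map_sub, g.map_d, units_smul_map]
  rfl

/-- A cell, from a closed homogeneous map and a homogeneous map bounding its image. -/
def Cell.ofGMap {X : σ → CDGModule.{u, v} B} {M N : CDGModule.{u, v} B} {f : N ⟶ M} {s : σ}
    {p q : ℤ} (h : p + 1 = q) (φ : GMap (X s) N q) (ψ : GMap (X s) M p) (hφ : φ.Closed)
    (hψ : (φ.postcomp f).IsDiff ψ) : Cell X f where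
  s := s
  p := -q
  φ := GMap.toHom (φ.toShiftDom (add_neg_cancel q)) (hφ.toShiftDom _)
  h :=
    { s := ψ.toShiftDom (show p + -q = -1 by omega)
      eq := fun {i r t} hr ht x => by
        have h1 := hψ (show i + -q + q = i by omega) (show i + -q + p = r by omega) (by omega)
          (show i + -q + 1 = t + -q by omega) ((X s).unsh (-q) rfl x)
        rw [comp_f, GMap.toHom_f, GMap.toShiftDom_f φ _ _ rfl (by omega),
          GMap.toShiftDom_f ψ _ _ rfl (by omega), GMap.toShiftDom_f ψ _ _ rfl (by omega),
          unsh_d ht rfl rfl, units_smul_map, Int.negOnePow_neg, negOnePow_of_add_one h]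
        refine h1.trans ?_
        rw [Units.neg_smul, sub_eq_add_neg] }

end CDGModule

namespace CDGDeformation

open CDGModule

variable {k : Type v} [CommRing k] {A : DGAlgebra.{u, v} k} {n : ℕ} {D : CDGDeformation A n}

local notation "τ" => TruncPoly.t k n

/-! ### Generators and relations of Γ_i -/

section Generators

variable {i : Fin (n + 1)}

variable (i) in
/-- The element of `Γ_i` represented by `a` and `b`. -/
noncomputable def gam {j l : ℤ} (h : j + 1 = l) (a : D.gr j) (b : D.gr l) : (D.Gam i).X j :=
  (Submodule.Quotient.mk a, Submodule.Quotient.mk ⟨b.1, h ▸ b.2⟩)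

lemma exists_gam {j l : ℤ} (h : j + 1 = l) (z : (D.Gam i).X j) : ∃ a b, gam i h a b = z := by
  subst h
  obtain ⟨α, β⟩ := z
  obtain ⟨a, rfl⟩ := Submodule.Quotient.mk_surjective _ α
  obtain ⟨b, rfl⟩ := Submodule.Quotient.mk_surjective _ β
  exact ⟨a, b, rfl⟩

lemma gam_eq_zero {j l : ℤ} (h : j + 1 = l) {a : D.gr j} {b : D.gr l}
    (ha : ∃ c : D.gr j, τ ^ ((i : ℕ) + 1) • c = a) (hb : ∃ c : D.gr l, τ ^ (i : ℕ) • c = b) :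
    gam i h a b = 0 := by
  subst h
  exact Prod.ext ((Submodule.Quotient.mk_eq_zero _).2 ha) ((Submodule.Quotient.mk_eq_zero _).2 hb)

lemma gam_add {j l : ℤ} (h : j + 1 = l) (a a' : D.gr j) (b b' : D.gr l) :
    gam i h a b + gam i h a' b' = gam i h (a + a') (b + b') := rfl

lemma sgn_gam {j l : ℤ} (h : j + 1 = l) (ε : ℤˣ) (a : D.gr j) (b : D.gr l) :
    ε • gam i h a b = gam i h (ε • a) (ε • b) := by
  rcases Int.units_eq_one_or ε with rfl | rfl
  · simp only [_root_.one_smul]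
  · simp only [Units.neg_smul, _root_.one_smul]
    rfl

lemma gam_smul {p j l j' l' : ℤ} (h : j + 1 = l) (h' : j' + 1 = l') (hj : p + j = j') (c : D.gr p)
    {a : D.gr j} {b : D.gr l} {a' : D.gr j'} {b' : D.gr l'} (ha : a'.1 = c.1 * a.1)
    (hb : b'.1 = p.negOnePow • (c.1 * b.1)) :
    (D.Gam i).smul hj c (gam i h a b) = gam i h' a' b' := by
  subst h h'
  refine Prod.ext (congrArg Submodule.Quotient.mk (Subtype.ext ha.symm)) ?_
  refine (units_smul_map (Submodule.mkQ _).toAddMonoidHom p.negOnePow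
    (CDGAlgebra.mulH (show p + (j + 1) = j' + 1 by omega) c b)).symm.trans
    (congrArg Submodule.Quotient.mk (Subtype.ext (Eq.trans ?_ hb.symm)))
  rcases Int.units_eq_one_or p.negOnePow with e | e <;> simp [e, CDGAlgebra.mulH]

lemma d_gam {j l m : ℤ} (h : j + 1 = l) (h' : l + 1 = m) {a : D.gr j} {b : D.gr l}
    {a' : D.gr l} {b' : D.gr m} (ha : a'.1 = D.d a.1 + τ • b.1)
    (hb : b'.1 = -D.d b.1 + a.1 * D.curvDivT.1) :
    (D.Gam i).d h (gam i h a b) = gam i h' a' b' := by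
  subst h h'
  exact Prod.ext (congrArg Submodule.Quotient.mk (Subtype.ext ha.symm))
    (congrArg Submodule.Quotient.mk (Subtype.ext hb.symm))

lemma base_smul_gam {j l : ℤ} (h : j + 1 = l) (r : TruncPoly k n) (a : D.gr j) (b : D.gr l) :
    r • gam i h a b = gam i h (r • a) (r • b) :=
  gam_smul h h _ _ (by simp [CDGAlgebra.oneH]) (by simp [CDGAlgebra.oneH])

variable (D i)

/-- The generator of `Γ_i` of degree `0`. -/
noncomputable def gamU : (D.Gam i).X 0 := gam i (zero_add 1) D.oneH 0

/-- The generator of `Γ_i` of degree `-1`. -/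
noncomputable def gamV : (D.Gam i).X (-1) := gam i (neg_add_cancel 1) 0 D.oneH

variable {D i}

lemma d_gamU : (D.Gam i).d (zero_add 1) (gamU D i) =
    curvAct _ (show 2 + -1 = (1 : ℤ) by omega) (gamV D i) := by
  rw [gamU, d_gam _ (show (1 : ℤ) + 1 = 2 by omega) (a' := 0) (b' := D.curvDivT)
    (by simp [CDGAlgebra.oneH, CDGAlgebra.d_one]) (by simp [CDGAlgebra.oneH])]
  exact (gam_smul _ _ _ _ (by simp) (by simp [CDGAlgebra.oneH, Int.negOnePow_even 2 ⟨1, rfl⟩])).symm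

lemma d_gamV : (D.Gam i).d (neg_add_cancel 1) (gamV D i) = τ • gamU D i := by
  rw [gamU, base_smul_gam]
  exact d_gam _ _ (by simp) (by simp [CDGAlgebra.oneH, CDGAlgebra.d_one])

lemma pow_smul_gamU : τ ^ ((i : ℕ) + 1) • gamU D i = 0 := by
  rw [gamU, base_smul_gam, smul_zero]
  exact gam_eq_zero _ ⟨_, rfl⟩ ⟨0, smul_zero _⟩

lemma pow_smul_gamV : τ ^ (i : ℕ) • gamV D i = 0 := by
  rw [gamV, base_smul_gam, smul_zero]
  exact gam_eq_zero _ ⟨0, smul_zero _⟩ ⟨_, rfl⟩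

/-- The sign undoes the one with which b, of degree l, acts on the shifted summand A_{i-1}[1]. -/
lemma gam_eq_smul_add {j l : ℤ} (h : j + 1 = l) (a : D.gr j) (b : D.gr l) :
    gam i h a b = (D.Gam i).smul (add_zero j) a (gamU D i) + l.negOnePow •
      (D.Gam i).smul (show l + -1 = j by omega) b (gamV D i) := by
  rw [gamU, gamV, gam_smul _ h (add_zero j) a (a' := a) (b' := 0) (by simp [CDGAlgebra.oneH])
      (by simp),
    gam_smul _ h _ b (a' := 0) (b' := l.negOnePow • b) (by simp)
      (by simp [CDGAlgebra.oneH, Units.smul_def]), sgn_gam, gam_add, smul_zero, add_zero, zero_add,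
    smul_smul, Int.units_mul_self, _root_.one_smul]

lemma gMap_ext {N : CDGModule.{u, v} D.toCDGAlgebra} {p q : ℤ} {φ ψ : GMap (D.Gam i) N p}
    (hq : -1 + p = q) (hu : φ.f (zero_add p) (gamU D i) = ψ.f (zero_add p) (gamU D i))
    (hv : φ.f hq (gamV D i) = ψ.f hq (gamV D i)) {j l : ℤ} (h : j + p = l) (z : (D.Gam i).X j) :
    φ.f h z = ψ.f h z := by
  obtain ⟨a, b, rfl⟩ := exists_gam rfl z
  rw [gam_eq_smul_add, map_add, map_add, units_smul_map, units_smul_map,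
    φ.map_smul (add_zero j) (zero_add p) h, ψ.map_smul (add_zero j) (zero_add p) h,
    φ.map_smul _ hq h, ψ.map_smul _ hq h, hu, hv]

end Generators

/-! ### Maps out of Γ_i with prescribed values on generators -/

section PairMap

variable {N : CDGModule.{u, v} D.toCDGAlgebra}

/-- The action on an element annihilated by `t^m`. -/
noncomputable def truncAct {m : ℕ} {a : ℤ} (x : N.X a) (hx : τ ^ m • x = 0) {j l : ℤ}
    (h : j + a = l) : D.trunc m j →ₗ[TruncPoly k n] N.X l :=
  Submodule.liftQ _
    { toFun := fun α => N.smul h α x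
      map_add' := fun α β => by rw [map_add, AddMonoidHom.add_apply]
      map_smul' := fun r α => N.base_smul h α r x } (by
    rintro _ ⟨y, rfl⟩
    change N.smul h (τ ^ m • y) x = 0
    rw [base_smul, ← smul_base, hx, map_zero])

variable {i : Fin (n + 1)} {a b : ℤ}

/-- The additive maps underlying `pairMap`. -/
noncomputable def pairFun (hb : b + 1 = a) (x : N.X a) (y : N.X b)
    (hx : τ ^ ((i : ℕ) + 1) • x = 0) (hy : τ ^ (i : ℕ) • y = 0) {j l : ℤ} (h : j + a = l) :
    (D.Gam i).X j →+ N.X l :=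
  AddMonoidHom.coprod
    -- The first sign is the Koszul sign of a map of degree a. The second also contains the sign
    -- (-1)^{j+1} with which an element of degree j + 1 acts on A_{i-1}[1].
    ((a * j).negOnePow • (truncAct x hx h).toAddMonoidHom)
    (((a + 1) * (j + 1)).negOnePow •
      (truncAct y hy (show j + 1 + b = l by omega)).toAddMonoidHom)

lemma pairFun_gam (hb : b + 1 = a) (x : N.X a) (y : N.X b)
    (hx : τ ^ ((i : ℕ) + 1) • x = 0) (hy : τ ^ (i : ℕ) • y = 0) {j l j' : ℤ} (h : j + a = l)
    (hj : j + 1 = j') (α : D.gr j) (β : D.gr j') :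
    pairFun hb x y hx hy h (gam i hj α β) = (a * j).negOnePow • N.smul h α x +
      ((a + 1) * j').negOnePow • N.smul (show j' + b = l by omega) β y := by
  subst hj
  rfl

/-- The homogeneous map `Γ_i → N` of degree `a` with prescribed values on the generators. -/
noncomputable def pairMap (hb : b + 1 = a) (x : N.X a) (y : N.X b)
    (hx : τ ^ ((i : ℕ) + 1) • x = 0) (hy : τ ^ (i : ℕ) • y = 0) :
    GMap (D.Gam i) N a where
  f h := pairFun hb x y hx hy h
  map_smul {p j l j' l'} h hj hl c z := by
    subst h
    obtain ⟨α, β, rfl⟩ := exists_gam rfl z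
    rw [gam_smul rfl rfl rfl c (a' := CDGAlgebra.mulH rfl c α)
      (b' := p.negOnePow • CDGAlgebra.mulH (show p + (j + 1) = p + j + 1 by omega) c β) rfl (by
        rcases Int.units_eq_one_or p.negOnePow with e | e <;> simp [e, CDGAlgebra.mulH]),
      pairFun_gam, pairFun_gam, N.mul_smul rfl hj (by omega),
      units_smul_map (N.smul (show p + j + 1 + b = l' by omega)), AddMonoidHom.smul_apply,
      N.mul_smul _ (show j + 1 + b = j' by omega) (by omega), map_add, units_smul_map,
      units_smul_map, smul_add, smul_smul, smul_smul, smul_smul, ← Int.negOnePow_add,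
      ← Int.negOnePow_add, ← Int.negOnePow_add]
    congr 2
    · congr 1; ring
    · rw [show (a + 1) * (p + j + 1) + p = a * p + (a + 1) * (j + 1) + 2 * p by ring,
        Int.negOnePow_add _ (2 * p), Int.negOnePow_even (2 * p) (even_two_mul p), mul_one]

@[simp]
lemma pairMap_gamU (hb : b + 1 = a) (x : N.X a) (y : N.X b)
    (hx : τ ^ ((i : ℕ) + 1) • x = 0) (hy : τ ^ (i : ℕ) • y = 0) (h : 0 + a = a) :
    (pairMap hb x y hx hy).f h (gamU D i) = x := by
  refine (pairFun_gam hb x y hx hy h _ _ _).trans ?_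
  rw [map_zero, AddMonoidHom.zero_apply, smul_zero, add_zero, mul_zero, Int.negOnePow_zero,
    _root_.one_smul, N.one_smul]

@[simp]
lemma pairMap_gamV (hb : b + 1 = a) (x : N.X a) (y : N.X b)
    (hx : τ ^ ((i : ℕ) + 1) • x = 0) (hy : τ ^ (i : ℕ) • y = 0) (h : -1 + a = b) :
    (pairMap hb x y hx hy).f h (gamV D i) = y := by
  refine (pairFun_gam hb x y hx hy h _ _ _).trans ?_
  rw [map_zero, AddMonoidHom.zero_apply, smul_zero, zero_add, mul_zero, Int.negOnePow_zero,
    _root_.one_smul, N.one_smul]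

end PairMap

/-! ### Closed maps and boundaries on generators -/

section Diff

variable {N : CDGModule.{u, v} D.toCDGAlgebra} {i : Fin (n + 1)} {a b e : ℤ}

/-- Both φ and the differential of ψ are linear, so comparing them on the two generators suffices;
du = (c/t)v and dv = tu then turn the equation into one about pairs. -/
lemma isDiff_iff (hb : b + 1 = a) (he : e + 1 = b) {φ : GMap (D.Gam i) N a}
    {ψ : GMap (D.Gam i) N b} : φ.IsDiff ψ ↔
      φ.f (zero_add a) (gamU D i) = N.d hb (ψ.f (zero_add b) (gamU D i)) -
        b.negOnePow • curvAct N (show 2 + e = a by omega) (ψ.f (show -1 + b = e by omega)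
          (gamV D i)) ∧
      φ.f (show -1 + a = b by omega) (gamV D i) = N.d he (ψ.f (show -1 + b = e by omega)
        (gamV D i)) - b.negOnePow • τ • ψ.f (zero_add b) (gamU D i) := by
  have hc : ψ.f (show 1 + b = a by omega) ((D.Gam i).d (zero_add 1) (gamU D i)) =
      curvAct N (show 2 + e = a by omega) (ψ.f (show -1 + b = e by omega) (gamV D i)) := by
    rw [d_gamU, curvAct, ψ.map_smul _ (show -1 + b = e by omega), Int.negOnePow_even _
      ⟨b, mul_two b⟩, _root_.one_smul]
    rfl
  have ht : ψ.f (zero_add b) ((D.Gam i).d (neg_add_cancel 1) (gamV D i)) =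
      τ • ψ.f (zero_add b) (gamU D i) := by rw [d_gamV, GMap.map_base]
  constructor
  · intro h
    rw [← hc, ← ht]
    exact ⟨h _ _ _ _ _, h _ _ _ _ _⟩
  · rintro ⟨h1, h2⟩
    have h3 := @gMap_ext _ _ _ _ _ i N a b φ (ψ.diff hb) (by omega)
      (by rw [GMap.diff_f ψ hb _ (zero_add 1) (zero_add b), hc, h1])
      (by rw [GMap.diff_f ψ hb _ (neg_add_cancel 1) (show -1 + b = e by omega), ht, h2])
    intro j j' l l' h hj hj' hi x
    rw [h3, GMap.diff_f ψ hb _ hi hj]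

/-- The zero homogeneous map. -/
def zeroGMap (M N : CDGModule.{u, v} D.toCDGAlgebra) (p : ℤ) : GMap M N p :=
  ⟨fun _ => 0, by intros; simp⟩

lemma isDiff_zero_iff {M N : CDGModule.{u, v} D.toCDGAlgebra} (hb : b + 1 = a)
    {ψ : GMap M N b} : (zeroGMap M N a).IsDiff ψ ↔ ψ.Closed := by
  constructor
  · intro h j j' l l' hj hj' hi x
    exact (sub_eq_zero.1 (h (show j + a = l' by omega) hj hj' hi x).symm)
  · intro h j j' l l' h1 hj hj' hi x
    exact (sub_eq_zero.2 (h hj hj' hi x)).symm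

lemma closed_iff (he : e + 1 = b) (hb : b + 1 = a) {ψ : GMap (D.Gam i) N b} : ψ.Closed ↔
    N.d hb (ψ.f (zero_add b) (gamU D i)) = b.negOnePow •
      curvAct N (show 2 + e = a by omega) (ψ.f (show -1 + b = e by omega) (gamV D i)) ∧
    N.d he (ψ.f (show -1 + b = e by omega) (gamV D i)) =
      b.negOnePow • τ • ψ.f (zero_add b) (gamU D i) := by
  rw [← isDiff_zero_iff hb, isDiff_iff hb he]
  exact and_congr (eq_comm.trans sub_eq_zero) (eq_comm.trans sub_eq_zero)

/-- The images of u and v form a closed pair once the value on v is multiplied by (-1)^q, and pair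
exactness supplies the pair defining the bounding map. -/
lemma orthogonal_gam (hN : D.IsAcyclic N) : Orthogonal (D.Gam i) N := by
  intro p q hq φ hφ
  have hp : p - 1 + 1 = p := by omega
  have hε := negOnePow_of_add_one hq
  obtain ⟨h1, h2⟩ := (closed_iff hq (show q + 1 = q + 1 from rfl)).1 hφ
  obtain ⟨x', y', hx', hy', hx, hy⟩ := hN.pairExact i (Nat.le_of_lt_succ i.2) hp hq rfl
    (φ.f (zero_add q) (gamU D i)) (q.negOnePow • φ.f (show -1 + q = p by omega) (gamV D i))
    (by rw [← GMap.map_base, pow_smul_gamU, map_zero])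
    (by rw [Units.smul_def, smul_comm, ← GMap.map_base, pow_smul_gamV, map_zero, smul_zero])
    (by rw [units_smul_map, h2, smul_smul, Int.units_mul_self, _root_.one_smul])
    (by rw [units_smul_map, h1])
  refine ⟨pairMap hp x' (q.negOnePow • y') hx' (by
    rw [Units.smul_def, smul_comm, hy', smul_zero]), (isDiff_iff hq hp).2 ?_⟩
  have hy2 := congrArg (q.negOnePow • ·) hy
  simp only [smul_smul, Int.units_mul_self, _root_.one_smul] at hy2
  rw [pairMap_gamU, pairMap_gamV, units_smul_map, units_smul_map, hx, hy2, hε]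
  rcases Int.units_eq_one_or p.negOnePow with e | e <;>
    simp [e, sub_eq_add_neg]

end Diff

end CDGDeformation

/-! ### Construction of resolutions -/

namespace CDGModule

variable {R : Type v} [CommRing R] {B : CDGAlgebra.{u, v} R} {σ : Type}

/-- In a cellular approximation `P → M`, a closed homogeneous map from a member of the family to
a stage of `P` is bounded in the next stage if its image in `M` is bounded, compatibly. -/
lemma exists_isDiff_of_cell {X : σ → CDGModule.{u, v} B} {M P F F' : CDGModule.{u, v} B}
    {f : P ⟶ M} {j : F ⟶ F'} {ι : F ⟶ P} {ι' : F' ⟶ P} (hj : j ≫ ι' = ι)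
    (hk : ∀ c : Cell X (ι ≫ f), ∃ k : NullHomotopy (c.φ ≫ j),
        ∀ {i l : ℤ} (h : i + -1 = l) x, f.f l (ι'.f l (k.s.f h x)) = c.h.s.f h x)
    {s : σ} {p q : ℤ} (h : p + 1 = q) {φ : GMap (X s) F q} {ψ : GMap (X s) M p} (hφ : φ.Closed)
    (hψ : (φ.postcomp (ι ≫ f)).IsDiff ψ) : ∃ K : GMap (X s) P p,
      (φ.postcomp ι).IsDiff K ∧ ∀ {i l : ℤ} (h : i + p = l) x, f.f l (K.f h x) = ψ.f h x := by
  -- Cells are morphisms of degree 0 from a shift of X s. The data (φ, ψ) are converted into a cell,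
  -- and the contraction found in F' is converted back into a map of degree p.
  obtain ⟨κ, hκ, hκf⟩ : ∃ κ : GMap ((X s).shift (-q)) F' (-1),
      (∀ {i r t : ℤ} (hr : i + -1 = r) (ht : i + 1 = t) (x : ((X s).shift (-q)).X i),
        j.f i ((φ.toShiftDom (add_neg_cancel q)).f (add_zero i) x) =
          F'.d (show r + 1 = i by omega) (κ.f hr x) +
            κ.f (show t + -1 = i by omega) (((X s).shift (-q)).d ht x)) ∧
      ∀ {i l : ℤ} (hl : i + -1 = l) (x : ((X s).shift (-q)).X i), f.f l (ι'.f l (κ.f hl x)) =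
        (ψ.toShiftDom (show p + -q = -1 by omega)).f hl x := by
    obtain ⟨k, hk⟩ := hk (Cell.ofGMap h φ ψ hφ hψ)
    exact ⟨k.s, k.eq, hk⟩
  have hK : (φ.postcomp j).IsDiff (κ.ofShiftDom (show p + -q = -1 by omega)) := by
    intro i i' l l' h1 hl hl' hi x
    have h2 := hκ (show l + -1 = l' by omega) (show l + 1 = i' + q by omega)
      ((X s).sh (-q) (show l + -q = i by omega) x)
    rw [GMap.toShiftDom_f φ _ _ (show l + -q = i by omega) h1, unsh_sh,
      sh_d _ _ (show i' + q + -q = i' by omega), units_smul_map, Int.negOnePow_neg,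
      negOnePow_of_add_one h] at h2
    rw [GMap.ofShiftDom_f κ _ hl (show l + -q = i by omega) (by omega),
      GMap.ofShiftDom_f κ _ _ (show i' + q + -q = i' by omega) (by omega), GMap.postcomp_f, h2,
      Units.neg_smul, sub_eq_add_neg]
  refine ⟨(κ.ofShiftDom (show p + -q = -1 by omega)).postcomp ι', ?_, fun {i l} hl x => ?_⟩
  · rw [← hj]
    exact hK.map_d ι'
  · rw [GMap.postcomp_f, GMap.ofShiftDom_f κ _ hl (show i + q + -q = i by omega) (by omega), hκf,
      GMap.toShiftDom_f ψ _ _ (show i + q + -q = i by omega) hl, unsh_sh]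

end CDGModule

namespace CDGDeformation

open CDGModule

variable {k : Type v} [CommRing k] {A : DGAlgebra.{u, v} k} {n : ℕ} {D : CDGDeformation A n}

local notation "τ" => TruncPoly.t k n

lemma cfst_curvAct {M N : CDGModule.{u, v} D.toCDGAlgebra} {f : M ⟶ N} {i j i' j' : ℤ}
    (h : 2 + i = j) (hi : i + 1 = i') (hj : j + 1 = j') (x : (cone f).X i) :
    cfst f hj (curvAct (cone f) h x) = curvAct M (by omega) (cfst f hi x) := by
  rw [curvAct, cfst_smul h hi hj, Int.negOnePow_even 2 ⟨1, rfl⟩, _root_.one_smul]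
  rfl

lemma csnd_curvAct {M N : CDGModule.{u, v} D.toCDGAlgebra} {f : M ⟶ N} {i j : ℤ}
    (h : 2 + i = j) (x : (cone f).X i) :
    csnd f j (curvAct (cone f) h x) = curvAct N h (csnd f i x) := rfl

lemma map_curvAct {M N : CDGModule.{u, v} D.toCDGAlgebra} (f : M ⟶ N) {i j : ℤ}
    (h : 2 + i = j) (x : M.X i) : f.f j (curvAct M h x) = curvAct N h (f.f i x) :=
  f.map_smul _ _ _

variable (D) in
/-- Every module has an `n`-semifree and `n`-cell resolution. -/
lemma exists_resolution (M : CDGModule.{u, v} D.toCDGAlgebra) :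
    ∃ (P : CDGModule.{u, v} D.toCDGAlgebra) (f : P ⟶ M),
      D.IsSemifree P ∧ D.IsCell (Hot.of P) ∧ D.IsQuasiIso f := by
  obtain ⟨P, f, F, j, ι, hP, hP', hj, hinj, hsurj, hk⟩ := exists_cellular_approximation D.Gam M
  refine ⟨P, f, hP, hP', isAcyclic_iff_pairExact.2 ?_⟩
  intro m hm e b a l hb ha hl x y hx hy hdy hdx
  -- The two elements of P coming from the pair are placed in a common stage.
  have hstage : ∀ {r r' : ℕ}, r ≤ r' → ∀ i (x : P.X i), (∃ z, (ι r).f i z = x) →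
      ∃ z, (ι r').f i z = x := by
    intro r r' h i x hx
    induction h with
    | refl => exact hx
    | step _ ih =>
      obtain ⟨z, hz⟩ := ih
      refine ⟨(j _).f i z, ?_⟩
      rw [← hz, ← comp_f, hj]
  obtain ⟨r, X, Y, hX, hY⟩ : ∃ r X Y, (ι r).f l X = cfst f hl x ∧
      (ι r).f a Y = -cfst f ha y := by
    obtain ⟨r, X, hX⟩ := hsurj l (cfst f hl x)
    obtain ⟨s, Y, hY⟩ := hsurj a (-cfst f ha y)
    obtain ⟨X', hX'⟩ := hstage (le_max_left r s) _ _ ⟨X, hX⟩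
    obtain ⟨Y', hY'⟩ := hstage (le_max_right r s) _ _ ⟨Y, hY⟩
    exact ⟨max r s, X', Y', hX', hY'⟩
  have hx1 := congrArg (cfst f hl) hx
  have hy1 := congrArg (cfst f ha) hy
  have hdy1 := congrArg (cfst f hl) hdy
  have hdy2 := congrArg (csnd f a) hdy
  have hdx1 := congrArg (cfst f (show l + 1 = l + 1 from rfl)) hdx
  have hdx2 := congrArg (csnd f l) hdx
  have hx2 := congrArg (csnd f a) hx
  have hy2 := congrArg (csnd f b) hy
  simp only [cfst_base, csnd_base, map_zero, cfst_d ha hl, cfst_d hl rfl, csnd_d ha, csnd_d hl,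
    cfst_curvAct _ ha, csnd_curvAct] at hx1 hy1 hdy1 hdy2 hdx1 hdx2 hx2 hy2
  have ε := negOnePow_of_add_one hl
  -- The differential of the cone is -d on the source part, so (X, Y) = (x₁, -y₁) satisfies the
  -- relations of a closed pair in P, and in F r since the stage injects into P. The target parts
  -- (-x₂, y₂) bound its image in M.
  let i : Fin (n + 1) := ⟨m, Nat.lt_succ_of_le hm⟩
  let φ : GMap (D.Gam i) (F r) l := pairMap hl X (l.negOnePow • Y)
    (hinj r l (by rw [Hom.map_base, hX, hx1, map_zero]))
    (hinj r a (by rw [Hom.map_base, units_smul_map, hY, Units.smul_def, smul_comm, smul_neg, hy1,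
      neg_zero, smul_zero, map_zero]))
  have hφ : φ.Closed := by
    refine (closed_iff hl rfl).2 ?_
    rw [pairMap_gamU, pairMap_gamV]
    constructor
    · refine hinj r _ ?_
      rw [units_smul_map, units_smul_map, units_smul_map, smul_smul, Int.units_mul_self,
        _root_.one_smul, Hom.map_d, map_curvAct, hX, hY, map_neg, ← hdx1, neg_neg]
    · refine hinj r _ ?_
      rw [units_smul_map, units_smul_map, units_smul_map, Hom.map_d, Hom.map_base, hX, hY, map_neg,
        hdy1]
  let ψ : GMap (D.Gam i) M a := pairMap ha (-csnd f a x) (l.negOnePow • csnd f b y)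
    (by rw [smul_neg, hx2, neg_zero]) (by rw [Units.smul_def, smul_comm, hy2, smul_zero])
  have hψ : (φ.postcomp (ι r ≫ f)).IsDiff ψ := by
    refine (isDiff_iff hl ha).2 ?_
    rw [GMap.postcomp_f, GMap.postcomp_f, pairMap_gamU, pairMap_gamU, pairMap_gamV, pairMap_gamV,
      comp_f, comp_f, units_smul_map, units_smul_map, units_smul_map, units_smul_map, hX, hY, ε,
      eq_sub_of_add_eq hdx2, map_neg (f.f a), eq_sub_of_add_eq hdy2]
    rcases Int.units_eq_one_or a.negOnePow with e | e <;>
      simp only [e, _root_.one_smul, Units.neg_smul, neg_neg, map_neg, smul_neg] <;>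
      constructor <;> abel
  -- K bounds the pair in P and satisfies f K = ψ exactly. This is why placing K in the source part
  -- of the cone also produces the target components of x and y.
  obtain ⟨K, hK, hfK⟩ := exists_isDiff_of_cell (hj r) (hk r) hl hφ hψ
  obtain ⟨h1, h2⟩ := (isDiff_iff hl ha).1 hK
  rw [GMap.postcomp_f, pairMap_gamU, hX] at h1
  rw [GMap.postcomp_f, pairMap_gamV, units_smul_map, hY] at h2
  have hu := hfK (zero_add a) (gamU D i)
  have hv := hfK (show -1 + a = b by omega) (gamV D i)
  rw [pairMap_gamU] at hu
  rw [pairMap_gamV] at hv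
  have hK1 : τ ^ (m + 1) • K.f (zero_add a) (gamU D i) = 0 := by
    rw [← GMap.map_base, pow_smul_gamU (i := i), map_zero]
  have hK2 : τ ^ m • K.f (show -1 + a = b by omega) (gamV D i) = 0 := by
    rw [← GMap.map_base, pow_smul_gamV (i := i), map_zero]
  refine ⟨-cinl f ha (K.f (zero_add a) (gamU D i)),
    l.negOnePow • cinl f hb (K.f (show -1 + a = b by omega) (gamV D i)), ?_, ?_, ?_, ?_⟩
  · rw [smul_neg, ← cinl_base, hK1, map_zero, neg_zero]
  · rw [Units.smul_def, smul_comm, ← cinl_base, hK2, map_zero, smul_zero]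
  · refine cone_ext hl ?_ ?_
    · rw [h1, ε]
      simp only [map_add, map_neg, cfst_curvAct _ hb, cfst_d ha hl, units_smul_map, cfst_cinl,
        Units.neg_smul, neg_neg, sub_eq_add_neg]
    · simp only [map_add, map_neg, csnd_curvAct, csnd_d ha, units_smul_map, cfst_cinl, csnd_cinl,
        map_zero, smul_zero, hu, neg_neg, add_zero]
  · have h3 := congrArg (l.negOnePow • ·) h2
    simp only [smul_smul, Int.units_mul_self, _root_.one_smul] at h3
    refine cone_ext ha ?_ ?_
    · rw [neg_eq_iff_eq_neg.1 h3, ε]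
      simp only [map_add, map_neg, cfst_d hb ha, units_smul_map, cfst_cinl, cfst_base]
      rcases Int.units_eq_one_or a.negOnePow with e | e <;>
        simp only [e, _root_.one_smul, Units.neg_smul, neg_neg, smul_neg] <;> abel
    · simp only [map_add, map_neg, csnd_d hb, units_smul_map, cfst_cinl, csnd_cinl, csnd_base,
        map_zero, smul_zero, hv, smul_smul, Int.units_mul_self, _root_.one_smul, neg_zero,
        add_zero]

end CDGDeformation

/-! ### Left adjoints from resolutions -/

/-- If every object has a `W`-resolution by an object of `T`, and the maps out of objects of `T` do
not see the difference between the source and the target of a morphism in `W`, then the localization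
functor at `W` has a fully faithful left adjoint, with essential image `T`. -/
lemma exists_leftAdjoint_of_resolutions {C : Type*} [Category* C] (W : MorphismProperty C)
    (T : ObjectProperty C) [T.IsClosedUnderIsomorphisms]
    (hT : ∀ X, T X → ∀ ⦃M N : C⦄ (g : M ⟶ N), W g →
      Function.Bijective fun a : X ⟶ M => a ≫ g)
    (hW : ∀ M, ∃ (P : C) (s : P ⟶ M), T P ∧ W s) :
    ∃ (p : W.Localization ⥤ C) (_ : p ⊣ W.Q),
      p.Full ∧ p.Faithful ∧ ∀ M : C, p.essImage M ↔ T M := by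
  choose P s hP hs using hW
  -- Composition with the resolution of M is bijective on maps out of X in T, so M ↦ P M is right
  -- adjoint to the inclusion, with the resolutions as counit.
  let e (X : T.FullSubcategory) (M : C) : (T.ι.obj X ⟶ M) ≃ (X ⟶ ⟨P M, hP M⟩) :=
    (Equiv.ofBijective _ (hT X.obj X.property (s M) (hs M))).symm.trans
      (T.fullyFaithfulι.homEquiv (X := X) (Y := ⟨P M, hP M⟩)).symm
  have he' : ∀ (X : T.FullSubcategory) (M : C) (a : X ⟶ (⟨P M, hP M⟩ : T.FullSubcategory)),
      (e X M).symm a = a.hom ≫ s M := fun _ _ _ => rfl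
  have he : ∀ X' X M (f : X' ⟶ X) (g : T.ι.obj X ⟶ M),
      e X' M (T.ι.map f ≫ g) = f ≫ e X M g := fun X' X M f g => by
    obtain ⟨a, rfl⟩ := (e X M).symm.surjective g
    rw [Equiv.apply_symm_apply, ← Equiv.eq_symm_apply, he', he']
    simp
  let R := Adjunction.rightAdjointOfEquiv e he
  let adj : T.ι ⊣ R := Adjunction.adjunctionOfEquivRight e he
  -- By Yoneda in T: under the adjunction, composition with R g is composition with g, which is
  -- bijective by hypothesis.
  have hR : W.IsInvertedBy R := fun M N g hg => by
    refine isIso_of_yoneda_map_bijective _ fun X => ?_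
    have h : (fun a : X ⟶ R.obj M => a ≫ R.map g) =
        adj.homEquiv X N ∘ (fun a => a ≫ g) ∘ (adj.homEquiv X M).symm := by
      funext a
      refine Eq.trans ?_ (adj.homEquiv_naturality_right _ _).symm
      rw [Equiv.apply_symm_apply]
    rw [h]
    exact (Equiv.bijective _).comp ((hT X.obj X.property g hg).comp (Equiv.bijective _))
  have hcounit : (W.functorCategory C) adj.counit := fun M => by
    have : adj.counit.app M = s M :=
      (Adjunction.adjunctionOfEquivRight_counit_app e he M).trans
        ((he' (R.obj M) M (𝟙 _)).trans (Category.id_comp (s M)))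
    rw [this]
    exact hs M
  -- R inverts W, its left adjoint is fully faithful and its counit lies in W, so R is itself a
  -- localization at W. Hence the localized category is equivalent to T, and the inclusion of T
  -- becomes the left adjoint sought.
  have := adj.isLocalization_rightAdjoint W hR hcounit
  let E := Localization.equivalenceFromModel R W
  let iso : R ⋙ E.inverse ≅ W.Q :=
    Functor.isoWhiskerRight (Localization.qCompEquivalenceFromModelFunctorIso R W).symm E.inverse ≪≫
      Functor.associator _ _ _ ≪≫ Functor.isoWhiskerLeft W.Q E.unitIso.symm ≪≫
        Functor.rightUnitor _
  refine ⟨E.functor ⋙ T.ι, (E.toAdjunction.comp adj).ofNatIsoRight iso, inferInstance,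
    inferInstance, fun M => ⟨?_, fun hM => ?_⟩⟩
  · rintro ⟨X, ⟨i⟩⟩
    exact T.prop_of_iso i (E.functor.obj X).property
  · exact ⟨E.inverse.obj ⟨M, hM⟩, ⟨T.ι.mapIso (E.counitIso.app ⟨M, hM⟩)⟩⟩

/-! ### Cell modules and homotopy projective modules -/

namespace Hot

variable {R : Type v} [CommRing R] {B : CDGAlgebra.{u, v} R}

lemma isLocalizing_isCell {σ : Type} (X : σ → CDGModule.{u, v} B) : IsLocalizing (IsCell X) where
  iso := ⟨fun e h T hT hX => have := hT.iso; T.prop_of_iso e (h T hT hX)⟩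
  zero Z hZ _ hT _ := hT.zero Z hZ
  shift M p h T hT hX := hT.shift M p (h T hT hX)
  cone₁ f h h' T hT hX := hT.cone₁ f (h T hT hX) (h' T hT hX)
  cone₂ f h h' T hT hX := hT.cone₂ f (h T hT hX) (h' T hT hX)
  cone₃ f h h' T hT hX := hT.cone₃ f (h T hT hX) (h' T hT hX)
  coproduct ι Y c hc h T hT hX := hT.coproduct ι Y c hc fun s => h s T hT hX

end Hot

namespace CDGDeformation

open CDGModule

variable {k : Type v} [CommRing k] {A : DGAlgebra.{u, v} k} {n : ℕ} {D : CDGDeformation A n}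

/-- Acyclic modules are stable under shifts, so vanishing of maps of degree 0 to all of them gives
vanishing in every degree. -/
lemma isHomotopyProjective_iff {P : CDGModule.{u, v} D.toCDGAlgebra} :
    D.IsHomotopyProjective (Hot.of P) ↔
      ∀ N : CDGModule.{u, v} D.toCDGAlgebra, D.IsAcyclic N → Orthogonal P N := by
  refine ⟨fun h N hN => orthogonal_of_homotopic fun r f g => ?_, fun h N hN => ⟨fun f g => ?_⟩⟩
  · have := h (N.shift r) (hN.shift r)
    exact (Hot.mk_eq_iff _ _).1 (Subsingleton.elim _ _)
  · obtain ⟨f, rfl⟩ := Hot.mk_surjective f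
    obtain ⟨g, rfl⟩ := Hot.mk_surjective g
    exact (Hot.mk_eq_iff _ _).2 (homotopic_of_orthogonal (h N hN) f g)

variable (D) in
lemma isLocalizing_isHomotopyProjective :
    Hot.IsLocalizing (D.IsHomotopyProjective : ObjectProperty (Hot D.toCDGAlgebra)) where
  iso := ⟨fun e h N hN => ⟨fun f g => by
    have := h N hN
    rw [← e.inv_hom_id_assoc f, ← e.inv_hom_id_assoc g, Subsingleton.elim (e.hom ≫ f)]⟩⟩
  zero Z hZ N _ := ⟨hZ.eq_of_src⟩
  shift M p h := isHomotopyProjective_iff.2 fun N hN =>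
    orthogonal_shift (isHomotopyProjective_iff.1 h N hN) p
  cone₁ f h h' := isHomotopyProjective_iff.2 fun N hN =>
    orthogonal_cone_source (isHomotopyProjective_iff.1 h N hN) (isHomotopyProjective_iff.1 h' N hN)
  cone₂ f h h' := isHomotopyProjective_iff.2 fun N hN =>
    orthogonal_cone_target (isHomotopyProjective_iff.1 h N hN) (isHomotopyProjective_iff.1 h' N hN)
  cone₃ f h h' := isHomotopyProjective_iff.2 fun N hN =>
    orthogonal_cone (isHomotopyProjective_iff.1 h N hN) (isHomotopyProjective_iff.1 h' N hN)
  coproduct ι Y c hc h N hN := ⟨fun f g => hc.some.hom_ext fun ⟨s⟩ =>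
    @Subsingleton.elim _ (h s N hN) _ _⟩

lemma IsCell.isHomotopyProjective {M : Hot D.toCDGAlgebra} (hM : D.IsCell M) :
    D.IsHomotopyProjective M :=
  hM _ D.isLocalizing_isHomotopyProjective fun _ =>
    isHomotopyProjective_iff.2 fun _ hN => orthogonal_gam hN

/-- The cone of a cellular resolution of M is acyclic, and homotopy projective since both ends are.
It is therefore orthogonal to itself, hence zero, and M follows from P by two out of three. -/
lemma IsHomotopyProjective.isCell {M : CDGModule.{u, v} D.toCDGAlgebra}
    (hM : D.IsHomotopyProjective (Hot.of M)) : D.IsCell (Hot.of M) := by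
  obtain ⟨P, f, -, hP, hf⟩ := D.exists_resolution M
  have hC := D.isLocalizing_isHomotopyProjective.cone₃ f hP.isHomotopyProjective hM
  exact (Hot.isLocalizing_isCell D.Gam).cone₂ f hP ((Hot.isLocalizing_isCell D.Gam).zero _
    (Hot.isZero_of_homotopic (homotopic_of_orthogonal (isHomotopyProjective_iff.1 hC _ hf) _ _)))

end CDGDeformation

theorem mainTheorem9 {k : Type v} [CommRing k] (A : DGAlgebra.{u, v} k) (n : ℕ)
    (D : CDGDeformation A n) :
    (∀ M : CDGModule.{u, v} D.toCDGAlgebra, ∃ (P : CDGModule.{u, v} D.toCDGAlgebra) (f : P ⟶ M),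
      D.IsSemifree P ∧ D.IsCell (Hot.of P) ∧ D.IsQuasiIso f) ∧
    (∃ (p : D.NDerived ⥤ Hot D.toCDGAlgebra) (_ : p ⊣ D.quotientFunctor),
      p.Full ∧ p.Faithful ∧ ∀ M : Hot D.toCDGAlgebra, p.essImage M ↔ D.IsCell M) ∧
    (∀ M : Hot D.toCDGAlgebra, D.IsCell M ↔ D.IsHomotopyProjective M) := by
  refine ⟨D.exists_resolution, ?_, fun M => ⟨fun h => h.isHomotopyProjective,
    fun h => CDGDeformation.IsHomotopyProjective.isCell (M := M.as) h⟩⟩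
  have : ObjectProperty.IsClosedUnderIsomorphisms
      (D.IsCell : ObjectProperty (Hot D.toCDGAlgebra)) := (Hot.isLocalizing_isCell D.Gam).iso
  refine exists_leftAdjoint_of_resolutions D.quasiIso D.IsCell ?_ fun M => ?_
  · rintro X hX M N _ ⟨g, hg, rfl⟩
    exact Hot.bijective_comp_mk (P := X.as)
      (CDGDeformation.isHomotopyProjective_iff.1 hX.isHomotopyProjective _ hg)
  · obtain ⟨P, f, -, hP, hf⟩ := D.exists_resolution M.as
    exact ⟨Hot.of P, Hot.mk f, hP, f, hf, rfl⟩
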